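/- Let $\Omega\subset\mathbb R^3$ be a bounded open set, $T>0$, $Q_T=\Omega\times(0,T)$, and let $\lambda\in C_0^\infty(Q_T)$ be a nonnegative function. Let $\nu_1>0$, $\nu_1+\nu_2\ge 0$, let $\mu\in(0,2/3)$ and $\alpha=4\mu/5$, and let $E,M\in\mathbb R$. Then there is a constant $c$, depending only on $\Omega,T,\lambda,\nu_1,\nu_2,\mu,E,M$, such that the following holds for all $\varepsilon>0$ and $m>1$. Put $p(s)=s^{3/2}(1+\varepsilon s^m)$ and $\mathbb S(\mathbf u)=\nu_1(\nabla\mathbf u+\nabla\mathbf u^\top)+\nu_2\,\mathrm{div}\,\mathbf u\,\mathbb I$. Let $\mathbf f:Q_T\to\mathbb R^3$ be measurable with $|\mathbf f|\le M$ a.e., and let $\varrho\ge 0$ and $\mathbf u$ be measurable functions on $Q_T$ such that $\mathbf u(\cdot,t)$ has a weak gradient in $\Omega$ for a.e. $t\in(0,T)$, given by a measurable function $\nabla\mathbf u$ on $Q_T$, and such that $$\|p(\varrho)\|_{L^\infty(0,T;L^1(\Omega))}+\|\varrho|\mathbf u|^2\|_{L^\infty(0,T;L^1(\Omega))}+\|\mathbf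 u\|_{L^2(0,T;W^{1,2}(\Omega))}\le E .$$ Suppose that $(\varrho,\mathbf u)$ is a weak solution of the compressible Navier–Stokes equations in $Q_T$, that is, $$\int_{Q_T}\varrho\mathbf u\cdot\partial_t\boldsymbol\xi\,dxdt+\int_{Q_T}\big(\varrho\mathbf u\otimes\mathbf u+p(\varrho)\mathbb I-\mathbb S(\mathbf u)\big):\nabla\boldsymbol\xi\,dxdt+\int_{Q_T}\varrho\mathbf f\cdot\boldsymbol\xi\,dxdt=0,$$ $$\int_{Q_T}\big(\varrho\,\partial_t\psi+\varrho\mathbf u\cdot\nabla\psi\big)\,dxdt=0$$ for all vector fields $\boldsymbol\xi\in C_0^\infty(Q_T)$ and all functions $\psi\in C_0^\infty(Q_T)$. Set $\rho=\lambda^4\varrho$ and $\mathbf v=\lambda\mathbf u$, extended by zero to $\mathbb R^3\times\mathbb R$, and $$\mathbf H(t)=\int_{\mathbb R^3}\rho|\mathbf v|^2\big(\log(1+\rho|\mathbf v|^2)\big)^{\alpha}\,dx,\qquad \mathbf N(t)=\|\mathbf v(\cdot,t)\|_{W^{1,2}(\mathbb R^3)} .$$ Then there is an integrable function $F:\mathbb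 R\to[0,\infty)$ such that $\int_{\mathbb R}F(t)\,dt\le c$ and, for almost every $t\in\mathbb R$, $\mathbf N(t)<\infty$ and $$\mathbf H(t)\le F(t)\,\mathbf N(t)^{4/5}\qquad\text{and}\qquad \mathbf H(t)\le F(t)\,\mathbf N(t)^{5/4}.$$ -/

import Mathlib

open MeasureTheory Set
open scoped ENNReal ContDiff

noncomputable section

namespace CNS

/-- Physical space with the Euclidean norm. -/
abbrev R3 : Type := EuclideanSpace ℝ (Fin 3)

/-- The `j`-th vector of the standard basis. -/
def e (j : Fin 3) : R3 := EuclideanSpace.single j 1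

/-- The open space-time cylinder over `Ω`; points of space-time are pairs `(x, t)`. -/
def cylinder (Ω : Set R3) (T : ℝ) : Set (R3 × ℝ) := Ω ×ˢ Ioo 0 T

/-- Smooth functions with compact support contained in the set `U`. -/
def IsTest {X Y : Type*} [NormedAddCommGroup X] [NormedSpace ℝ X]
    [NormedAddCommGroup Y] [NormedSpace ℝ Y] (U : Set X) (φ : X → Y) : Prop :=
  ContDiff ℝ ∞ φ ∧ HasCompactSupport φ ∧ tsupport φ ⊆ U

/-- Time derivative of a function on space-time. -/
def dt {Y : Type*} [NormedAddCommGroup Y] [NormedSpace ℝ Y] (φ : R3 × ℝ → Y) (z : R3 × ℝ) : Y :=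
  fderiv ℝ φ z (0, 1)

/-- Spatial partial derivative in the direction `j` of a function on space-time. -/
def dx {Y : Type*} [NormedAddCommGroup Y] [NormedSpace ℝ Y] (j : Fin 3) (φ : R3 × ℝ → Y)
    (z : R3 × ℝ) : Y :=
  fderiv ℝ φ z (e j, 0)

/-- `G` is the weak gradient of the vector field `g` in the open set `U`:
`G x j` is the weak partial derivative of `g` in the direction `j`. -/
def HasWeakGradient (U : Set R3) (g : R3 → R3) (G : R3 → Fin 3 → R3) : Prop :=
  LocallyIntegrableOn g U ∧
    ∀ j, LocallyIntegrableOn (fun x => G x j) U ∧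
      ∀ φ : R3 → ℝ, IsTest U φ →
        ∫ x, (fderiv ℝ φ x (e j)) • g x = - ∫ x, φ x • G x j

/-- The norm of `W^{1,2}(U)`. The weak gradient is unique up to null sets, so the infimum is over
one value; it is `∞` if there is no weak gradient. -/
def sobolevNorm (U : Set R3) (g : R3 → R3) : ℝ≥0∞ :=
  (⨅ (G : R3 → Fin 3 → R3) (_ : HasWeakGradient U g G),
    ∫⁻ x in U, ENNReal.ofReal (‖g x‖ ^ 2 + ∑ j, ‖G x j‖ ^ 2)) ^ (1 / 2 : ℝ)

/-- The regularized critical pressure, as a function of the density. -/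
def pressure (ε m s : ℝ) : ℝ := s ^ (3 / 2 : ℝ) * (1 + ε * s ^ m)

/-- The viscous stress tensor, where `A j i` is the derivative of the `i`-th component of the
velocity in the direction `j`. -/
def stress (ν₁ ν₂ : ℝ) (A : Fin 3 → R3) (i j : Fin 3) : ℝ :=
  ν₁ * (A j i + A i j) + (if i = j then ν₂ * ∑ k, A k k else 0)

/-- The sum of the norms of the pressure in `L^∞(0,T; L^1(Ω))`, of the kinetic energy density in
`L^∞(0,T; L^1(Ω))`, and of the velocity in `L^2(0,T; W^{1,2}(Ω))`. -/
def energy (Ω : Set R3) (T ε m : ℝ) (ϱ : R3 × ℝ → ℝ) (u : R3 × ℝ → R3) : ℝ≥0∞ :=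
  essSup (fun t => ∫⁻ x in Ω, ENNReal.ofReal (pressure ε m (ϱ (x, t)))) (volume.restrict (Ioo 0 T))
    + essSup (fun t => ∫⁻ x in Ω, ENNReal.ofReal (ϱ (x, t) * ‖u (x, t)‖ ^ 2))
        (volume.restrict (Ioo 0 T))
    + (∫⁻ t in Ioo 0 T, sobolevNorm Ω (fun x => u (x, t)) ^ 2) ^ (1 / 2 : ℝ)

/-- Weak solutions in the cylinder of the compressible Navier-Stokes equations with the regularized
critical pressure, force `f`, density `ϱ` and velocity `u`. The field `Du` is the spatial gradient
of the velocity, `Du z j` being its derivative in the direction `j`. -/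
structure IsWeakSolution (Ω : Set R3) (T ν₁ ν₂ ε m : ℝ) (f : R3 × ℝ → R3)
    (ϱ : R3 × ℝ → ℝ) (u : R3 × ℝ → R3) (Du : R3 × ℝ → Fin 3 → R3) : Prop where
  density_measurable : AEStronglyMeasurable ϱ (volume.restrict (cylinder Ω T))
  density_nonneg : ∀ᵐ z ∂(volume.restrict (cylinder Ω T)), 0 ≤ ϱ z
  velocity_measurable : AEStronglyMeasurable u (volume.restrict (cylinder Ω T))
  gradient_measurable : AEStronglyMeasurable Du (volume.restrict (cylinder Ω T))
  gradient_weak : ∀ᵐ t ∂(volume.restrict (Ioo 0 T)),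
    HasWeakGradient Ω (fun x => u (x, t)) (fun x => Du (x, t))
  momentum : ∀ ξ : R3 × ℝ → R3, IsTest (cylinder Ω T) ξ →
    (∫ z in cylinder Ω T, ϱ z * inner ℝ (u z) (dt ξ z))
      + (∫ z in cylinder Ω T, ∑ i, ∑ j,
          (ϱ z * u z i * u z j + (if i = j then pressure ε m (ϱ z) else 0)
            - stress ν₁ ν₂ (Du z) i j) * dx j ξ z i)
      + (∫ z in cylinder Ω T, ϱ z * inner ℝ (f z) (ξ z)) = 0
  mass : ∀ ψ : R3 × ℝ → ℝ, IsTest (cylinder Ω T) ψ →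
    ∫ z in cylinder Ω T, (ϱ z * dt ψ z + ∑ j, ϱ z * u z j * dx j ψ z) = 0

/-- The localized density. -/
def locDensity (lam ϱ : R3 × ℝ → ℝ) (z : R3 × ℝ) : ℝ := lam z ^ 4 * ϱ z

/-- The localized velocity. -/
def locVelocity (lam : R3 × ℝ → ℝ) (u : R3 × ℝ → R3) (z : R3 × ℝ) : R3 := lam z • u z

/-- The logarithmic kinetic energy of the density `ρ` and the velocity `v` at time `t`. -/
def H (α : ℝ) (ρ : R3 × ℝ → ℝ) (v : R3 × ℝ → R3) (t : ℝ) : ℝ≥0∞ :=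
  ∫⁻ x, ENNReal.ofReal (ρ (x, t) * ‖v (x, t)‖ ^ 2
    * Real.log (1 + ρ (x, t) * ‖v (x, t)‖ ^ 2) ^ α)

/-- The norm in `W^{1,2}` of the whole space of the velocity `v` at time `t`. -/
def N (v : R3 × ℝ → R3) (t : ℝ) : ℝ≥0∞ := sobolevNorm univ (fun x => v (x, t))

end CNS

end

open Filter Topology

namespace CNS

/-! The proof is an interaction Morawetz argument with a logarithmically weighted kernel, followed
by a potential estimate.

Interaction. Test the momentum equation at `x` with `ϱ(y) K(x - y)` and the mass equation at `y`
with `ϱ(x) u(x) · K(x - y)`, localise both by `Λ = λ²`, and add. The time derivatives cancel, and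
the remaining terms integrate to zero (`Flow.integral_doubled_eq_zero`). Since `ϱ` and `u` are not
admissible in test functions, the two equations are taken at different times `t`, `t'` with a
mollifier in `t - t'`; its derivative enters the two equations with opposite signs, and the other
terms pass to the limit `t = t'` (`tendsto_integral_timeMoll_prodKer`).

The kernel is `K(z) = ell(|z|²)^s z / |z|`, with `|z|²` regularised to `|z|² + δ`, where `ell w = 4
+ log(1 + 1/w)` and `s = 2μ`. Symmetrising in `x`, `y` (`Flow.interaction_symm`), the principal part
is `ϱ ϱ' (u - u') ⊗ (u - u') : ∇K + (p ϱ' + p' ϱ) div K` minus viscous terms. As `div K ≥ ell^s /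
|z|` up to the regularisation and `p(ϱ) ≥ ϱ^{3/2}`, the pressure controls the interaction energy `λ²
λ'² ϱ^{3/2} ϱ' ell^s / |x - y|`. The logarithm spoils the sign of the quadratic form, but only by
`2s ell^{s-1} / |z|`, one power of `ell` better. In `kinetic_young` this is absorbed into half of
the interaction energy, up to products of `(λ|u|)^6 / D² + ϱ|u|² D` with `ϱ'^{3/2}` and with
`|z|^{-3} ell^{-(5-3s)}`, where `D(t) = 1 + ‖u(t)‖²_{W^{1,2}}`. The first factor is integrable in
space-time by the Sobolev inequality and the energy bound; the kernel is integrable near `0` exactly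
when `5 - 3s > 1`, that is `μ < 2/3`. All constants are independent of `ε`, `m` and `δ`, and `δ → 0`
by Fatou's lemma.

Potential estimate. The Riesz bound `|g| ≤ C |∇g| * |·|^{-2}` for smooth `g`, together with
`|·|^{-2} * |·|^{-2} ≤ C |·|^{-1}`, gives `(∫ a |g|)² ≤ C ‖∇g‖² ∬ a a' / |x - y|`
(`exists_sq_lintegral_mul_enorm_le`). It is used with `g = v` and `a = ρ^{5/4} log(1 + ρ|v|²)^μ`.
Each `log` is bounded by `ell` unless `ρ|v|²` exceeds a power of `1 / |x - y|`, and then a small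
power of the kinetic energy pays for everything; so the double integral is bounded by the
interaction energy `B(t)` at time `t` plus a constant.

Conclusion. Since `ρ|v|² log^α = (a|v|)^{4/5} (|v|^6)^{1/5}` for `α = 4μ/5`, Hölder's and Sobolev's
inequalities give `H ≤ C (1 + B)^{2/5} N²` (`Flow.H_le`). Splitting `N²` as `(N²)^{3/5} N^{4/5}` and
as `(N²)^{3/8} N^{5/4}` leaves factors which are integrable in time, because `B` and `N²` are. -/

/-! ### Doubling of the time variable and traces on `t = t'`. -/

lemma measurePreserving_prodProdProdComm {α β γ δ : Type*} [MeasureSpace α] [MeasureSpace β]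
    [MeasureSpace γ] [MeasureSpace δ] [SFinite (volume : Measure α)] [SFinite (volume : Measure β)]
    [SFinite (volume : Measure γ)] [SFinite (volume : Measure δ)] :
    MeasurePreserving (fun q : (α × β) × γ × δ => ((q.1.1, q.2.1), (q.1.2, q.2.2))) := by
  have h1 : MeasurePreserving (MeasurableEquiv.prodAssoc : (α × β) × γ × δ ≃ᵐ _) :=
    measurePreserving_prodAssoc _ _ _
  have h2 : MeasurePreserving (MeasurableEquiv.prodAssoc : (β × γ) × δ ≃ᵐ _) :=
    measurePreserving_prodAssoc _ _ _
  have h3 : MeasurePreserving (MeasurableEquiv.prodAssoc : (γ × β) × δ ≃ᵐ _) :=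
    measurePreserving_prodAssoc _ _ _
  have h4 : MeasurePreserving (MeasurableEquiv.prodAssoc : (α × γ) × β × δ ≃ᵐ _) :=
    measurePreserving_prodAssoc _ _ _
  have h5 : MeasurePreserving (Prod.map Prod.swap id : (β × γ) × δ → (γ × β) × δ) :=
    (Measure.measurePreserving_swap (μ := (volume : Measure β)) (ν := (volume : Measure γ))).prod
      (MeasurePreserving.id _)
  have h6 := h3.comp (h5.comp (h2.symm _))
  have h7 := (MeasurePreserving.id (volume : Measure α)).prod h6
  exact (h4.symm _).comp (h7.comp h1)

/-- The coordinates for the limit on the time diagonal: for two space-time points, both spatial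
variables are kept, and the time variables become the difference, seen by the mollifier, and the
second time. -/
lemma measurePreserving_shear :
    MeasurePreserving (fun q : (R3 × R3) × ℝ × ℝ => ((q.1.1, q.2.1 + q.2.2), (q.1.2, q.2.2))) := by
  have h1 : MeasurePreserving (fun z : ℝ × ℝ => (z.1 + z.2, z.2)) :=
    measurePreserving_add_prod _ _
  exact measurePreserving_prodProdProdComm.comp
    ((MeasurePreserving.id (volume : Measure (R3 × R3))).prod h1)

/-- A product of two merely integrable functions need not be integrable on `t = t'`; it suffices
that one of them is bounded in time with values in `L¹` of space. -/
lemma lintegral_diag_le {a b : R3 × ℝ → ℝ≥0∞} (ha : Measurable a) (hb : Measurable b) {C : ℝ≥0∞}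
    (hC : ∀ᵐ t : ℝ, ∫⁻ x, b (x, t) ≤ C) :
    ∫⁻ d : (R3 × R3) × ℝ, a (d.1.1, d.2) * b (d.1.2, d.2) ≤ C * ∫⁻ z, a z := by
  have hm : Measurable fun d : (R3 × R3) × ℝ => a (d.1.1, d.2) * b (d.1.2, d.2) := by fun_prop
  calc ∫⁻ d : (R3 × R3) × ℝ, a (d.1.1, d.2) * b (d.1.2, d.2)
      = ∫⁻ t, ∫⁻ p : R3 × R3, a (p.1, t) * b (p.2, t) := by
        rw [Measure.volume_eq_prod, lintegral_prod_symm _ hm.aemeasurable]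
    _ = ∫⁻ t, (∫⁻ x, a (x, t)) * ∫⁻ y, b (y, t) := by
        refine lintegral_congr fun t => ?_
        rw [Measure.volume_eq_prod, lintegral_prod_mul (f := fun x => a (x, t))
          (g := fun y => b (y, t)) (by fun_prop) (by fun_prop)]
    _ ≤ ∫⁻ t, (∫⁻ x, a (x, t)) * C := by
        refine lintegral_mono_ae ?_
        filter_upwards [hC] with t ht
        gcongr
    _ = C * ∫⁻ z, a z := by
        rw [lintegral_mul_const _ (by exact ha.lintegral_prod_left'), mul_comm, Measure.volume_eq_prod,
          lintegral_prod_symm _ ha.aemeasurable]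

lemma tendsto_lintegral_translation {A : R3 × ℝ → ℝ} (hA : Integrable A) :
    Tendsto (fun τ : ℝ => ∫⁻ z : R3 × ℝ, ‖A (z.1, τ + z.2) - A z‖ₑ) (𝓝 0) (𝓝 0) := by
  have hA1 : MemLp A 1 := memLp_one_iff_integrable.2 hA
  let g : ℝ → C(R3 × ℝ, R3 × ℝ) := fun τ => ⟨fun z => (z.1, τ + z.2), by fun_prop⟩
  have hg : Continuous g := by
    refine ContinuousMap.continuous_of_continuous_uncurry _ ?_
    simp only [Function.uncurry_def, g, ContinuousMap.coe_mk]
    fun_prop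
  have hgm : ∀ τ, MeasurePreserving (g τ) volume volume := fun τ =>
    (MeasurePreserving.id (volume : Measure R3)).prod (measurePreserving_add_left volume τ)
  have hc := Continuous.compMeasurePreservingLp (f := fun _ : ℝ => hA1.toLp A) continuous_const hg
    hgm ENNReal.one_ne_top
  have h0 : Lp.compMeasurePreserving (g 0) (hgm 0) (hA1.toLp A) = hA1.toLp A := by
    rw [Lp.toLp_compMeasurePreserving hA1 (hgm 0)]
    congr 1
    funext z
    simp [g]
  have ht := (hc.tendsto 0)
  simp only [h0] at ht
  rw [Lp.tendsto_Lp_iff_tendsto_eLpNorm'] at ht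
  refine ht.congr fun τ => ?_
  rw [eLpNorm_one_eq_lintegral_enorm]
  refine lintegral_congr_ae ?_
  have e1 := (Lp.coeFn_compMeasurePreserving (hA1.toLp A) (hgm τ))
  have e2 := hA1.coeFn_toLp
  have e3 := (hgm τ).quasiMeasurePreserving.ae_eq_comp e2
  filter_upwards [e1, e2, e3] with z h1 h2 h3
  simp only [Pi.sub_apply, h1, h2, h3]
  rfl

/-- A mollifying sequence on the time axis. -/
noncomputable def timeBump (n : ℕ) : ContDiffBump (0 : ℝ) where
  rIn := 1 / (2 * ((n : ℝ) + 1))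
  rOut := 1 / ((n : ℝ) + 1)
  rIn_pos := by positivity
  rIn_lt_rOut := by
    apply one_div_lt_one_div_of_lt <;> linarith [n.cast_nonneg (α := ℝ)]

/-- The normalised mollifying sequence on the time axis. -/
noncomputable def timeMoll (n : ℕ) : ℝ → ℝ := (timeBump n).normed volume

lemma timeMoll_nonneg (n : ℕ) (τ : ℝ) : 0 ≤ timeMoll n τ := (timeBump n).nonneg_normed τ

lemma timeMoll_contDiff (n : ℕ) : ContDiff ℝ ∞ (timeMoll n) := (timeBump n).contDiff_normed

lemma timeMoll_hasCompactSupport (n : ℕ) : HasCompactSupport (timeMoll n) :=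
  (timeBump n).hasCompactSupport_normed

lemma timeMoll_integral (n : ℕ) : ∫ τ, timeMoll n τ = 1 := (timeBump n).integral_normed

lemma timeMoll_integrable (n : ℕ) : Integrable (timeMoll n) :=
  (timeMoll_contDiff n).continuous.integrable_of_hasCompactSupport (timeMoll_hasCompactSupport n)

lemma timeMoll_lintegral (n : ℕ) : ∫⁻ τ, ENNReal.ofReal (timeMoll n τ) = 1 := by
  rw [← ofReal_integral_eq_lintegral_ofReal (timeMoll_integrable n)
    (ae_of_all _ (timeMoll_nonneg n)), timeMoll_integral, ENNReal.ofReal_one]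

lemma timeMoll_eq_zero {n : ℕ} {τ : ℝ} (h : 1 / ((n : ℝ) + 1) ≤ |τ|) : timeMoll n τ = 0 := by
  have : τ ∉ Function.support (timeMoll n) := by
    rw [timeMoll, ContDiffBump.support_normed_eq]
    simpa [timeBump] using h
  simpa using this

/-- The product of a function of `z` and a function of `z'`, weighted with a kernel depending on the
spatial variables. -/
def prodKer (A B : R3 × ℝ → ℝ) (k : R3 × R3 → ℝ) (q : (R3 × ℝ) × R3 × ℝ) : ℝ :=
  A q.1 * B q.2 * k (q.1.1, q.2.1)

lemma integrable_mul_prodKer {A B : R3 × ℝ → ℝ} {k : R3 × R3 → ℝ} (hA : Integrable A)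
    (hB : Integrable B) (hk : Measurable k) {Ck : ℝ} (hkb : ∀ p, |k p| ≤ Ck) {θ : ℝ → ℝ}
    (hθ : Continuous θ) {Cθ : ℝ} (hθb : ∀ τ, |θ τ| ≤ Cθ) :
    Integrable fun q => θ (q.1.2 - q.2.2) * prodKer A B k q := by
  have h1 : Integrable fun q : (R3 × ℝ) × R3 × ℝ => A q.1 * B q.2 := hA.mul_prod hB
  have h2 : Integrable fun q => prodKer A B k q :=
    h1.mul_bdd (c := Ck)
      (by exact (hk.comp (by fun_prop)).aestronglyMeasurable) (ae_of_all _ fun q => hkb _)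
  exact h2.bdd_mul (c := Cθ) (by fun_prop) (ae_of_all _ fun q => hθb _)

lemma integrable_diag_prodKer {A B : R3 × ℝ → ℝ} {k : R3 × R3 → ℝ} (hA : Integrable A)
    (hAm : Measurable A) (hBm : Measurable B) (hk : Measurable k) {Ck : ℝ} (hkb : ∀ p, |k p| ≤ Ck)
    {C : ℝ≥0∞} (hC : C ≠ ⊤) (hCB : ∀ᵐ t : ℝ, ∫⁻ x, ‖B (x, t)‖ₑ ≤ C) :
    Integrable fun d : (R3 × R3) × ℝ => prodKer A B k ((d.1.1, d.2), (d.1.2, d.2)) := by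
  have h1 : Integrable fun d : (R3 × R3) × ℝ => A (d.1.1, d.2) * B (d.1.2, d.2) := by
    refine ⟨by fun_prop, ?_⟩
    rw [hasFiniteIntegral_iff_enorm]
    simp only [enorm_mul]
    exact (lintegral_diag_le (a := fun z => ‖A z‖ₑ) (b := fun z => ‖B z‖ₑ) (by fun_prop)
      (by fun_prop) hCB).trans_lt (ENNReal.mul_lt_top hC.lt_top hA.2)
  exact h1.mul_bdd (c := Ck) (by exact (hk.comp (by fun_prop)).aestronglyMeasurable)
    (ae_of_all _ fun q => hkb _)

/-- In shear coordinates only `A` is translated in time, so the error is at most the mollified `L¹`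
modulus of continuity of `A`, times the uniform bound of `B` in space. No time regularity of `B` is
needed, and `A` may be merely integrable, as the momentum flux is. -/
theorem tendsto_integral_timeMoll_prodKer {A B : R3 × ℝ → ℝ} {k : R3 × R3 → ℝ} (hA : Integrable A)
    (hAm : Measurable A) (hB : Integrable B) (hBm : Measurable B) (hk : Measurable k) {Ck : ℝ}
    (hkb : ∀ p, |k p| ≤ Ck) {C : ℝ≥0∞} (hC : C ≠ ⊤) (hCB : ∀ᵐ t : ℝ, ∫⁻ x, ‖B (x, t)‖ₑ ≤ C) :
    Tendsto (fun n => ∫ q, timeMoll n (q.1.2 - q.2.2) * prodKer A B k q) atTop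
      (𝓝 (∫ d : (R3 × R3) × ℝ, prodKer A B k ((d.1.1, d.2), (d.1.2, d.2)))) := by
  have hdiag := integrable_diag_prodKer hA hAm hBm hk hkb hC hCB
  have hCk : 0 ≤ Ck := (abs_nonneg _).trans (hkb 0)
  set D : (R3 × R3) × ℝ → ℝ := fun d => prodKer A B k ((d.1.1, d.2), (d.1.2, d.2)) with hD
  have hmp := measurePreserving_shear
  have hint : ∀ n, Integrable fun q => timeMoll n (q.1.2 - q.2.2) * prodKer A B k q := fun n => by
    obtain ⟨c, hc⟩ := (timeMoll_hasCompactSupport n).exists_bound_of_continuous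
      (timeMoll_contDiff n).continuous
    exact integrable_mul_prodKer hA hB hk hkb (timeMoll_contDiff n).continuous (Cθ := c) hc
  let E : (R3 × R3) × ℝ × ℝ → ℝ := fun r => A (r.1.1, r.2.1 + r.2.2) * B (r.1.2, r.2.2) * k r.1
  have e1 : ∀ n, ∫ q, timeMoll n (q.1.2 - q.2.2) * prodKer A B k q
      = ∫ r : (R3 × R3) × ℝ × ℝ, timeMoll n r.2.1 * E r := by
    intro n
    rw [← hmp.map_eq, integral_map hmp.measurable.aemeasurable
      (by rw [hmp.map_eq]; exact (hint n).1)]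
    refine integral_congr_ae (ae_of_all _ fun r => ?_)
    simp [prodKer, E]
  have i1 : ∀ n, Integrable fun r : (R3 × R3) × ℝ × ℝ => timeMoll n r.2.1 * E r := by
    intro n
    refine (hmp.integrable_comp_of_integrable (hint n)).congr (ae_of_all _ fun r => ?_)
    simp [prodKer, E]
  have hsw : MeasurePreserving (fun r : (R3 × R3) × ℝ × ℝ => (r.2.1, (r.1, r.2.2))) := by
    have h2 : MeasurePreserving (MeasurableEquiv.prodAssoc : ((R3 × R3) × ℝ) × ℝ ≃ᵐ _) :=
      measurePreserving_prodAssoc _ _ _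
    have h3 : MeasurePreserving (MeasurableEquiv.prodAssoc : (ℝ × (R3 × R3)) × ℝ ≃ᵐ _) :=
      measurePreserving_prodAssoc _ _ _
    have h5 : MeasurePreserving (Prod.map Prod.swap id : ((R3 × R3) × ℝ) × ℝ → (ℝ × (R3 × R3)) × ℝ) :=
      (Measure.measurePreserving_swap (μ := (volume : Measure (R3 × R3)))
        (ν := (volume : Measure ℝ))).prod (MeasurePreserving.id _)
    exact h3.comp (h5.comp (h2.symm _))
  have i0' : ∀ n, Integrable fun p : ℝ × (R3 × R3) × ℝ => timeMoll n p.1 * D p.2 := fun n =>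
    (timeMoll_integrable n).mul_prod hdiag
  have i0 : ∀ n, Integrable fun r : (R3 × R3) × ℝ × ℝ => timeMoll n r.2.1 * D (r.1, r.2.2) :=
    fun n => hsw.integrable_comp_of_integrable (i0' n)
  -- The mollifier has integral one, so the limit is an integral against the same mollifier and the
  -- two integrands can be compared pointwise.
  have e0 : ∀ n, ∫ r : (R3 × R3) × ℝ × ℝ, timeMoll n r.2.1 * D (r.1, r.2.2) = ∫ d, D d := by
    intro n
    have := integral_map (f := fun p : ℝ × (R3 × R3) × ℝ => timeMoll n p.1 * D p.2)
      hsw.measurable.aemeasurable (by rw [hsw.map_eq]; exact (i0' n).1)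
    rw [hsw.map_eq] at this
    rw [← this, Measure.volume_eq_prod, integral_prod_mul (f := timeMoll n), timeMoll_integral,
      one_mul]
  let om : ℝ → ℝ≥0∞ := fun τ => ∫⁻ z : R3 × ℝ, ‖A (z.1, τ + z.2) - A z‖ₑ
  have hom : Tendsto om (𝓝 0) (𝓝 0) := tendsto_lintegral_translation hA
  have key : ∀ n, ‖(∫ q, timeMoll n (q.1.2 - q.2.2) * prodKer A B k q) - ∫ d, D d‖ₑ
      ≤ ∫⁻ τ, ENNReal.ofReal (timeMoll n τ) * (ENNReal.ofReal Ck * (C * om τ)) := by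
    intro n
    rw [e1 n, ← e0 n, ← integral_sub (i1 n) (i0 n)]
    refine (enorm_integral_le_lintegral_enorm _).trans ?_
    let f : ℝ × (R3 × R3) × ℝ → ℝ≥0∞ := fun p => ENNReal.ofReal (timeMoll n p.1) *
      (ENNReal.ofReal Ck * (‖A (p.2.1.1, p.1 + p.2.2) - A (p.2.1.1, p.2.2)‖ₑ
        * ‖B (p.2.1.2, p.2.2)‖ₑ))
    have hmoll : Measurable (timeMoll n) := (timeMoll_contDiff n).continuous.measurable
    have hf : Measurable f := by fun_prop
    calc ∫⁻ r : (R3 × R3) × ℝ × ℝ, ‖timeMoll n r.2.1 * E r - timeMoll n r.2.1 * D (r.1, r.2.2)‖ₑ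
        ≤ ∫⁻ r : (R3 × R3) × ℝ × ℝ, f (r.2.1, (r.1, r.2.2)) := by
          refine lintegral_mono fun r => ?_
          have : timeMoll n r.2.1 * E r - timeMoll n r.2.1 * D (r.1, r.2.2)
            = timeMoll n r.2.1 * (k r.1 * ((A (r.1.1, r.2.1 + r.2.2) - A (r.1.1, r.2.2))
              * B (r.1.2, r.2.2))) := by
            simp only [E, D, prodKer]; ring
          rw [this, enorm_mul, enorm_mul, enorm_mul]
          simp only [f]
          rw [Real.enorm_eq_ofReal (timeMoll_nonneg n _)]
          gcongr
          rw [← ofReal_norm]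
          exact ENNReal.ofReal_le_ofReal (hkb _)
      _ = ∫⁻ p, f p := hsw.lintegral_comp hf
      _ = ∫⁻ τ, ∫⁻ d, f (τ, d) := by
          rw [Measure.volume_eq_prod, lintegral_prod _ hf.aemeasurable]
      _ ≤ _ := by
          refine lintegral_mono fun τ => ?_
          simp only [f]
          rw [lintegral_const_mul _ (by fun_prop), lintegral_const_mul _ (by fun_prop)]
          gcongr
          exact lintegral_diag_le (a := fun z : R3 × ℝ => ‖A (z.1, τ + z.2) - A z‖ₑ)
            (b := fun z => ‖B z‖ₑ) (by fun_prop) (by fun_prop) hCB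
  rw [tendsto_iff_edist_tendsto_0]
  simp only [edist_eq_enorm_sub]
  have hom2 : Tendsto (fun τ => ENNReal.ofReal Ck * (C * om τ)) (𝓝 0) (𝓝 0) := by
    have := ENNReal.Tendsto.const_mul (a := ENNReal.ofReal Ck)
      (ENNReal.Tendsto.const_mul (a := C) hom (Or.inr hC)) (Or.inr ENNReal.ofReal_ne_top)
    simpa using this
  rw [ENNReal.tendsto_atTop_zero]
  intro ε hε
  have := hom2.eventually (Iic_mem_nhds hε)
  rw [Metric.eventually_nhds_iff] at this
  obtain ⟨r, hr, hball⟩ := this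
  obtain ⟨N, hN⟩ := exists_nat_one_div_lt hr
  refine ⟨N, fun n hn => (key n).trans ?_⟩
  calc ∫⁻ τ, ENNReal.ofReal (timeMoll n τ) * (ENNReal.ofReal Ck * (C * om τ))
      ≤ ∫⁻ τ, ENNReal.ofReal (timeMoll n τ) * ε := by
        refine lintegral_mono fun τ => ?_
        by_cases hτ : 1 / ((n : ℝ) + 1) ≤ |τ|
        · simp [timeMoll_eq_zero hτ]
        · gcongr
          refine hball ?_
          rw [Real.dist_eq, sub_zero]
          push Not at hτ
          refine hτ.trans_le (le_trans ?_ hN.le)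
          apply one_div_le_one_div_of_le (by positivity)
          have : (N : ℝ) ≤ n := by exact_mod_cast hn
          linarith
    _ = ε := by
        rw [lintegral_mul_const _ (timeMoll_contDiff n).continuous.measurable.ennreal_ofReal,
          timeMoll_lintegral, one_mul]

/-- Functions of two space-time points for which integration against a kernel concentrating on
`t = s` converges to the integral over `t = s`. -/
structure HasTrace (𝒜 : (R3 × ℝ) × R3 × ℝ → ℝ) : Prop where
  integrable_mul : ∀ θ : ℝ → ℝ, Continuous θ → (∃ C, ∀ τ, |θ τ| ≤ C) →
    Integrable fun q => θ (q.1.2 - q.2.2) * 𝒜 q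
  integrable_diag : Integrable fun d : (R3 × R3) × ℝ => 𝒜 ((d.1.1, d.2), (d.1.2, d.2))
  tendsto : Tendsto (fun n => ∫ q, timeMoll n (q.1.2 - q.2.2) * 𝒜 q) atTop
      (𝓝 (∫ d : (R3 × R3) × ℝ, 𝒜 ((d.1.1, d.2), (d.1.2, d.2))))

lemma timeMoll_bounded (n : ℕ) : ∃ C, ∀ τ, |timeMoll n τ| ≤ C :=
  (timeMoll_hasCompactSupport n).exists_bound_of_continuous (timeMoll_contDiff n).continuous

lemma HasTrace.integrable_timeMoll {𝒜 : (R3 × ℝ) × R3 × ℝ → ℝ} (h : HasTrace 𝒜) (n : ℕ) :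
    Integrable fun q => timeMoll n (q.1.2 - q.2.2) * 𝒜 q :=
  h.integrable_mul _ (timeMoll_contDiff n).continuous (timeMoll_bounded n)

lemma HasTrace.add {𝒜 ℬ : (R3 × ℝ) × R3 × ℝ → ℝ} (hA : HasTrace 𝒜) (hB : HasTrace ℬ) :
    HasTrace fun q => 𝒜 q + ℬ q where
  integrable_mul θ h1 h2 := by
    simp only [mul_add]
    exact (hA.integrable_mul θ h1 h2).add (hB.integrable_mul θ h1 h2)
  integrable_diag := hA.integrable_diag.add hB.integrable_diag
  tendsto := by
    rw [integral_add hA.integrable_diag hB.integrable_diag]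
    refine (hA.tendsto.add hB.tendsto).congr fun n => ?_
    rw [← integral_add (hA.integrable_timeMoll n) (hB.integrable_timeMoll n)]
    simp only [mul_add]

lemma HasTrace.sub {𝒜 ℬ : (R3 × ℝ) × R3 × ℝ → ℝ} (hA : HasTrace 𝒜) (hB : HasTrace ℬ) :
    HasTrace fun q => 𝒜 q - ℬ q where
  integrable_mul θ h1 h2 := by
    simp only [mul_sub]
    exact (hA.integrable_mul θ h1 h2).sub (hB.integrable_mul θ h1 h2)
  integrable_diag := hA.integrable_diag.sub hB.integrable_diag
  tendsto := by
    rw [integral_sub hA.integrable_diag hB.integrable_diag]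
    refine (hA.tendsto.sub hB.tendsto).congr fun n => ?_
    rw [← integral_sub (hA.integrable_timeMoll n) (hB.integrable_timeMoll n)]
    simp only [mul_sub]

lemma HasTrace.zero : HasTrace fun _ => 0 where
  integrable_mul θ _ _ := by simp
  integrable_diag := by simp
  tendsto := by simp

lemma HasTrace.sum {ι : Type*} (s : Finset ι) {𝒜 : ι → (R3 × ℝ) × R3 × ℝ → ℝ}
    (h : ∀ i, HasTrace (𝒜 i)) : HasTrace fun q => ∑ i ∈ s, 𝒜 i q := by
  classical
  induction s using Finset.induction_on with
  | empty => simpa using HasTrace.zero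
  | insert a s ha ih => simpa only [Finset.sum_insert ha] using (h a).add ih

/-- Measurable functions on space-time which are integrable in space, uniformly in time, and
integrable. -/
structure Slice (B : R3 × ℝ → ℝ) : Prop where
  measurable : Measurable B
  integrable : Integrable B
  bound : ∃ C : ℝ≥0∞, C ≠ ⊤ ∧ ∀ᵐ t : ℝ, ∫⁻ x, ‖B (x, t)‖ₑ ≤ C

lemma Slice.hasTrace {A B : R3 × ℝ → ℝ} {k : R3 × R3 → ℝ} (hB : Slice B) (hA : Integrable A)
    (hAm : Measurable A) (hk : Measurable k) (hkb : ∃ C, ∀ p, |k p| ≤ C) :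
    HasTrace (prodKer A B k) := by
  obtain ⟨Ck, hkb⟩ := hkb
  obtain ⟨C, hC, hCB⟩ := hB.bound
  exact ⟨fun θ h1 ⟨c, hc⟩ => integrable_mul_prodKer hA hB.integrable hk hkb h1 hc,
    integrable_diag_prodKer hA hAm hB.measurable hk hkb hC hCB,
    tendsto_integral_timeMoll_prodKer hA hAm hB.integrable hB.measurable hk hkb hC hCB⟩

/-! ### Everywhere defined representatives and their integrability. -/

/-- A weak solution in the cylinder, given by measurable functions vanishing outside of it,
together with the energy bounds. -/
structure Flow (Ω : Set R3) (T ν₁ ν₂ ε m M E : ℝ) (f : R3 × ℝ → R3)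
    (ϱ : R3 × ℝ → ℝ) (u : R3 × ℝ → R3) (Du : R3 × ℝ → Fin 3 → R3) : Prop where
  isOpen : IsOpen Ω
  bounded : Bornology.IsBounded Ω
  eps_pos : 0 < ε
  measurable_density : Measurable ϱ
  measurable_velocity : Measurable u
  measurable_gradient : Measurable Du
  measurable_force : Measurable f
  density_nonneg : ∀ z, 0 ≤ ϱ z
  density_zero : ∀ z, z ∉ cylinder Ω T → ϱ z = 0
  velocity_zero : ∀ z, z ∉ cylinder Ω T → u z = 0
  gradient_zero : ∀ z, z ∉ cylinder Ω T → Du z = 0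
  force_le : ∀ z, ‖f z‖ ≤ M
  pressure_le : ∀ᵐ t : ℝ, ∫⁻ x, ENNReal.ofReal (pressure ε m (ϱ (x, t))) ≤ ENNReal.ofReal E
  kinetic_le : ∀ᵐ t : ℝ, ∫⁻ x, ENNReal.ofReal (ϱ (x, t) * ‖u (x, t)‖ ^ 2) ≤ ENNReal.ofReal E
  dissipation_le : ∫⁻ z, ENNReal.ofReal (‖u z‖ ^ 2 + ∑ j, ‖Du z j‖ ^ 2) ≤ ENNReal.ofReal (E ^ 2)
  gradient_weak : ∀ᵐ t ∂(volume.restrict (Ioo 0 T)),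
    HasWeakGradient Ω (fun x => u (x, t)) (fun x => Du (x, t))
  momentum : ∀ ξ : R3 × ℝ → R3, IsTest (cylinder Ω T) ξ →
    (∫ z, ϱ z * inner ℝ (u z) (dt ξ z))
      + (∫ z, ∑ i, ∑ j, (ϱ z * u z i * u z j + (if i = j then pressure ε m (ϱ z) else 0)
            - stress ν₁ ν₂ (Du z) i j) * dx j ξ z i)
      + (∫ z, ϱ z * inner ℝ (f z) (ξ z)) = 0
  mass : ∀ ψ : R3 × ℝ → ℝ, IsTest (cylinder Ω T) ψ →
    ∫ z, (ϱ z * dt ψ z + ∑ j, ϱ z * u z j * dx j ψ z) = 0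

lemma measurable_pressure (ε m : ℝ) : Measurable (pressure ε m) := by
  unfold pressure; fun_prop

lemma pressure_nonneg {ε m s : ℝ} (hε : 0 ≤ ε) (hs : 0 ≤ s) : 0 ≤ pressure ε m s := by
  unfold pressure; positivity

lemma rpow_le_pressure {ε m s : ℝ} (hε : 0 ≤ ε) (hs : 0 ≤ s) :
    s ^ (3 / 2 : ℝ) ≤ pressure ε m s := by
  have h1 : 0 ≤ s ^ (3 / 2 : ℝ) := by positivity
  have h2 : 0 ≤ ε * s ^ m := by positivity
  unfold pressure
  nlinarith

lemma le_one_add_pressure {ε m s : ℝ} (hε : 0 ≤ ε) (hs : 0 ≤ s) : s ≤ 1 + pressure ε m s := by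
  refine le_trans ?_ (add_le_add_right (rpow_le_pressure (m := m) hε hs) 1)
  rcases le_total s 1 with h | h
  · have h1 : 0 ≤ s ^ (3 / 2 : ℝ) := by positivity
    linarith
  · have := Real.rpow_le_rpow_of_exponent_le h (show (1 : ℝ) ≤ 3 / 2 by norm_num)
    rw [Real.rpow_one] at this
    linarith

lemma pressure_zero (ε m : ℝ) : pressure ε m 0 = 0 := by
  unfold pressure; rw [Real.zero_rpow (by norm_num)]; simp

namespace Flow

variable {Ω : Set R3} {T ν₁ ν₂ ε m M E : ℝ} {f : R3 × ℝ → R3} {ϱ : R3 × ℝ → ℝ} {u : R3 × ℝ → R3}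
  {Du : R3 × ℝ → Fin 3 → R3}

/-- A function of space and time dominating the lower order terms of the flow. -/
noncomputable def weight (Ω : Set R3) (T ε m : ℝ) (ϱ : R3 × ℝ → ℝ) (u : R3 × ℝ → R3)
    (z : R3 × ℝ) : ℝ :=
  (cylinder Ω T).indicator 1 z + pressure ε m (ϱ z) + ϱ z * ‖u z‖ ^ 2

lemma measurableSet_cylinder (hΩ : IsOpen Ω) (T : ℝ) : MeasurableSet (cylinder Ω T) :=
  hΩ.measurableSet.prod measurableSet_Ioo

lemma measurable_weight (h : Flow Ω T ν₁ ν₂ ε m M E f ϱ u Du) :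
    Measurable (weight Ω T ε m ϱ u) := by
  have h1 := measurable_pressure ε m
  have h2 := h.measurable_density
  have h3 := h.measurable_velocity
  have h4 : Measurable ((cylinder Ω T).indicator (1 : R3 × ℝ → ℝ)) :=
    measurable_one.indicator (measurableSet_cylinder h.isOpen T)
  unfold weight
  fun_prop

lemma weight_nonneg (h : Flow Ω T ν₁ ν₂ ε m M E f ϱ u Du) (z : R3 × ℝ) :
    0 ≤ weight Ω T ε m ϱ u z := by
  have h1 := pressure_nonneg (m := m) h.eps_pos.le (h.density_nonneg z)
  have h2 := h.density_nonneg z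
  have h3 : 0 ≤ (cylinder Ω T).indicator (1 : R3 × ℝ → ℝ) z :=
    indicator_nonneg (fun _ _ => zero_le_one) z
  unfold weight
  positivity

lemma lintegral_weight_le (h : Flow Ω T ν₁ ν₂ ε m M E f ϱ u Du) :
    ∀ᵐ t : ℝ, ∫⁻ x, ENNReal.ofReal (weight Ω T ε m ϱ u (x, t))
      ≤ volume Ω + ENNReal.ofReal E + ENNReal.ofReal E := by
  filter_upwards [h.pressure_le, h.kinetic_le] with t h1 h2
  have m1 := measurable_pressure ε m
  have m2 := h.measurable_density
  have m3 := h.measurable_velocity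
  calc ∫⁻ x, ENNReal.ofReal (weight Ω T ε m ϱ u (x, t))
      ≤ ∫⁻ x, (Ω.indicator 1 x + ENNReal.ofReal (pressure ε m (ϱ (x, t)))
          + ENNReal.ofReal (ϱ (x, t) * ‖u (x, t)‖ ^ 2)) := by
        refine lintegral_mono fun x => ?_
        unfold weight
        refine ENNReal.ofReal_add_le.trans ?_
        gcongr
        refine ENNReal.ofReal_add_le.trans ?_
        gcongr
        by_cases hx : (x, t) ∈ cylinder Ω T
        · rw [indicator_of_mem hx, indicator_of_mem hx.1]; simp
        · rw [indicator_of_notMem hx]; simp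
    _ ≤ _ := by
        rw [lintegral_add_right _ (by fun_prop), lintegral_add_right _ (by fun_prop),
          lintegral_indicator_one h.isOpen.measurableSet]
        gcongr

lemma weight_of_notMem (h : Flow Ω T ν₁ ν₂ ε m M E f ϱ u Du) {z : R3 × ℝ}
    (hz : z ∉ cylinder Ω T) : weight Ω T ε m ϱ u z = 0 := by
  simp [weight, hz, h.density_zero z hz, pressure_zero]

lemma weightConst_ne_top (h : Flow Ω T ν₁ ν₂ ε m M E f ϱ u Du) :
    volume Ω + ENNReal.ofReal E + ENNReal.ofReal E ≠ ⊤ := by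
  have := h.bounded.measure_lt_top (μ := volume)
  finiteness

/-- The weight is bounded in `L^∞` of time with values in `L¹` of space and vanishes outside the
bounded time interval, hence it is also integrable in space-time. -/
lemma slice_of_abs_le (h : Flow Ω T ν₁ ν₂ ε m M E f ϱ u Du) {g : R3 × ℝ → ℝ} (hg : Measurable g)
    {C : ℝ} (hC : ∀ z, |g z| ≤ C * weight Ω T ε m ϱ u z) : Slice g := by
  have hb : ∀ z, ‖g z‖ₑ ≤ ENNReal.ofReal C * ENNReal.ofReal (weight Ω T ε m ϱ u z) := fun z => by
    rw [← ENNReal.ofReal_mul' (h.weight_nonneg z), ← ofReal_norm]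
    exact ENNReal.ofReal_le_ofReal (hC z)
  have hw := h.measurable_weight
  have hs : ∀ᵐ t : ℝ, ∫⁻ x, ‖g (x, t)‖ₑ
      ≤ ENNReal.ofReal C * (volume Ω + ENNReal.ofReal E + ENNReal.ofReal E) := by
    filter_upwards [h.lintegral_weight_le] with t ht
    refine (lintegral_mono fun x => hb (x, t)).trans ?_
    rw [lintegral_const_mul _ (by fun_prop)]
    gcongr
  have hfin : ENNReal.ofReal C * (volume Ω + ENNReal.ofReal E + ENNReal.ofReal E) ≠ ⊤ :=
    ENNReal.mul_ne_top ENNReal.ofReal_ne_top h.weightConst_ne_top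
  refine ⟨hg, ⟨hg.aestronglyMeasurable, ?_⟩, _, hfin, hs⟩
  rw [hasFiniteIntegral_iff_enorm, Measure.volume_eq_prod, lintegral_prod_symm _ (by fun_prop)]
  calc ∫⁻ t, ∫⁻ x, ‖g (x, t)‖ₑ
      ≤ ∫⁻ t, (Ioo 0 T).indicator (fun _ => ENNReal.ofReal C *
          (volume Ω + ENNReal.ofReal E + ENNReal.ofReal E)) t := by
        refine lintegral_mono_ae ?_
        filter_upwards [hs] with t ht
        by_cases htT : t ∈ Ioo 0 T
        · rwa [indicator_of_mem htT]
        · rw [indicator_of_notMem htT]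
          refine le_of_eq ?_
          rw [lintegral_eq_zero_iff (by fun_prop)]
          refine ae_of_all _ fun x => ?_
          have h1 := hC (x, t)
          rw [h.weight_of_notMem (fun hz => htT hz.2), mul_zero] at h1
          simpa using h1
    _ < ⊤ := by
        rw [lintegral_indicator_const measurableSet_Ioo]
        refine ENNReal.mul_lt_top hfin.lt_top ?_
        simp

lemma density_le (h : Flow Ω T ν₁ ν₂ ε m M E f ϱ u Du) (z : R3 × ℝ) :
    ϱ z ≤ weight Ω T ε m ϱ u z := by
  by_cases hz : z ∈ cylinder Ω T
  · have h1 := le_one_add_pressure (m := m) h.eps_pos.le (h.density_nonneg z)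
    have h2 := h.density_nonneg z
    have : 0 ≤ ϱ z * ‖u z‖ ^ 2 := by positivity
    simp only [weight, indicator_of_mem hz, Pi.one_apply]
    linarith
  · rw [h.density_zero z hz]; exact h.weight_nonneg z

lemma pressure_le_weight (h : Flow Ω T ν₁ ν₂ ε m M E f ϱ u Du) (z : R3 × ℝ) :
    pressure ε m (ϱ z) ≤ weight Ω T ε m ϱ u z := by
  have h2 := h.density_nonneg z
  have : 0 ≤ ϱ z * ‖u z‖ ^ 2 := by positivity
  have h3 : 0 ≤ (cylinder Ω T).indicator (1 : R3 × ℝ → ℝ) z :=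
    indicator_nonneg (fun _ _ => zero_le_one) z
  simp only [weight]
  linarith

lemma kinetic_le_weight (h : Flow Ω T ν₁ ν₂ ε m M E f ϱ u Du) (z : R3 × ℝ) :
    ϱ z * ‖u z‖ ^ 2 ≤ weight Ω T ε m ϱ u z := by
  have h2 := pressure_nonneg (m := m) h.eps_pos.le (h.density_nonneg z)
  have h3 : 0 ≤ (cylinder Ω T).indicator (1 : R3 × ℝ → ℝ) z :=
    indicator_nonneg (fun _ _ => zero_le_one) z
  simp only [weight]
  linarith

lemma density_mul_norm_le (h : Flow Ω T ν₁ ν₂ ε m M E f ϱ u Du) (z : R3 × ℝ) :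
    ϱ z * ‖u z‖ ≤ weight Ω T ε m ϱ u z := by
  have h1 := h.density_le z
  have h2 := h.kinetic_le_weight z
  have h3 := h.density_nonneg z
  nlinarith [mul_nonneg h3 (sq_nonneg (‖u z‖ - 1))]

end Flow

lemma abs_apply_le (v : R3) (i : Fin 3) : |v i| ≤ ‖v‖ := by
  simpa using PiLp.norm_apply_le v i

namespace Flow

variable {Ω : Set R3} {T ν₁ ν₂ ε m M E : ℝ} {f : R3 × ℝ → R3} {ϱ : R3 × ℝ → ℝ} {u : R3 × ℝ → R3}
  {Du : R3 × ℝ → Fin 3 → R3}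

lemma slice_density (h : Flow Ω T ν₁ ν₂ ε m M E f ϱ u Du) : Slice ϱ :=
  h.slice_of_abs_le h.measurable_density (C := 1) fun z => by
    rw [abs_of_nonneg (h.density_nonneg z), one_mul]; exact h.density_le z

@[fun_prop]
lemma measurable_coord (i : Fin 3) : Measurable fun v : R3 => v i :=
  (EuclideanSpace.proj (𝕜 := ℝ) i).continuous.measurable

lemma slice_momentum (h : Flow Ω T ν₁ ν₂ ε m M E f ϱ u Du) (i : Fin 3) :
    Slice fun z => ϱ z * u z i := by
  have h1 := h.measurable_density
  have h2 := h.measurable_velocity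
  refine h.slice_of_abs_le (by fun_prop) (C := 1) fun z => ?_
  rw [abs_mul, abs_of_nonneg (h.density_nonneg z), one_mul]
  exact (mul_le_mul_of_nonneg_left (abs_apply_le _ i) (h.density_nonneg z)).trans
    (h.density_mul_norm_le z)

lemma slice_force (h : Flow Ω T ν₁ ν₂ ε m M E f ϱ u Du) (i : Fin 3) :
    Slice fun z => ϱ z * f z i := by
  have h1 := h.measurable_density
  have h2 := h.measurable_force
  refine h.slice_of_abs_le (by fun_prop) (C := M) fun z => ?_
  have hM : 0 ≤ M := (norm_nonneg _).trans (h.force_le z)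
  rw [abs_mul, abs_of_nonneg (h.density_nonneg z), mul_comm]
  exact mul_le_mul ((abs_apply_le _ i).trans (h.force_le z)) (h.density_le z) (h.density_nonneg z) hM

lemma integrable_gradient (h : Flow Ω T ν₁ ν₂ ε m M E f ϱ u Du) (i j : Fin 3) :
    Integrable fun z => Du z i j := by
  have h1 := h.measurable_gradient
  have hm : Measurable fun z => Du z i j := by
    have : Measurable fun z => Du z i := by fun_prop
    fun_prop
  have hI1 : Integrable fun z => ‖u z‖ ^ 2 + ∑ j, ‖Du z j‖ ^ 2 := by
    have h2 := h.measurable_velocity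
    refine ⟨by fun_prop, ?_⟩
    rw [hasFiniteIntegral_iff_ofReal (ae_of_all _ fun z => by positivity)]
    exact h.dissipation_le.trans_lt ENNReal.ofReal_lt_top
  have hcyl : volume (cylinder Ω T) < ⊤ := by
    rw [cylinder, Measure.volume_eq_prod, Measure.prod_prod]
    refine ENNReal.mul_lt_top h.bounded.measure_lt_top (by simp)
  have hI2 : Integrable ((cylinder Ω T).indicator (1 : R3 × ℝ → ℝ)) := by
    rw [integrable_indicator_iff (measurableSet_cylinder h.isOpen T)]
    exact integrableOn_const hcyl.ne
  -- On the cylinder, which has finite measure, `|Du| ≤ 1 + |Du|²`.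
  refine (hI1.add hI2).mono' hm.aestronglyMeasurable (ae_of_all _ fun z => ?_)
  by_cases hz : z ∈ cylinder Ω T
  · have e1 : |Du z i j| ≤ ‖Du z i‖ := abs_apply_le _ j
    have e2 : ‖Du z i‖ ^ 2 ≤ ∑ j, ‖Du z j‖ ^ 2 :=
      Finset.single_le_sum (f := fun j => ‖Du z j‖ ^ 2) (fun _ _ => by positivity)
        (Finset.mem_univ i)
    simp only [Pi.add_apply, indicator_of_mem hz, Pi.one_apply, Real.norm_eq_abs]
    nlinarith [sq_nonneg (‖Du z i‖ - 1), sq_nonneg ‖u z‖]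
  · rw [h.gradient_zero z hz]
    simp only [Pi.zero_apply, PiLp.zero_apply, norm_zero, Pi.add_apply]
    have : 0 ≤ (cylinder Ω T).indicator (1 : R3 × ℝ → ℝ) z :=
      indicator_nonneg (fun _ _ => zero_le_one) z
    positivity

/-- The total momentum flux. -/
noncomputable def flux (ν₁ ν₂ ε m : ℝ) (ϱ : R3 × ℝ → ℝ) (u : R3 × ℝ → R3)
    (Du : R3 × ℝ → Fin 3 → R3) (i j : Fin 3) (z : R3 × ℝ) : ℝ :=
  ϱ z * u z i * u z j + (if i = j then pressure ε m (ϱ z) else 0) - stress ν₁ ν₂ (Du z) i j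

lemma measurable_gradient_coord (h : Flow Ω T ν₁ ν₂ ε m M E f ϱ u Du) (i j : Fin 3) :
    Measurable fun z => Du z i j := by
  have h1 := h.measurable_gradient
  have : Measurable fun z => Du z i := by fun_prop
  fun_prop

lemma measurable_flux (h : Flow Ω T ν₁ ν₂ ε m M E f ϱ u Du) (i j : Fin 3) :
    Measurable (flux ν₁ ν₂ ε m ϱ u Du i j) := by
  have h1 := h.measurable_density
  have h2 : ∀ i, Measurable fun z => u z i := fun i =>
    (measurable_coord i).comp h.measurable_velocity
  have h4 := h.measurable_gradient_coord
  unfold flux stress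
  refine Measurable.sub (Measurable.add ((h1.mul (h2 i)).mul (h2 j)) ?_)
    (Measurable.add (measurable_const.mul ((h4 j i).add (h4 i j))) ?_)
  · split_ifs
    · exact (measurable_pressure ε m).comp h1
    · exact measurable_const
  · split_ifs
    · exact measurable_const.mul (Finset.measurable_sum _ fun k _ => h4 k k)
    · exact measurable_const

lemma integrable_flux (h : Flow Ω T ν₁ ν₂ ε m M E f ϱ u Du) (i j : Fin 3) :
    Integrable (flux ν₁ ν₂ ε m ϱ u Du i j) := by
  have h1 := h.measurable_density
  have h2 := h.measurable_velocity
  have h3 := measurable_pressure ε m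
  have i1 : Integrable fun z => ϱ z * u z i * u z j := by
    refine (h.slice_of_abs_le (by fun_prop) (C := 1) fun z => ?_).integrable
    rw [mul_assoc, abs_mul, abs_of_nonneg (h.density_nonneg z), one_mul, abs_mul]
    refine le_trans ?_ (h.kinetic_le_weight z)
    have := h.density_nonneg z
    have a1 := abs_apply_le (u z) i
    have a2 := abs_apply_le (u z) j
    rw [sq]
    gcongr
  have i2 : Integrable fun z => pressure ε m (ϱ z) := by
    refine (h.slice_of_abs_le (by fun_prop) (C := 1) fun z => ?_).integrable
    rw [abs_of_nonneg (pressure_nonneg h.eps_pos.le (h.density_nonneg z)), one_mul]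
    exact h.pressure_le_weight z
  have i3 : Integrable fun z => stress ν₁ ν₂ (Du z) i j := by
    unfold stress
    refine (((h.integrable_gradient j i).add (h.integrable_gradient i j)).const_mul ν₁).add ?_
    split_ifs
    · exact (integrable_finsetSum _ fun k _ => h.integrable_gradient k k).const_mul ν₂
    · simp
  unfold flux
  refine (i1.add ?_).sub i3
  split_ifs
  · exact i2
  · simp

end Flow

/-! ### Test functions in product form. -/

section Test

variable {X Y : Type*} [NormedAddCommGroup X] [NormedSpace ℝ X] [NormedAddCommGroup Y]
  [NormedSpace ℝ Y] {U : Set X} {φ : X → Y}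

lemma IsTest.continuous_fderiv_apply (h : IsTest U φ) (v : X) :
    Continuous fun z => fderiv ℝ φ z v :=
  (h.1.continuous_fderiv (by simp)).clm_apply continuous_const

lemma IsTest.exists_bound (h : IsTest U φ) : ∃ C, ∀ z, ‖φ z‖ ≤ C :=
  h.2.1.exists_bound_of_continuous h.1.continuous

lemma IsTest.exists_bound_fderiv (h : IsTest U φ) (v : X) : ∃ C, ∀ z, ‖fderiv ℝ φ z v‖ ≤ C :=
  (h.2.1.fderiv_apply ℝ v).exists_bound_of_continuous (h.continuous_fderiv_apply v)

lemma IsTest.eq_zero (h : IsTest U φ) {z : X} (hz : z ∉ U) : φ z = 0 :=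
  image_eq_zero_of_notMem_tsupport fun hz' => hz (h.2.2 hz')

lemma IsTest.fderiv_eq_zero (h : IsTest U φ) {z : X} (hz : z ∉ U) : fderiv ℝ φ z = 0 :=
  image_eq_zero_of_notMem_tsupport fun hz' => hz (h.2.2 (tsupport_fderiv_subset ℝ hz'))

end Test

lemma isTest_smul {V : Type*} [NormedAddCommGroup V] [NormedSpace ℝ V] {U : Set (R3 × ℝ)}
    {Λ : R3 × ℝ → ℝ} (hΛ : IsTest U Λ) {τ : ℝ → ℝ} (hτ : ContDiff ℝ ∞ τ) {F : R3 → V}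
    (hF : ContDiff ℝ ∞ F) (b : ℝ) :
    IsTest U fun z : R3 × ℝ => (τ z.2 * Λ z * b) • F z.1 := by
  have hs : Function.support (fun z : R3 × ℝ => (τ z.2 * Λ z * b) • F z.1)
      ⊆ Function.support Λ := fun z hz => by
    simp only [Function.mem_support, ne_eq, smul_eq_zero, mul_eq_zero, not_or] at hz ⊢
    exact hz.1.1.2
  have ht := closure_mono hs
  refine ⟨?_, hΛ.2.1.mono hs, ht.trans hΛ.2.2⟩
  exact (((hτ.comp contDiff_snd).mul hΛ.1).mul contDiff_const).smul (hF.comp contDiff_fst)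

lemma fderiv_smul_test {V : Type*} [NormedAddCommGroup V] [NormedSpace ℝ V]
    {Λ : R3 × ℝ → ℝ} (hΛ : Differentiable ℝ Λ) {τ : ℝ → ℝ} (hτ : Differentiable ℝ τ) {F : R3 → V}
    (hF : Differentiable ℝ F) (b : ℝ) (z h : R3 × ℝ) :
    fderiv ℝ (fun z : R3 × ℝ => (τ z.2 * Λ z * b) • F z.1) z h
      = (τ z.2 * Λ z * b) • fderiv ℝ F z.1 h.1
        + (deriv τ z.2 * h.2 * Λ z * b + τ z.2 * fderiv ℝ Λ z h * b) • F z.1 := by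
  have h1 : HasFDerivAt (fun z : R3 × ℝ => τ z.2) _ z :=
    (hτ z.2).hasDerivAt.comp_hasFDerivAt z (hasFDerivAt_snd (𝕜 := ℝ) (p := z))
  have h2 : HasFDerivAt (fun z : R3 × ℝ => F z.1) _ z :=
    (hF z.1).hasFDerivAt.comp z (hasFDerivAt_fst (𝕜 := ℝ) (p := z))
  have h3 := ((h1.mul (hΛ z).hasFDerivAt).mul_const b).smul h2
  have h4 := h3.fderiv
  simp only [Pi.mul_apply] at h4
  rw [show (fun z : R3 × ℝ => (τ z.2 * Λ z * b) • F z.1)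
    = fun y => (τ y.2 * Λ y * b) • F y.1 from rfl]
  erw [h4]
  simp
  congr 1
  ring

/-- Smooth vector kernels, bounded together with their first derivatives. -/
structure SmoothKernel (K : R3 → R3) : Prop where
  contDiff : ContDiff ℝ ∞ K
  bound : ∃ C, ∀ z i, |K z i| ≤ C
  bound_fderiv : ∃ C, ∀ z i j, |fderiv ℝ K z (e j) i| ≤ C

/-! ### The doubled equations and the interaction identity. -/

namespace Flow

variable {Ω : Set R3} {T ν₁ ν₂ ε m M E : ℝ} {f : R3 × ℝ → R3} {ϱ : R3 × ℝ → ℝ} {u : R3 × ℝ → R3}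
  {Du : R3 × ℝ → Fin 3 → R3} {K : R3 → R3} {Λ : R3 × ℝ → ℝ}

/-- The kernel `K (x - y)`. -/
noncomputable def diffKer (K : R3 → R3) (i : Fin 3) (p : R3 × R3) : ℝ := K (p.1 - p.2) i

/-- The kernel `∂ⱼ K (x - y)`. -/
noncomputable def diffKer' (K : R3 → R3) (i j : Fin 3) (p : R3 × R3) : ℝ :=
  fderiv ℝ K (p.1 - p.2) (e j) i

/-- The part of the doubled momentum equation without derivative of the mollifier. -/
noncomputable def doubledMomentum (ν₁ ν₂ ε m : ℝ) (f : R3 × ℝ → R3) (ϱ : R3 × ℝ → ℝ)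
    (u : R3 × ℝ → R3) (Du : R3 × ℝ → Fin 3 → R3) (K : R3 → R3) (Λ : R3 × ℝ → ℝ)
    (q : (R3 × ℝ) × R3 × ℝ) : ℝ :=
  (∑ i, prodKer (fun z => ϱ z * u z i * dt Λ z) (fun z => ϱ z * Λ z) (diffKer K i) q)
    + (∑ i, prodKer (fun z => ϱ z * f z i * Λ z) (fun z => ϱ z * Λ z) (diffKer K i) q)
    + (∑ i, ∑ j, prodKer (fun z => flux ν₁ ν₂ ε m ϱ u Du i j z * dx j Λ z) (fun z => ϱ z * Λ z)
        (diffKer K i) q)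
    + ∑ i, ∑ j, prodKer (fun z => flux ν₁ ν₂ ε m ϱ u Du i j z * Λ z) (fun z => ϱ z * Λ z)
        (diffKer' K i j) q

/-- The part of the doubled mass equation without derivative of the mollifier. -/
noncomputable def doubledMass (ϱ : R3 × ℝ → ℝ) (u : R3 × ℝ → R3) (K : R3 → R3) (Λ : R3 × ℝ → ℝ)
    (q : (R3 × ℝ) × R3 × ℝ) : ℝ :=
  (∑ i, prodKer (fun z => ϱ z * u z i * Λ z) (fun z => ϱ z * dt Λ z) (diffKer K i) q)
    + (∑ i, ∑ j, prodKer (fun z => ϱ z * u z i * Λ z) (fun z => ϱ z * u z j * dx j Λ z)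
        (diffKer K i) q)
    - ∑ i, ∑ j, prodKer (fun z => ϱ z * u z i * Λ z) (fun z => ϱ z * u z j * Λ z)
        (diffKer' K i j) q

/-- The factor of the derivative of the mollifier. -/
noncomputable def doubledTime (ϱ : R3 × ℝ → ℝ) (u : R3 × ℝ → R3) (K : R3 → R3) (Λ : R3 × ℝ → ℝ)
    (q : (R3 × ℝ) × R3 × ℝ) : ℝ :=
  ∑ i, prodKer (fun z => ϱ z * u z i * Λ z) (fun z => ϱ z * Λ z) (diffKer K i) q

lemma inner_eq_sum (v w : R3) : inner ℝ v w = ∑ i, v i * w i := by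
  simp [PiLp.inner_apply, mul_comm]

/-- For frozen `z'` the field `θ(t - t') Λ(z) Λ(z') K(x - x')` is an admissible test function of
`z`; the rough factor `ϱ(z')` is only a constant and is multiplied in afterwards. -/
lemma integral_doubledMomentum (h : Flow Ω T ν₁ ν₂ ε m M E f ϱ u Du) (hK : SmoothKernel K)
    (hΛ : IsTest (cylinder Ω T) Λ) {θ : ℝ → ℝ} (hθ : ContDiff ℝ ∞ θ) (z' : R3 × ℝ) :
    ∫ z, (deriv θ (z.2 - z'.2) * doubledTime ϱ u K Λ (z, z')
      + θ (z.2 - z'.2) * doubledMomentum ν₁ ν₂ ε m f ϱ u Du K Λ (z, z')) = 0 := by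
  have hτ : ContDiff ℝ ∞ fun t => θ (t - z'.2) := hθ.comp (contDiff_id.sub contDiff_const)
  have hF : ContDiff ℝ ∞ fun x => K (x - z'.1) := hK.contDiff.comp (contDiff_id.sub contDiff_const)
  have hξ := isTest_smul hΛ hτ hF (Λ z')
  set ξ : R3 × ℝ → R3 := fun z => (θ (z.2 - z'.2) * Λ z * Λ z') • K (z.1 - z'.1) with hξdef
  have hfd : ∀ z v, fderiv ℝ ξ z v = (θ (z.2 - z'.2) * Λ z * Λ z') • fderiv ℝ K (z.1 - z'.1) v.1
      + (deriv θ (z.2 - z'.2) * v.2 * Λ z * Λ z' + θ (z.2 - z'.2) * fderiv ℝ Λ z v * Λ z')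
        • K (z.1 - z'.1) := by
    intro z v
    have := fderiv_smul_test (hΛ.1.differentiable (by simp)) (hτ.differentiable (by simp))
      (hF.differentiable (by simp)) (Λ z') z v
    rw [fderiv_comp_sub, deriv_comp_sub_const] at this
    exact this
  have hmom := h.momentum ξ hξ
  have hcoord : ∀ (v : R3 × ℝ) (i : Fin 3), ∃ C, ∀ z, ‖(fderiv ℝ ξ z v) i‖ ≤ C := fun v i => by
    obtain ⟨C, hC⟩ := hξ.exists_bound_fderiv v
    exact ⟨C, fun z => (PiLp.norm_apply_le _ i).trans (hC z)⟩
  have hcont : ∀ (v : R3 × ℝ) (i : Fin 3), AEStronglyMeasurable fun z => (fderiv ℝ ξ z v) i :=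
    fun v i => ((EuclideanSpace.proj (𝕜 := ℝ) i).continuous.comp
      (hξ.continuous_fderiv_apply v)).aestronglyMeasurable
  have i1 : Integrable fun z => ϱ z * inner ℝ (u z) (dt ξ z) := by
    have : (fun z => ϱ z * inner ℝ (u z) (dt ξ z))
        = fun z => ∑ i, ϱ z * u z i * (fderiv ℝ ξ z (0, 1)) i := by
      funext z; rw [inner_eq_sum, Finset.mul_sum]; simp only [dt, mul_assoc]
    rw [this]
    refine integrable_finsetSum _ fun i _ => ?_
    obtain ⟨C, hC⟩ := hcoord (0, 1) i
    exact (h.slice_momentum i).integrable.mul_bdd (hcont _ i) (ae_of_all _ hC)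
  have i2 : Integrable fun z => ∑ i, ∑ j, (ϱ z * u z i * u z j
      + (if i = j then pressure ε m (ϱ z) else 0) - stress ν₁ ν₂ (Du z) i j) * dx j ξ z i := by
    refine integrable_finsetSum _ fun i _ => integrable_finsetSum _ fun j _ => ?_
    obtain ⟨C, hC⟩ := hcoord (e j, 0) i
    exact (h.integrable_flux i j).mul_bdd (hcont _ i) (ae_of_all _ hC)
  have i3 : Integrable fun z => ϱ z * inner ℝ (f z) (ξ z) := by
    have : (fun z => ϱ z * inner ℝ (f z) (ξ z)) = fun z => ∑ i, ϱ z * f z i * ξ z i := by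
      funext z; rw [inner_eq_sum, Finset.mul_sum]; simp only [mul_assoc]
    rw [this]
    refine integrable_finsetSum _ fun i _ => ?_
    obtain ⟨C, hC⟩ := hξ.exists_bound
    exact (h.slice_force i).integrable.mul_bdd ((EuclideanSpace.proj (𝕜 := ℝ) i).continuous.comp
      hξ.1.continuous).aestronglyMeasurable
      (ae_of_all _ fun z => (PiLp.norm_apply_le _ i).trans (hC z))
  rw [← integral_add i1 i2, ← integral_add (by exact i1.add i2) i3] at hmom
  have : ∀ z, deriv θ (z.2 - z'.2) * doubledTime ϱ u K Λ (z, z')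
      + θ (z.2 - z'.2) * doubledMomentum ν₁ ν₂ ε m f ϱ u Du K Λ (z, z')
      = ϱ z' * (ϱ z * inner ℝ (u z) (dt ξ z) + (∑ i, ∑ j, (ϱ z * u z i * u z j
      + (if i = j then pressure ε m (ϱ z) else 0) - stress ν₁ ν₂ (Du z) i j) * dx j ξ z i)
      + ϱ z * inner ℝ (f z) (ξ z)) := by
    intro z
    have ex : ∀ i, ξ z i = θ (z.2 - z'.2) * Λ z * Λ z' * K (z.1 - z'.1) i := fun i => by
      simp [hξdef]
    have et : ∀ i, dt ξ z i = (deriv θ (z.2 - z'.2) * Λ z + θ (z.2 - z'.2) * dt Λ z) * Λ z'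
        * K (z.1 - z'.1) i := fun i => by
      simp only [dt, hfd]
      simp
      exact Or.inl (by ring)
    have ed : ∀ i j, dx j ξ z i = θ (z.2 - z'.2) * Λ z * Λ z' * fderiv ℝ K (z.1 - z'.1) (e j) i
        + θ (z.2 - z'.2) * dx j Λ z * Λ z' * K (z.1 - z'.1) i := fun i j => by
      simp only [dx, hfd]
      simp
    rw [inner_eq_sum, inner_eq_sum]
    simp only [ex, et, ed]
    simp only [doubledTime, doubledMomentum, prodKer, diffKer, diffKer']
    change _ = ϱ z' * (ϱ z * _ + (∑ i, ∑ j, flux ν₁ ν₂ ε m ϱ u Du i j z * _) + ϱ z * _)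
    simp only [mul_add, Finset.mul_sum, Finset.sum_add_distrib, add_mul]
    have c1 : ∀ a b c d g k : ℝ, a + (b + c + d + g) = a + b + (g + d) + c := by intros; ring
    rw [c1 _ _ _ _ _ 0]
    congr 1
    · congr 1
      · congr 1 <;> exact Finset.sum_congr rfl fun i _ => by ring
      · congr 1 <;> exact Finset.sum_congr rfl fun i _ => Finset.sum_congr rfl fun j _ => by ring
    · exact Finset.sum_congr rfl fun i _ => by ring
  simp only [this]
  rw [integral_const_mul, hmom, mul_zero]

/-- The mass equation is tested in `z'` with `z` frozen, so `ϱ(z) u(z)` is a constant vector. Both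
`θ(t - t')` and `K(x - x')` are differentiated in the second point, whence the two minus signs
relative to the momentum equation. -/
lemma integral_doubledMass (h : Flow Ω T ν₁ ν₂ ε m M E f ϱ u Du) (hK : SmoothKernel K)
    (hΛ : IsTest (cylinder Ω T) Λ) {θ : ℝ → ℝ} (hθ : ContDiff ℝ ∞ θ) (z : R3 × ℝ) :
    ∫ z', (- (deriv θ (z.2 - z'.2) * doubledTime ϱ u K Λ (z, z'))
      + θ (z.2 - z'.2) * doubledMass ϱ u K Λ (z, z')) = 0 := by
  have hτ : ContDiff ℝ ∞ fun t => θ (z.2 - t) := hθ.comp (contDiff_const.sub contDiff_id)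
  have hF : ContDiff ℝ ∞ fun y => inner ℝ (ϱ z • u z) (K (z.1 - y)) :=
    contDiff_const.inner ℝ (hK.contDiff.comp (contDiff_const.sub contDiff_id))
  have hψ := isTest_smul hΛ hτ hF (Λ z)
  set ψ : R3 × ℝ → ℝ := fun z' =>
    (θ (z.2 - z'.2) * Λ z' * Λ z) • inner ℝ (ϱ z • u z) (K (z.1 - z'.1)) with hψdef
  have hfd : ∀ z' v, fderiv ℝ ψ z' v = (θ (z.2 - z'.2) * Λ z' * Λ z)
        * inner ℝ (ϱ z • u z) (- fderiv ℝ K (z.1 - z'.1) v.1)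
      + (- deriv θ (z.2 - z'.2) * v.2 * Λ z' * Λ z + θ (z.2 - z'.2) * fderiv ℝ Λ z' v * Λ z)
        * inner ℝ (ϱ z • u z) (K (z.1 - z'.1)) := by
    intro z' v
    have := fderiv_smul_test (hΛ.1.differentiable (by simp)) (hτ.differentiable (by simp))
      (hF.differentiable (by simp)) (Λ z) z' v
    rw [deriv_comp_const_sub] at this
    have hd : HasFDerivAt (fun y => K (z.1 - y)) (-(fderiv ℝ K (z.1 - z'.1))) z'.1 := by
      have h1 := (hK.contDiff.differentiable (by simp) (z.1 - z'.1)).hasFDerivAt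
      have h2 : HasFDerivAt (fun y => z.1 - y) (-ContinuousLinearMap.id ℝ R3) z'.1 :=
        (hasFDerivAt_id z'.1).const_sub z.1
      have h3 := h1.comp z'.1 h2
      rw [ContinuousLinearMap.comp_neg, ContinuousLinearMap.comp_id] at h3
      exact h3
    have hd2 := (innerSL ℝ (ϱ z • u z)).hasFDerivAt.comp z'.1 hd
    have e2 : fderiv ℝ (fun y => inner ℝ (ϱ z • u z) (K (z.1 - y))) z'.1
        = (innerSL ℝ (ϱ z • u z)).comp (-(fderiv ℝ K (z.1 - z'.1))) := hd2.fderiv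
    rw [e2] at this
    exact this
  have hmass := h.mass ψ hψ
  have : ∀ z', - (deriv θ (z.2 - z'.2) * doubledTime ϱ u K Λ (z, z'))
      + θ (z.2 - z'.2) * doubledMass ϱ u K Λ (z, z')
      = ϱ z' * dt ψ z' + ∑ j, ϱ z' * u z' j * dx j ψ z' := by
    intro z'
    have et : dt ψ z' = (- deriv θ (z.2 - z'.2) * Λ z' + θ (z.2 - z'.2) * dt Λ z') * Λ z
        * ∑ i, ϱ z * u z i * K (z.1 - z'.1) i := by
      simp only [dt, hfd, inner_eq_sum]
      simp
      exact Or.inl (by ring)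
    have ed : ∀ j, dx j ψ z' = θ (z.2 - z'.2) * dx j Λ z' * Λ z
          * (∑ i, ϱ z * u z i * K (z.1 - z'.1) i)
        - θ (z.2 - z'.2) * Λ z' * Λ z
          * ∑ i, ϱ z * u z i * fderiv ℝ K (z.1 - z'.1) (e j) i := fun j => by
      simp only [dx, hfd, inner_eq_sum]
      simp
      ring
    simp only [et, ed, doubledTime, doubledMass, prodKer, diffKer, diffKer']
    simp only [mul_add, mul_sub, Finset.mul_sum, Finset.sum_add_distrib, add_mul,
      Finset.sum_sub_distrib, ← Finset.sum_neg_distrib]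
    rw [Finset.sum_comm (f := fun j i => ϱ z' * u z' j * (θ (z.2 - z'.2) * dx j Λ z' * Λ z
      * (ϱ z * u z i * K (z.1 - z'.1) i))), Finset.sum_comm (f := fun j i => ϱ z' * u z' j
      * (θ (z.2 - z'.2) * Λ z' * Λ z * (ϱ z * u z i * fderiv ℝ K (z.1 - z'.1) (e j) i)))]
    have c1 : ∀ a b c d : ℝ, a + (b + c - d) = a + b + (c - d) := by intros; ring
    rw [c1]
    congr 1
    · congr 1 <;> exact Finset.sum_congr rfl fun i _ => by ring
    · congr 1 <;> exact Finset.sum_congr rfl fun i _ => Finset.sum_congr rfl fun j _ => by ring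
  simp only [this]
  exact hmass

lemma measurable_diffKer (hK : SmoothKernel K) (i : Fin 3) : Measurable (diffKer K i) := by
  have := hK.contDiff.continuous
  unfold diffKer
  exact (measurable_coord i).comp (by fun_prop)

lemma measurable_diffKer' (hK : SmoothKernel K) (i j : Fin 3) : Measurable (diffKer' K i j) := by
  have h1 : Continuous fun z => fderiv ℝ K z (e j) :=
    (hK.contDiff.continuous_fderiv (by simp)).clm_apply continuous_const
  unfold diffKer'
  exact (measurable_coord i).comp (h1.comp (by fun_prop)).measurable

end Flow

lemma Slice.mul_bounded {B c : R3 × ℝ → ℝ} (hB : Slice B) (hc : Continuous c) {C : ℝ}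
    (hC : ∀ z, ‖c z‖ ≤ C) : Slice fun z => B z * c z := by
  obtain ⟨C', hC', hb⟩ := hB.bound
  refine ⟨hB.measurable.mul hc.measurable,
    hB.integrable.mul_bdd hc.aestronglyMeasurable (ae_of_all _ hC),
    C' * ENNReal.ofReal C, ENNReal.mul_ne_top hC' ENNReal.ofReal_ne_top, ?_⟩
  filter_upwards [hb] with t ht
  have hm := hB.measurable
  calc ∫⁻ x, ‖B (x, t) * c (x, t)‖ₑ ≤ ∫⁻ x, ‖B (x, t)‖ₑ * ENNReal.ofReal C := by
        refine lintegral_mono fun x => ?_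
        rw [enorm_mul]
        gcongr
        rw [← ofReal_norm]
        exact ENNReal.ofReal_le_ofReal (hC _)
    _ ≤ C' * ENNReal.ofReal C := by
        rw [lintegral_mul_const _ (by fun_prop)]
        gcongr

namespace Flow

variable {Ω : Set R3} {T ν₁ ν₂ ε m M E : ℝ} {f : R3 × ℝ → R3} {ϱ : R3 × ℝ → ℝ} {u : R3 × ℝ → R3}
  {Du : R3 × ℝ → Fin 3 → R3} {K : R3 → R3} {Λ : R3 × ℝ → ℝ}

/-- In each product the second factor contains only density or momentum, which are slice-bounded;
the flux, which is only integrable because of the stress, always stands in the first factor. -/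
lemma hasTrace_doubled (h : Flow Ω T ν₁ ν₂ ε m M E f ϱ u Du) (hK : SmoothKernel K)
    (hΛ : IsTest (cylinder Ω T) Λ) :
    HasTrace (doubledTime ϱ u K Λ) ∧ HasTrace (doubledMomentum ν₁ ν₂ ε m f ϱ u Du K Λ)
      ∧ HasTrace (doubledMass ϱ u K Λ) := by
  obtain ⟨C0, hC0⟩ := hΛ.exists_bound
  obtain ⟨Ct, hCt⟩ := hΛ.exists_bound_fderiv (0, 1)
  have hCx : ∀ j, ∃ C, ∀ z, ‖dx j Λ z‖ ≤ C := fun j => hΛ.exists_bound_fderiv (e j, 0)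
  have hc0 := hΛ.1.continuous
  have hct : Continuous (dt Λ) := hΛ.continuous_fderiv_apply (0, 1)
  have hcx : ∀ j, Continuous (dx j Λ) := fun j => hΛ.continuous_fderiv_apply (e j, 0)
  obtain ⟨k0, hk0⟩ := hK.bound
  obtain ⟨k1, hk1⟩ := hK.bound_fderiv
  have hb0 : ∀ i, ∃ C, ∀ p, |diffKer K i p| ≤ C := fun i => ⟨k0, fun p => hk0 _ i⟩
  have hb1 : ∀ i j, ∃ C, ∀ p, |diffKer' K i j p| ≤ C := fun i j => ⟨k1, fun p => hk1 _ i j⟩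
  have s1 : Slice fun z => ϱ z * Λ z := h.slice_density.mul_bounded hc0 hC0
  have s2 : Slice fun z => ϱ z * dt Λ z := h.slice_density.mul_bounded hct hCt
  have s3 : ∀ i, Slice fun z => ϱ z * u z i * Λ z := fun i =>
    (h.slice_momentum i).mul_bounded hc0 hC0
  have s4 : ∀ i, Slice fun z => ϱ z * u z i * dt Λ z := fun i =>
    (h.slice_momentum i).mul_bounded hct hCt
  have s5 : ∀ i j, Slice fun z => ϱ z * u z i * dx j Λ z := fun i j =>
    (h.slice_momentum i).mul_bounded (hcx j) (hCx j).choose_spec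
  have s6 : ∀ i, Slice fun z => ϱ z * f z i * Λ z := fun i =>
    (h.slice_force i).mul_bounded hc0 hC0
  have i1 : ∀ i j, Integrable fun z => flux ν₁ ν₂ ε m ϱ u Du i j z * dx j Λ z := fun i j =>
    (h.integrable_flux i j).mul_bdd (hcx j).aestronglyMeasurable (ae_of_all _ (hCx j).choose_spec)
  have i2 : ∀ i j, Integrable fun z => flux ν₁ ν₂ ε m ϱ u Du i j z * Λ z := fun i j =>
    (h.integrable_flux i j).mul_bdd hc0.aestronglyMeasurable (ae_of_all _ hC0)
  have mk := measurable_diffKer hK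
  have mk' := measurable_diffKer' hK
  refine ⟨?_, ?_, ?_⟩
  · exact HasTrace.sum _ fun i => s1.hasTrace (s3 i).integrable (s3 i).measurable (mk i) (hb0 i)
  · refine HasTrace.add (HasTrace.add (HasTrace.add ?_ ?_) ?_) ?_
    · exact HasTrace.sum _ fun i => s1.hasTrace (s4 i).integrable (s4 i).measurable (mk i) (hb0 i)
    · exact HasTrace.sum _ fun i => s1.hasTrace (s6 i).integrable (s6 i).measurable (mk i) (hb0 i)
    · exact HasTrace.sum _ fun i => HasTrace.sum _ fun j => s1.hasTrace (i1 i j)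
        ((h.measurable_flux i j).mul (hcx j).measurable) (mk i) (hb0 i)
    · exact HasTrace.sum _ fun i => HasTrace.sum _ fun j => s1.hasTrace (i2 i j)
        ((h.measurable_flux i j).mul hc0.measurable) (mk' i j) (hb1 i j)
  · refine HasTrace.sub (HasTrace.add ?_ ?_) ?_
    · exact HasTrace.sum _ fun i => s2.hasTrace (s3 i).integrable (s3 i).measurable (mk i) (hb0 i)
    · exact HasTrace.sum _ fun i => HasTrace.sum _ fun j => (s5 j j).hasTrace (s3 i).integrable
        (s3 i).measurable (mk i) (hb0 i)
    · exact HasTrace.sum _ fun i => HasTrace.sum _ fun j => (s3 j).hasTrace (s3 i).integrable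
        (s3 i).measurable (mk' i j) (hb1 i j)

/-- The interaction Morawetz identity. -/
theorem integral_doubled_eq_zero (h : Flow Ω T ν₁ ν₂ ε m M E f ϱ u Du) (hK : SmoothKernel K)
    (hΛ : IsTest (cylinder Ω T) Λ) :
    (Integrable fun d : (R3 × R3) × ℝ =>
      doubledMomentum ν₁ ν₂ ε m f ϱ u Du K Λ ((d.1.1, d.2), (d.1.2, d.2))
        + doubledMass ϱ u K Λ ((d.1.1, d.2), (d.1.2, d.2))) ∧
    ∫ d : (R3 × R3) × ℝ, (doubledMomentum ν₁ ν₂ ε m f ϱ u Du K Λ ((d.1.1, d.2), (d.1.2, d.2))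
        + doubledMass ϱ u K Λ ((d.1.1, d.2), (d.1.2, d.2))) = 0 := by
  obtain ⟨t0, t1, t2⟩ := h.hasTrace_doubled hK hΛ
  -- The diagonal integral is the limit of the mollified integrals, and each of these vanishes.
  refine ⟨(t1.add t2).integrable_diag, tendsto_nhds_unique (t1.add t2).tendsto ?_⟩
  refine tendsto_const_nhds.congr fun n => ?_
  have hθ := timeMoll_contDiff n
  have hd : ContDiff ℝ ∞ (deriv (timeMoll n)) := by
    exact (contDiff_infty_iff_deriv.1 hθ).2
  obtain ⟨C, hC⟩ := (timeMoll_hasCompactSupport n).deriv.exists_bound_of_continuous hd.continuous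
  have j0 := t0.integrable_mul _ hd.continuous ⟨C, hC⟩
  have j1 := t1.integrable_timeMoll n
  have j2 := t2.integrable_timeMoll n
  have k1 : ∫ q : (R3 × ℝ) × R3 × ℝ, (deriv (timeMoll n) (q.1.2 - q.2.2) * doubledTime ϱ u K Λ q
      + timeMoll n (q.1.2 - q.2.2) * doubledMomentum ν₁ ν₂ ε m f ϱ u Du K Λ q) = 0 := by
    rw [Measure.volume_eq_prod, integral_prod_symm _ (by exact j0.add j1)]
    simp only [h.integral_doubledMomentum hK hΛ hθ, integral_zero]
  have k2 : ∫ q : (R3 × ℝ) × R3 × ℝ, (-(deriv (timeMoll n) (q.1.2 - q.2.2) * doubledTime ϱ u K Λ q)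
      + timeMoll n (q.1.2 - q.2.2) * doubledMass ϱ u K Λ q) = 0 := by
    rw [Measure.volume_eq_prod, integral_prod _ (by exact j0.neg.add j2)]
    simp only [h.integral_doubledMass hK hΛ hθ, integral_zero]
  -- Adding the two equations cancels the terms with the derivative of the mollifier, which would
  -- blow up in the limit.
  have k3 := integral_add (by exact j0.add j1) (by exact j0.neg.add j2)
    (f := fun q : (R3 × ℝ) × R3 × ℝ => (deriv (timeMoll n) (q.1.2 - q.2.2) * doubledTime ϱ u K Λ q
      + timeMoll n (q.1.2 - q.2.2) * doubledMomentum ν₁ ν₂ ε m f ϱ u Du K Λ q))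
    (g := fun q : (R3 × ℝ) × R3 × ℝ =>
      (-(deriv (timeMoll n) (q.1.2 - q.2.2) * doubledTime ϱ u K Λ q)
      + timeMoll n (q.1.2 - q.2.2) * doubledMass ϱ u K Λ q))
  rw [k1, k2, add_zero] at k3
  rw [← k3]
  refine integral_congr_ae (ae_of_all _ fun q => ?_)
  ring

end Flow

/-! ### The radial kernel with logarithmic weight and its derivative. -/

/-- The logarithmic weight. -/
noncomputable def ell (w : ℝ) : ℝ := 4 + Real.log (1 + w⁻¹)

lemma four_le_ell {w : ℝ} (hw : 0 ≤ w) : 4 ≤ ell w := by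
  have : 0 ≤ w⁻¹ := inv_nonneg.2 hw
  have := Real.log_nonneg (show 1 ≤ 1 + w⁻¹ by linarith)
  unfold ell; linarith

lemma ell_pos {w : ℝ} (hw : 0 ≤ w) : 0 < ell w := by linarith [four_le_ell hw]

lemma ell_anti {w w' : ℝ} (hw : 0 < w) (h : w ≤ w') : ell w' ≤ ell w := by
  unfold ell
  have : 0 < w' := hw.trans_le h
  gcongr

@[fun_prop]
lemma measurable_ell : Measurable ell := by unfold ell; fun_prop

/-- The scalar profile of the radial kernel. -/
noncomputable def gker (s w : ℝ) : ℝ := w ^ (-(1 / 2) : ℝ) * ell w ^ s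

@[fun_prop]
lemma measurable_gker (s : ℝ) : Measurable (gker s) := by unfold gker; fun_prop

lemma gker_nonneg {s w : ℝ} (hw : 0 ≤ w) : 0 ≤ gker s w := by
  have := ell_pos hw
  unfold gker; positivity

lemma gker_sub_one {s w : ℝ} (hw : 0 < w) : gker (s - 1) w = gker s w / ell w := by
  unfold gker
  rw [Real.rpow_sub_one (ell_pos hw.le).ne', mul_div_assoc]

lemma gker_sub_one_le {s w : ℝ} (hw : 0 < w) : gker (s - 1) w ≤ gker s w / 4 := by
  rw [gker_sub_one hw]
  exact div_le_div_of_nonneg_left (gker_nonneg hw.le) (by norm_num) (four_le_ell hw.le)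

lemma gker_anti {s w w' : ℝ} (hs : 0 ≤ s) (hw : 0 < w) (h : w ≤ w') : gker s w' ≤ gker s w := by
  unfold gker
  have h1 := ell_anti hw h
  have h2 := ell_pos (hw.le.trans h)
  have h3 : w' ^ (-(1 / 2) : ℝ) ≤ w ^ (-(1 / 2) : ℝ) :=
    Real.rpow_le_rpow_of_nonpos hw h (by norm_num)
  have h4 : ell w' ^ s ≤ ell w ^ s := Real.rpow_le_rpow h2.le h1 hs
  have : 0 ≤ w ^ (-(1 / 2) : ℝ) := by positivity
  gcongr

/-- The derivative of the scalar profile. -/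
noncomputable def gker' (s w : ℝ) : ℝ := -(gker s w / 2 + s * gker (s - 1) w / (w + 1)) / w

lemma hasDerivAt_ell {w : ℝ} (hw : 0 < w) : HasDerivAt ell (-(1 / (w * (w + 1)))) w := by
  have h1 : HasDerivAt (fun w : ℝ => 1 + w⁻¹) (-(w ^ 2)⁻¹) w := (hasDerivAt_inv hw.ne').const_add 1
  have h2 := (h1.log (by positivity)).const_add 4
  refine h2.congr_deriv ?_
  field_simp

lemma hasDerivAt_gker (s : ℝ) {w : ℝ} (hw : 0 < w) : HasDerivAt (gker s) (gker' s w) w := by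
  have h1 := Real.hasDerivAt_rpow_const (x := w) (p := (-(1 / 2) : ℝ)) (Or.inl hw.ne')
  have h2 := (hasDerivAt_ell hw).rpow_const (p := s) (Or.inl (ell_pos hw.le).ne')
  refine (h1.mul h2).congr_deriv ?_
  unfold gker' gker
  rw [Real.rpow_sub_one hw.ne']
  field_simp
  ring

lemma contDiffAt_gker (s : ℝ) {w : ℝ} (hw : 0 < w) : ContDiffAt ℝ ∞ (gker s) w := by
  have h1 : ContDiffAt ℝ ∞ ell w := by
    unfold ell
    exact contDiffAt_const.add (((contDiffAt_const.add (contDiffAt_inv ℝ hw.ne'))).log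
      (by positivity))
  unfold gker
  exact (contDiffAt_id.rpow_const_of_ne hw.ne').mul (h1.rpow_const_of_ne (ell_pos hw.le).ne')

lemma gker'_nonpos {s w : ℝ} (hs : 0 ≤ s) (hw : 0 < w) : gker' s w ≤ 0 := by
  have h1 := gker_nonneg (s := s) hw.le
  have h2 := gker_nonneg (s := s - 1) hw.le
  unfold gker'
  rw [neg_div]
  have : 0 ≤ (gker s w / 2 + s * gker (s - 1) w / (w + 1)) / w := by positivity
  linarith

lemma two_mul_gker'_le {s w : ℝ} (hs : 0 ≤ s) (hw : 0 < w) :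
    -(2 * w * gker' s w) ≤ gker s w + 2 * s * gker (s - 1) w := by
  have h2 := gker_nonneg (s := s - 1) hw.le
  have h3 : s * gker (s - 1) w / (w + 1) ≤ s * gker (s - 1) w :=
    div_le_self (by positivity) (by linarith)
  have : -(2 * w * gker' s w) = gker s w + 2 * (s * gker (s - 1) w / (w + 1)) := by
    unfold gker'; field_simp
  rw [this]
  linarith

/-- The regularised radial vector field `z / |z|` with a logarithmic weight. -/
noncomputable def radialKer (s δ : ℝ) (z : R3) : R3 := gker s (‖z‖ ^ 2 + δ) • z

section

variable {s δ : ℝ}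

lemma hasFDerivAt_radialKer (s : ℝ) (hδ : 0 < δ) (z : R3) :
    HasFDerivAt (radialKer s δ) (gker s (‖z‖ ^ 2 + δ) • ContinuousLinearMap.id ℝ R3
      + (gker' s (‖z‖ ^ 2 + δ) • (2 • innerSL ℝ z)).smulRight z) z := by
  have hw : 0 < ‖z‖ ^ 2 + δ := by positivity
  have h1 : HasFDerivAt (fun z : R3 => ‖z‖ ^ 2 + δ) (2 • innerSL ℝ z) z :=
    (hasStrictFDerivAt_norm_sq z).hasFDerivAt.add_const δ
  have h2 := (hasDerivAt_gker s hw).comp_hasFDerivAt z h1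
  exact h2.smul (hasFDerivAt_id z)

lemma fderiv_radialKer (s : ℝ) (hδ : 0 < δ) (z : R3) (i j : Fin 3) :
    fderiv ℝ (radialKer s δ) z (e j) i
      = (if i = j then gker s (‖z‖ ^ 2 + δ) else 0) + 2 * gker' s (‖z‖ ^ 2 + δ) * z i * z j := by
  rw [(hasFDerivAt_radialKer s hδ z).fderiv]
  have h1 : inner ℝ z (e j) = z j := by
    rw [Flow.inner_eq_sum]; simp [e]
  simp [e, eq_comm] at h1 ⊢
  rw [h1]
  ring

lemma contDiff_radialKer (s : ℝ) (hδ : 0 < δ) : ContDiff ℝ ∞ (radialKer s δ) := by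
  refine contDiff_iff_contDiffAt.2 fun z => ?_
  have hw : 0 < ‖z‖ ^ 2 + δ := by positivity
  have h1 : ContDiffAt ℝ ∞ (fun z : R3 => ‖z‖ ^ 2 + δ) z :=
    ((contDiff_norm_sq ℝ).contDiffAt).add contDiffAt_const
  exact ((contDiffAt_gker s hw).comp z h1).smul contDiffAt_id

lemma abs_radialKer_le (hδ : 0 < δ) (z : R3) (i : Fin 3) :
    |radialKer s δ z i| ≤ ell (‖z‖ ^ 2 + δ) ^ s := by
  have hw : 0 < ‖z‖ ^ 2 + δ := by positivity
  have h1 : |radialKer s δ z i| ≤ gker s (‖z‖ ^ 2 + δ) * ‖z‖ := by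
    simp only [radialKer, PiLp.smul_apply, smul_eq_mul, abs_mul, abs_of_nonneg (gker_nonneg hw.le)]
    exact mul_le_mul_of_nonneg_left (abs_apply_le z i) (gker_nonneg hw.le)
  refine h1.trans ?_
  have h2 : ‖z‖ ≤ (‖z‖ ^ 2 + δ) ^ (1 / 2 : ℝ) := by
    rw [← Real.sqrt_eq_rpow]
    exact Real.le_sqrt_of_sq_le (by linarith)
  have h3 := ell_pos hw.le
  calc gker s (‖z‖ ^ 2 + δ) * ‖z‖
      ≤ gker s (‖z‖ ^ 2 + δ) * (‖z‖ ^ 2 + δ) ^ (1 / 2 : ℝ) :=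
        mul_le_mul_of_nonneg_left h2 (gker_nonneg hw.le)
    _ = ell (‖z‖ ^ 2 + δ) ^ s * ((‖z‖ ^ 2 + δ) ^ (-(1 / 2) : ℝ)
          * (‖z‖ ^ 2 + δ) ^ (1 / 2 : ℝ)) := by unfold gker; ring
    _ = ell (‖z‖ ^ 2 + δ) ^ s := by
        rw [← Real.rpow_add hw]; norm_num

lemma abs_fderiv_radialKer_le (hs : 0 ≤ s) (hs2 : s ≤ 2) (hδ : 0 < δ) (z : R3) (i j : Fin 3) :
    |fderiv ℝ (radialKer s δ) z (e j) i| ≤ 3 * gker s (‖z‖ ^ 2 + δ) := by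
  have hw : 0 < ‖z‖ ^ 2 + δ := by positivity
  have h0 := gker_nonneg (s := s) hw.le
  rw [fderiv_radialKer s hδ]
  refine (abs_add_le _ _).trans ?_
  have h1 : |if i = j then gker s (‖z‖ ^ 2 + δ) else 0| ≤ gker s (‖z‖ ^ 2 + δ) := by
    split_ifs
    · rw [abs_of_nonneg h0]
    · simpa using h0
  have h2 : |2 * gker' s (‖z‖ ^ 2 + δ) * z i * z j|
      ≤ -(2 * (‖z‖ ^ 2 + δ) * gker' s (‖z‖ ^ 2 + δ)) := by
    have hn := gker'_nonpos hs hw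
    have : |z i| * |z j| ≤ ‖z‖ ^ 2 + δ := by
      have a1 := abs_apply_le z i
      have a2 := abs_apply_le z j
      nlinarith [abs_nonneg (z i), abs_nonneg (z j)]
    rw [mul_assoc, abs_mul, abs_mul, abs_mul, abs_two, abs_of_nonpos hn]
    nlinarith
  have h3 := two_mul_gker'_le hs hw
  have h4 := gker_sub_one_le (s := s) hw
  nlinarith

/-- The gradient of the kernel has transverse eigenvalue `gker s` and radial eigenvalue `gker s +
2|z|² gker'`. Without the logarithm both would be nonnegative; differentiating `ell^s` makes the
radial one negative by at most `2s gker (s - 1)`, which is smaller than `gker s` by a factor of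
order `ell`. -/
lemma radialKer_quadratic (hs : 0 ≤ s) (hδ : 0 < δ) (z a : R3) :
    -(2 * s * gker (s - 1) (‖z‖ ^ 2 + δ)) * ‖a‖ ^ 2
      ≤ ∑ i, ∑ j, a i * a j * fderiv ℝ (radialKer s δ) z (e j) i := by
  have hw : 0 < ‖z‖ ^ 2 + δ := by positivity
  have e1 : ∑ i, ∑ j, a i * a j * fderiv ℝ (radialKer s δ) z (e j) i
      = gker s (‖z‖ ^ 2 + δ) * ‖a‖ ^ 2 + 2 * gker' s (‖z‖ ^ 2 + δ) * (inner ℝ a z) ^ 2 := by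
    simp only [fderiv_radialKer s hδ, Flow.inner_eq_sum, EuclideanSpace.real_norm_sq_eq,
      Fin.sum_univ_three]
    simp
    ring
  rw [e1]
  have h1 : (inner ℝ a z) ^ 2 ≤ ‖a‖ ^ 2 * (‖z‖ ^ 2 + δ) := by
    have := abs_real_inner_le_norm a z
    have h2 : (inner ℝ a z) ^ 2 ≤ (‖a‖ * ‖z‖) ^ 2 := by
      rw [← sq_abs (inner ℝ a z)]
      exact pow_le_pow_left₀ (abs_nonneg _) this 2
    nlinarith [mul_nonneg (sq_nonneg ‖a‖) hδ.le]
  have hn := gker'_nonpos hs hw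
  have h3 := two_mul_gker'_le hs hw
  nlinarith [mul_le_mul_of_nonneg_left h3 (sq_nonneg ‖a‖), mul_le_mul_of_nonpos_left h1 hn]

/-- Of `3 gker s` the radial derivative removes at most `gker s + 2s gker (s - 1)`. Since `ell ≥ 4`
and `s ≤ 2`, the second part is at most `gker s`, and one copy remains. -/
lemma radialKer_trace (hs : 0 ≤ s) (hs2 : s ≤ 2) (hδ : 0 < δ) (z : R3) :
    gker s (‖z‖ ^ 2 + δ) ≤ ∑ i, fderiv ℝ (radialKer s δ) z (e i) i := by
  have hw : 0 < ‖z‖ ^ 2 + δ := by positivity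
  have e1 : ∑ i, fderiv ℝ (radialKer s δ) z (e i) i
      = 3 * gker s (‖z‖ ^ 2 + δ) + 2 * gker' s (‖z‖ ^ 2 + δ) * ‖z‖ ^ 2 := by
    simp only [fderiv_radialKer s hδ, EuclideanSpace.real_norm_sq_eq, Fin.sum_univ_three]
    simp
    ring
  rw [e1]
  have hn := gker'_nonpos hs hw
  have h0 := gker_nonneg (s := s) hw.le
  have h3 := two_mul_gker'_le hs hw
  have h4 := gker_sub_one_le (s := s) hw
  have h5 : 2 * s * gker (s - 1) (‖z‖ ^ 2 + δ) ≤ gker s (‖z‖ ^ 2 + δ) := by nlinarith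
  nlinarith [mul_nonneg (neg_nonneg.2 hn) hδ.le]

lemma smoothKernel_radialKer (hs : 0 ≤ s) (hs2 : s ≤ 2) (hδ : 0 < δ) :
    SmoothKernel (radialKer s δ) := by
  refine ⟨contDiff_radialKer s hδ, ⟨ell δ ^ s, fun z i => (abs_radialKer_le hδ z i).trans ?_⟩,
    ⟨3 * gker s δ, fun z i j => (abs_fderiv_radialKer_le hs hs2 hδ z i j).trans ?_⟩⟩
  · exact Real.rpow_le_rpow (ell_pos (by positivity)).le (ell_anti hδ (by simp)) hs
  · exact mul_le_mul_of_nonneg_left (gker_anti hs hδ (by simp)) (by norm_num)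

end

/-! ### Monotonicity and integrability of the borderline kernels. -/

lemma ell_le_mul {w w' : ℝ} (hw : 0 < w) (h : w ≤ w') :
    ell w ≤ ell w' * (w' / w) ^ (1 / 4 : ℝ) := by
  have hw' : 0 < w' := hw.trans_le h
  have hq : 0 < w' / w := by positivity
  have h1 : ell w ≤ ell w' + Real.log (w' / w) := by
    unfold ell
    rw [add_assoc, ← Real.log_mul (by positivity) (by positivity)]
    gcongr
    rw [add_mul, one_mul, inv_mul_eq_div, div_div_cancel_left' hw'.ne']
    have : 1 ≤ w' / w := (one_le_div hw).2 h
    linarith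
  have h2 : 0 ≤ Real.log (w' / w) := Real.log_nonneg ((one_le_div hw).2 h)
  -- This is `1 + y ≤ exp y`; the summand `4` in `ell` yields the exponent `1/4`, so that powers of
  -- `ell` vary more slowly than the powers of `w` beside them.
  have h3 : 1 + Real.log (w' / w) / 4 ≤ (w' / w) ^ (1 / 4 : ℝ) := by
    rw [Real.rpow_def_of_pos hq]
    have := Real.add_one_le_exp (Real.log (w' / w) * (1 / 4))
    linarith
  have h4 := four_le_ell hw'.le
  calc ell w ≤ ell w' * (1 + Real.log (w' / w) / 4) := by nlinarith
    _ ≤ _ := by gcongr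

lemma ell_rpow_le {w w' a : ℝ} (hw : 0 < w) (h : w ≤ w') (ha : 0 ≤ a) :
    ell w ^ a ≤ ell w' ^ a * (w' / w) ^ (a / 4) := by
  have hw' : 0 < w' := hw.trans_le h
  have h1 := Real.rpow_le_rpow (ell_pos hw.le).le (ell_le_mul hw h) ha
  rwa [Real.mul_rpow (ell_pos hw'.le).le (by positivity), ← Real.rpow_mul (by positivity),
    show (1 / 4 : ℝ) * a = a / 4 by ring] at h1

/-- The borderline cubic kernel. -/
noncomputable def cubicKer (c w : ℝ) : ℝ := w ^ (-(3 / 2) : ℝ) * ell w ^ (-c)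

@[fun_prop]
lemma measurable_cubicKer (c : ℝ) : Measurable (cubicKer c) := by unfold cubicKer; fun_prop

lemma cubicKer_nonneg {c w : ℝ} (hw : 0 ≤ w) : 0 ≤ cubicKer c w := by
  have := ell_pos hw
  unfold cubicKer; positivity

/-- The factor `ell^(-c)` increases with `w`, but by a factor of at most `(w'/w)^(c/4) ≤
(w'/w)^(3/2)`, which the decrease of `w^(-3/2)` outweighs. Monotonicity is what allows `δ` to be
dropped from the error kernels. -/
lemma cubicKer_anti {c w w' : ℝ} (hc : 0 ≤ c) (hc6 : c ≤ 6) (hw : 0 < w) (h : w ≤ w') :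
    cubicKer c w' ≤ cubicKer c w := by
  have hw' : 0 < w' := hw.trans_le h
  have h1 := ell_pos hw.le
  have h2 := ell_pos hw'.le
  have h3 := ell_rpow_le hw h hc
  have hq : 1 ≤ w' / w := (one_le_div hw).2 h
  have h4 : (w' / w) ^ (c / 4) ≤ (w' / w) ^ (3 / 2 : ℝ) :=
    Real.rpow_le_rpow_of_exponent_le hq (by linarith)
  have h5 : ell w ^ c ≤ ell w' ^ c * (w' / w) ^ (3 / 2 : ℝ) :=
    h3.trans (mul_le_mul_of_nonneg_left h4 (by positivity))
  unfold cubicKer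
  rw [Real.rpow_neg hw'.le, Real.rpow_neg hw.le, Real.rpow_neg h1.le, Real.rpow_neg h2.le,
    ← mul_inv, ← mul_inv]
  apply inv_anti₀ (by positivity)
  rw [Real.div_rpow hw'.le hw.le] at h5
  have : 0 < w ^ (3 / 2 : ℝ) := by positivity
  calc w ^ (3 / 2 : ℝ) * ell w ^ c
      ≤ w ^ (3 / 2 : ℝ) * (ell w' ^ c * (w' ^ (3 / 2 : ℝ) / w ^ (3 / 2 : ℝ))) := by gcongr
    _ = w' ^ (3 / 2 : ℝ) * ell w' ^ c := by field_simp

/-- The sum of the kernels occurring in the error terms. -/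
noncomputable def errKer (s w : ℝ) : ℝ :=
  ell w ^ (3 * s) + gker s w ^ (6 / 5 : ℝ) + cubicKer (5 - 3 * s) w

@[fun_prop]
lemma measurable_errKer (s : ℝ) : Measurable (errKer s) := by unfold errKer; fun_prop

lemma errKer_nonneg {s w : ℝ} (hw : 0 ≤ w) : 0 ≤ errKer s w := by
  have h1 := ell_pos hw
  have h2 := gker_nonneg (s := s) hw
  have h3 := cubicKer_nonneg (c := 5 - 3 * s) hw
  unfold errKer; positivity

lemma errKer_anti {s w w' : ℝ} (hs : 0 ≤ s) (hs2 : s ≤ 4 / 3) (hw : 0 < w) (h : w ≤ w') :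
    errKer s w' ≤ errKer s w := by
  have hw' : 0 < w' := hw.trans_le h
  have h1 := ell_pos hw'.le
  have h2 := gker_nonneg (s := s) hw'.le
  unfold errKer
  gcongr ?_ + ?_ + ?_
  · exact Real.rpow_le_rpow h1.le (ell_anti hw h) (by linarith)
  · exact Real.rpow_le_rpow h2 (gker_anti hs hw h) (by norm_num)
  · exact cubicKer_anti (by linarith) (by linarith) hw h

/-- The first two kernels are far from critical: at the cost of powers of `ell` at the outer radius
they are dominated by `r⁻²`. Only the cubic kernel has to be kept as it is. -/
lemma errKer_sq_le {s R r : ℝ} (hs2 : s ≤ 4 / 3) (hr : 0 < r) (hrR : r ≤ R) :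
    errKer s (r ^ 2) ≤ (ell (R ^ 2) ^ (4 : ℝ) * R ^ 2
      + ell (R ^ 2) ^ (8 / 5 : ℝ) * R ^ (4 / 5 : ℝ)) * (r ^ 2)⁻¹
      + r⁻¹ ^ 3 * ell (r ^ 2) ^ (-(5 - 3 * s)) := by
  have hR : 0 < R := hr.trans_le hrR
  have hr2 : 0 < r ^ 2 := by positivity
  have hle : r ^ 2 ≤ R ^ 2 := by gcongr
  have h4 := four_le_ell hr2.le
  have hp := ell_pos hr2.le
  have hpR := ell_pos (w := R ^ 2) (by positivity)
  have e1 : ell (r ^ 2) ^ (3 * s) ≤ ell (R ^ 2) ^ (4 : ℝ) * R ^ 2 * (r ^ 2)⁻¹ := by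
    have a1 : ell (r ^ 2) ^ (3 * s) ≤ ell (r ^ 2) ^ (4 : ℝ) :=
      Real.rpow_le_rpow_of_exponent_le (by linarith) (by linarith)
    have a2 := ell_rpow_le hr2 hle (a := 4) (by norm_num)
    rw [show (4 : ℝ) / 4 = 1 by norm_num, Real.rpow_one] at a2
    calc _ ≤ _ := a1.trans a2
      _ = _ := by ring
  have e2 : gker s (r ^ 2) ^ (6 / 5 : ℝ)
      ≤ ell (R ^ 2) ^ (8 / 5 : ℝ) * R ^ (4 / 5 : ℝ) * (r ^ 2)⁻¹ := by
    unfold gker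
    rw [Real.mul_rpow (by positivity) (by positivity), ← Real.rpow_mul hr2.le, ← Real.rpow_mul hp.le]
    have a1 : ell (r ^ 2) ^ (s * (6 / 5)) ≤ ell (r ^ 2) ^ (8 / 5 : ℝ) :=
      Real.rpow_le_rpow_of_exponent_le (by linarith) (by linarith)
    have a2 := ell_rpow_le hr2 hle (a := 8 / 5) (by norm_num)
    calc (r ^ 2) ^ (-(1 / 2) * (6 / 5) : ℝ) * ell (r ^ 2) ^ (s * (6 / 5))
        ≤ (r ^ 2) ^ (-(1 / 2) * (6 / 5) : ℝ)
          * (ell (R ^ 2) ^ (8 / 5 : ℝ) * (R ^ 2 / r ^ 2) ^ (8 / 5 / 4 : ℝ)) := by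
          gcongr
          exact a1.trans a2
      _ = ell (R ^ 2) ^ (8 / 5 : ℝ) * (R ^ 2) ^ (2 / 5 : ℝ)
          * ((r ^ 2) ^ (-(1 / 2) * (6 / 5) : ℝ) * ((r ^ 2) ^ (2 / 5 : ℝ))⁻¹) := by
          rw [Real.div_rpow (by positivity) hr2.le]
          norm_num
          ring
      _ = _ := by
          rw [← Real.rpow_neg hr2.le, ← Real.rpow_add hr2, ← Real.rpow_natCast R 2,
            ← Real.rpow_mul hR.le]
          norm_num
          exact Or.inl (Real.rpow_neg_one _)
  have e3 : cubicKer (5 - 3 * s) (r ^ 2) = r⁻¹ ^ 3 * ell (r ^ 2) ^ (-(5 - 3 * s)) := by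
    unfold cubicKer
    rw [← Real.rpow_natCast r 2, ← Real.rpow_mul hr.le]
    norm_num
  unfold errKer
  rw [e3]
  linarith

/-- An antiderivative is explicit up to a bounded factor: `ell(y²)^(1 - c)`, which tends to `0` at
the origin because `c > 1`. -/
lemma integrableOn_inv_mul_ell {c : ℝ} (hc : 1 < c) {R : ℝ} (hR : 0 < R) :
    IntegrableOn (fun y : ℝ => y⁻¹ * ell (y ^ 2) ^ (-c)) (Ioo 0 R) := by
  -- With `0⁻¹ = 0` the formula would give `ell 0 = 4`, so the limit value at the origin is
  -- prescribed to make the primitive continuous on `[0, R]`.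
  let h : ℝ → ℝ := fun y => if y = 0 then 0 else ell (y ^ 2) ^ (1 - c)
  let h' : ℝ → ℝ := fun y => (c - 1) * (2 * y / (y ^ 2 * (y ^ 2 + 1))) * ell (y ^ 2) ^ (-c)
  have hd : ∀ y, 0 < y → HasDerivAt h (h' y) y := by
    intro y hy
    have h1 : HasDerivAt (fun y : ℝ => y ^ 2) (2 * y) y := by simpa using hasDerivAt_pow 2 y
    have h2 := ((hasDerivAt_ell (w := y ^ 2) (by positivity)).comp y h1).rpow_const (p := 1 - c)
      (Or.inl (ell_pos (by positivity)).ne')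
    have h3 : HasDerivAt (fun y => ell (y ^ 2) ^ (1 - c)) (h' y) y := by
      refine h2.congr_deriv ?_
      simp only [h', Function.comp]
      rw [show 1 - c - 1 = -c by ring]
      ring
    refine h3.congr_of_eventuallyEq ?_
    filter_upwards [lt_mem_nhds hy] with x hx
    simp [h, hx.ne']
  have hlim : Tendsto h (𝓝[>] 0) (𝓝 0) := by
    have t1 : Tendsto (fun y : ℝ => y ^ 2) (𝓝[>] 0) (𝓝[>] 0) := by
      refine tendsto_nhdsWithin_iff.2 ⟨?_, ?_⟩
      · have : Tendsto (fun y : ℝ => y ^ 2) (𝓝 0) (𝓝 (0 ^ 2)) := (continuous_pow 2).tendsto 0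
        simp only [ne_eq, OfNat.ofNat_ne_zero, not_false_eq_true, zero_pow] at this
        exact this.mono_left nhdsWithin_le_nhds
      · filter_upwards [self_mem_nhdsWithin] with y hy
        exact pow_pos (show (0 : ℝ) < y from hy) 2
    have t2 : Tendsto ell (𝓝[>] 0) atTop := by
      unfold ell
      exact tendsto_atTop_add_const_left _ _ (Real.tendsto_log_atTop.comp
        (tendsto_atTop_add_const_left _ _ tendsto_inv_nhdsGT_zero))
    have t3 : Tendsto (fun x : ℝ => x ^ (1 - c)) atTop (𝓝 0) := by
      have := tendsto_rpow_neg_atTop (y := c - 1) (by linarith)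
      simpa using this
    refine ((t3.comp (t2.comp t1))).congr' ?_
    filter_upwards [self_mem_nhdsWithin] with y hy
    simp [h, (show (0 : ℝ) < y from hy).ne']
  have hcont : ContinuousOn h (Icc 0 R) := by
    intro y hy
    rcases hy.1.eq_or_lt with h0 | h0
    · subst h0
      have : ContinuousWithinAt h (Ici 0) 0 := by
        rw [← continuousWithinAt_Ioi_iff_Ici]
        simpa [ContinuousWithinAt, h] using hlim
      exact this.mono Icc_subset_Ici_self
    · exact (hd y h0).continuousAt.continuousWithinAt
  have hnn : ∀ y ∈ Ioo 0 R, 0 ≤ h' y := by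
    intro y hy
    have h1 := ell_pos (w := y ^ 2) (by positivity)
    have h2 : 0 ≤ c - 1 := by linarith
    have h3 := hy.1
    simp only [h']
    positivity
  have hint : IntegrableOn h' (Ioc 0 R) :=
    intervalIntegral.integrableOn_deriv_of_nonneg hcont (fun y hy => hd y hy.1) hnn
  -- The derivative of the primitive is `2 (c - 1) / (y² + 1)` times the integrand, and `y² + 1 ≤ R²
  -- + 1`.
  have hint2 := (hint.mono_set Ioo_subset_Ioc_self).const_mul ((R ^ 2 + 1) / (2 * (c - 1)))
  refine hint2.mono' (by fun_prop) ?_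
  filter_upwards [ae_restrict_mem measurableSet_Ioo] with y hy
  have hy0 := hy.1
  have h1 := ell_pos (w := y ^ 2) (by positivity)
  have h2 : 0 < c - 1 := by linarith
  have h3 : 0 < ell (y ^ 2) ^ (-c) := by positivity
  rw [Real.norm_of_nonneg (by positivity)]
  have : (R ^ 2 + 1) / (2 * (c - 1)) * h' y
      = (R ^ 2 + 1) / (y ^ 2 + 1) * (y⁻¹ * ell (y ^ 2) ^ (-c)) := by
    simp only [h']; field_simp
  rw [this]
  refine le_mul_of_one_le_left (by positivity) ?_
  rw [one_le_div (by positivity)]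
  have := hy.2
  gcongr

/-- In polar coordinates the Jacobian `r²` turns the majorant into a constant plus `r⁻¹ ell(r²)^(-(5
- 3s))`, integrable at the origin since `s < 4/3` means `5 - 3s > 1`. The bound is uniform in `δ` by
monotonicity of the kernel. -/
lemma exists_lintegral_errKer_le {s : ℝ} (hs : 0 ≤ s) (hs2 : s < 4 / 3) (R : ℝ) :
    ∃ C : ℝ≥0∞, C ≠ ⊤ ∧ ∀ δ > 0, ∀ x : R3, ∀ U : Set R3, MeasurableSet U →
      (∀ y ∈ U, ‖x - y‖ < R) →
      ∫⁻ y in U, ENNReal.ofReal (errKer s (‖x - y‖ ^ 2 + δ)) ≤ C := by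
  rcases le_or_gt R 0 with hR | hR
  · refine ⟨0, by simp, fun δ _ x U hU hUR => ?_⟩
    have : U = ∅ := by
      refine eq_empty_of_forall_notMem fun y hy => ?_
      have := hUR y hy
      linarith [norm_nonneg (x - y)]
    simp [this]
  let A : ℝ := ell (R ^ 2) ^ (4 : ℝ) * R ^ 2 + ell (R ^ 2) ^ (8 / 5 : ℝ) * R ^ (4 / 5 : ℝ)
  let F : ℝ → ℝ := fun r => A * (r ^ 2)⁻¹ + r⁻¹ ^ 3 * ell (r ^ 2) ^ (-(5 - 3 * s))
  have hF : IntegrableOn (fun x : R3 => F ‖x‖) (Metric.ball 0 R) := by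
    rw [integrableOn_fun_norm_addHaar (f := F) volume]
    have i1 : IntegrableOn (fun _ : ℝ => A) (Ioo 0 R) := integrableOn_const (by simp)
    have i2 := i1.add (integrableOn_inv_mul_ell (c := 5 - 3 * s) (by linarith) hR)
    refine i2.congr_fun (fun y hy => ?_) measurableSet_Ioo
    have : y ≠ 0 := hy.1.ne'
    simp [F]
    field_simp
  have hFm : Measurable F := by fun_prop
  refine ⟨∫⁻ z in Metric.ball (0 : R3) R, ENNReal.ofReal (F ‖z‖), ?_, fun δ hδ x U hU hUR => ?_⟩
  · have := hF.lintegral_lt_top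
    exact this.ne
  · calc ∫⁻ y in U, ENNReal.ofReal (errKer s (‖x - y‖ ^ 2 + δ))
        ≤ ∫⁻ y in U, (Metric.ball (0 : R3) R).indicator (fun z => ENNReal.ofReal (F ‖z‖)) (x - y) := by
          refine lintegral_mono_ae ?_
          have hne : ∀ᵐ y ∂(volume.restrict U), y ≠ x :=
            ae_restrict_of_ae (by simp [ae_iff, measure_singleton])
          filter_upwards [hne, ae_restrict_mem hU] with y hy hyU
          rw [indicator_of_mem (by simpa using hUR y hyU)]
          have hr : 0 < ‖x - y‖ := norm_pos_iff.2 (sub_ne_zero.2 (Ne.symm hy))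
          apply ENNReal.ofReal_le_ofReal
          refine (errKer_anti hs hs2.le (w := ‖x - y‖ ^ 2) (by positivity) (by linarith)).trans ?_
          exact errKer_sq_le hs2.le hr (hUR y hyU).le
      _ ≤ ∫⁻ y, (Metric.ball (0 : R3) R).indicator (fun z => ENNReal.ofReal (F ‖z‖)) (x - y) :=
          setLIntegral_le_lintegral _ _
      _ = ∫⁻ z, (Metric.ball (0 : R3) R).indicator (fun z => ENNReal.ofReal (F ‖z‖)) z :=
          lintegral_sub_left_eq_self _ x
      _ = _ := lintegral_indicator Metric.isOpen_ball.measurableSet _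

/-! ### Pointwise Young inequalities. -/

section Young

lemma mul_le_rpow_add {a b : ℝ} (ha : 0 ≤ a) (hb : 0 ≤ b) : a * b ≤ a ^ (3 / 2 : ℝ) + b ^ 3 := by
  rcases le_total a (b ^ 2) with h | h
  · have : 0 ≤ a ^ (3 / 2 : ℝ) := by positivity
    nlinarith
  · have h1 : b ≤ a ^ (1 / 2 : ℝ) := by
      rw [← Real.sqrt_eq_rpow]; exact Real.le_sqrt_of_sq_le h
    have h2 : a * a ^ (1 / 2 : ℝ) = a ^ (3 / 2 : ℝ) := by
      rcases ha.eq_or_lt with h0 | h0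
      · subst h0; rw [Real.zero_rpow (by norm_num)]; simp
      · nth_rewrite 1 [← Real.rpow_one a]
        rw [← Real.rpow_add h0]; norm_num
    have : 0 ≤ b ^ 3 := by positivity
    nlinarith [mul_le_mul_of_nonneg_left h1 ha]

lemma mul_ell_rpow_le {a s w : ℝ} (ha : 0 ≤ a) (hw : 0 ≤ w) :
    a * ell w ^ s ≤ a ^ (3 / 2 : ℝ) + ell w ^ (3 * s) := by
  have h := ell_pos hw
  refine (mul_le_rpow_add ha (by positivity)).trans_eq ?_
  rw [← Real.rpow_natCast, ← Real.rpow_mul h.le]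
  norm_num
  ring_nf

/-- A weighted mean of the three pairwise products, with weights `1/6`, `1/3`, `1/2`. Pairwise
products are wanted because `G²`, `ρ^(3/2)` and `g^(6/5)` are separately integrable, and two such
factors can be integrated over the pair of points whereas three cannot. -/
lemma mul_mul_le_young {G ρ g : ℝ} (hG : 0 ≤ G) (hρ : 0 ≤ ρ) (hg : 0 ≤ g) :
    G * ρ * g ≤ G ^ 2 * ρ ^ (3 / 2 : ℝ) + G ^ 2 * g ^ (6 / 5 : ℝ)
      + ρ ^ (3 / 2 : ℝ) * g ^ (6 / 5 : ℝ) := by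
  rcases hG.eq_or_lt with rfl | hG
  · simp; positivity
  rcases hρ.eq_or_lt with rfl | hρ
  · simp; positivity
  rcases hg.eq_or_lt with rfl | hg
  · simp; positivity
  have key := Real.geom_mean_le_arith_mean3_weighted (w₁ := 1 / 6) (w₂ := 1 / 3) (w₃ := 1 / 2)
    (p₁ := G ^ 2 * ρ ^ (3 / 2 : ℝ)) (p₂ := G ^ 2 * g ^ (6 / 5 : ℝ))
    (p₃ := ρ ^ (3 / 2 : ℝ) * g ^ (6 / 5 : ℝ)) (by norm_num) (by norm_num) (by norm_num)
    (by positivity) (by positivity) (by positivity) (by norm_num)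
  have e1 : (G ^ 2 * ρ ^ (3 / 2 : ℝ)) ^ (1 / 6 : ℝ) * (G ^ 2 * g ^ (6 / 5 : ℝ)) ^ (1 / 3 : ℝ)
      * (ρ ^ (3 / 2 : ℝ) * g ^ (6 / 5 : ℝ)) ^ (1 / 2 : ℝ) = G * ρ * g := by
    -- For positive factors the identity between monomials becomes a linear identity between
    -- logarithms.
    obtain ⟨x, rfl⟩ : ∃ x, G = Real.exp x := ⟨_, (Real.exp_log hG).symm⟩
    obtain ⟨y, rfl⟩ : ∃ x, ρ = Real.exp x := ⟨_, (Real.exp_log hρ).symm⟩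
    obtain ⟨z, rfl⟩ : ∃ x, g = Real.exp x := ⟨_, (Real.exp_log hg).symm⟩
    simp only [← Real.exp_nat_mul, ← Real.exp_mul, ← Real.exp_add]
    congr 1
    push_cast
    ring
  rw [e1] at key
  have p1 : 0 ≤ G ^ 2 * ρ ^ (3 / 2 : ℝ) := by positivity
  have p2 : 0 ≤ G ^ 2 * g ^ (6 / 5 : ℝ) := by positivity
  have p3 : 0 ≤ ρ ^ (3 / 2 : ℝ) * g ^ (6 / 5 : ℝ) := by positivity
  linarith

/-- Absorption of the kinetic energy with negative sign. -/
lemma kinetic_young {s l L ρ n ρ' D w : ℝ} (hs2 : s ≤ 2) (hl : 0 ≤ l) (hL : 0 ≤ L)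
    (hρ : 0 ≤ ρ) (hn : 0 ≤ n) (hρ' : 0 ≤ ρ') (hD : 0 < D) (hw : 0 < w) :
    4 * s * (l ^ 2 * L * ρ * n ^ 2 * ρ' * gker (s - 1) w)
      ≤ 1 / 2 * (l ^ 2 * L * ρ ^ (3 / 2 : ℝ) * ρ' * gker s w)
        + 13 * L * ((l * n) ^ 6 / D ^ 2 + ρ * n ^ 2 * D)
          * (ρ' ^ (3 / 2 : ℝ) + cubicKer (5 - 3 * s) w) := by
  have hg := gker_nonneg (s := s) hw.le
  have hc := cubicKer_nonneg (c := 5 - 3 * s) hw.le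
  have hell := ell_pos hw.le
  rcases hl.eq_or_lt with rfl | hl
  · simp; positivity
  rcases hL.eq_or_lt with rfl | hL
  · simp
  rcases hρ.eq_or_lt with rfl | hρ
  · simp
    have : 0 ≤ l ^ 2 * L * (0 : ℝ) ^ (3 / 2 : ℝ) * ρ' * gker s w := by positivity
    have : 0 ≤ 13 * L * ((l * n) ^ 6 / D ^ 2) * (ρ' ^ (3 / 2 : ℝ) + cubicKer (5 - 3 * s) w) := by
      positivity
    linarith
  rcases hn.eq_or_lt with rfl | hn
  · simp; positivity
  rcases hρ'.eq_or_lt with rfl | hρ'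
  · simp; positivity
  -- The exponent `s - 5/3` is forced: with total weight `3/5` on this factor and `2/5` on `ell^s`,
  -- the mean carries `ell^(s - 1)`. Its cube then produces the cubic kernel with exponent `5 - 3s`.
  set X : ℝ := L * ρ' * w ^ (-(1 / 2) : ℝ) * ell w ^ (s - 5 / 3) with hX
  have hXpos : 0 < X := by positivity
  have hXle : X ≤ L * (ρ' ^ (3 / 2 : ℝ) + cubicKer (5 - 3 * s) w) := by
    have h1 := mul_le_rpow_add hρ'.le (b := w ^ (-(1 / 2) : ℝ) * ell w ^ (s - 5 / 3))
      (by positivity)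
    have h2 : (w ^ (-(1 / 2) : ℝ) * ell w ^ (s - 5 / 3)) ^ 3 = cubicKer (5 - 3 * s) w := by
      unfold cubicKer
      rw [mul_pow, ← Real.rpow_natCast, ← Real.rpow_natCast, ← Real.rpow_mul hw.le,
        ← Real.rpow_mul hell.le]
      congr 2 <;> push_cast <;> ring
    rw [h2] at h1
    calc X = L * (ρ' * (w ^ (-(1 / 2) : ℝ) * ell w ^ (s - 5 / 3))) := by rw [hX]; ring
      _ ≤ _ := by gcongr
  -- The weights cancel `D` and reproduce `l² ρ n²`. The two factors `32` make the mean `32^(3/5) =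
  -- 8 ≥ 4s` times the left side while the absorbed term keeps the coefficient `2/5 < 1/2`; `64/5 <
  -- 13` gives the other constant.
  have key := Real.geom_mean_le_arith_mean3_weighted (w₁ := 2 / 5) (w₂ := 1 / 5) (w₃ := 2 / 5)
    (p₁ := l ^ 2 * L * ρ ^ (3 / 2 : ℝ) * ρ' * (w ^ (-(1 / 2) : ℝ) * ell w ^ s))
    (p₂ := 32 * ((l * n) ^ 6 / D ^ 2 * X)) (p₃ := 32 * (ρ * n ^ 2 * D * X))
    (by norm_num) (by norm_num) (by norm_num)
    (by positivity) (by positivity) (by positivity) (by norm_num)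
  have e0 : (32 : ℝ) = Real.exp (5 * Real.log 2) := by
    rw [mul_comm, Real.exp_mul, Real.exp_log (by norm_num)]; norm_num
  have e8 : (8 : ℝ) = Real.exp (3 * Real.log 2) := by
    rw [mul_comm, Real.exp_mul, Real.exp_log (by norm_num)]; norm_num
  have e1 : (l ^ 2 * L * ρ ^ (3 / 2 : ℝ) * ρ' * (w ^ (-(1 / 2) : ℝ) * ell w ^ s)) ^ (2 / 5 : ℝ)
      * (32 * ((l * n) ^ 6 / D ^ 2 * X)) ^ (1 / 5 : ℝ) * (32 * (ρ * n ^ 2 * D * X)) ^ (2 / 5 : ℝ)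
      = 8 * (l ^ 2 * L * ρ * n ^ 2 * ρ' * (w ^ (-(1 / 2) : ℝ) * ell w ^ (s - 1))) := by
    rw [hX, e0, e8]
    generalize ell w = q at hell
    clear key hXle hXpos hX X e0 e8
    obtain ⟨l, rfl⟩ : ∃ x, l = Real.exp x := ⟨_, (Real.exp_log hl).symm⟩
    obtain ⟨L, rfl⟩ : ∃ x, L = Real.exp x := ⟨_, (Real.exp_log hL).symm⟩
    obtain ⟨ρ, rfl⟩ : ∃ x, ρ = Real.exp x := ⟨_, (Real.exp_log hρ).symm⟩
    obtain ⟨n, rfl⟩ : ∃ x, n = Real.exp x := ⟨_, (Real.exp_log hn).symm⟩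
    obtain ⟨ρ', rfl⟩ : ∃ x, ρ' = Real.exp x := ⟨_, (Real.exp_log hρ').symm⟩
    obtain ⟨D, rfl⟩ : ∃ x, D = Real.exp x := ⟨_, (Real.exp_log hD).symm⟩
    obtain ⟨w, rfl⟩ : ∃ x, w = Real.exp x := ⟨_, (Real.exp_log hw).symm⟩
    obtain ⟨q, rfl⟩ : ∃ x, q = Real.exp x := ⟨_, (Real.exp_log hell).symm⟩
    simp only [← Real.exp_add, ← Real.exp_nat_mul, ← Real.exp_mul, ← Real.exp_sub]
    congr 1
    push_cast
    ring
  rw [e1] at key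
  have hgs : gker (s - 1) w = w ^ (-(1 / 2) : ℝ) * ell w ^ (s - 1) := rfl
  have hgs' : gker s w = w ^ (-(1 / 2) : ℝ) * ell w ^ s := rfl
  rw [hgs, hgs']
  have hb : 0 ≤ l ^ 2 * L * ρ * n ^ 2 * ρ' * (w ^ (-(1 / 2) : ℝ) * ell w ^ (s - 1)) := by positivity
  have hb2 : 0 ≤ l ^ 2 * L * ρ ^ (3 / 2 : ℝ) * ρ' * (w ^ (-(1 / 2) : ℝ) * ell w ^ s) := by positivity
  have ha1 : 0 ≤ (l * n) ^ 6 / D ^ 2 := by positivity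
  have ha2 : 0 ≤ ρ * n ^ 2 * D := by positivity
  have h1 : ((l * n) ^ 6 / D ^ 2 + ρ * n ^ 2 * D) * X
      ≤ ((l * n) ^ 6 / D ^ 2 + ρ * n ^ 2 * D)
        * (L * (ρ' ^ (3 / 2 : ℝ) + cubicKer (5 - 3 * s) w)) := by gcongr
  nlinarith [mul_nonneg ha1 hXpos.le, mul_nonneg ha2 hXpos.le]

end Young

/-! ### Symmetrisation and the pointwise lower bound of the interaction. -/

namespace Flow

variable {Ω : Set R3} {T ν₁ ν₂ ε m M E : ℝ} {f : R3 × ℝ → R3} {ϱ : R3 × ℝ → ℝ} {u : R3 × ℝ → R3}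
  {Du : R3 × ℝ → Fin 3 → R3} {Λ : R3 × ℝ → ℝ} {s δ : ℝ}

/-- The sum of the integrands of the doubled momentum and mass equations on the diagonal. -/
noncomputable def interaction (ν₁ ν₂ ε m : ℝ) (f : R3 × ℝ → R3) (ϱ : R3 × ℝ → ℝ)
    (u : R3 × ℝ → R3) (Du : R3 × ℝ → Fin 3 → R3) (K : R3 → R3) (Λ : R3 × ℝ → ℝ)
    (z z' : R3 × ℝ) : ℝ :=
  doubledMomentum ν₁ ν₂ ε m f ϱ u Du K Λ (z, z') + doubledMass ϱ u K Λ (z, z')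

/-- The sum of the norms of the partial derivatives. -/
noncomputable def gradNorm (Du : R3 × ℝ → Fin 3 → R3) (z : R3 × ℝ) : ℝ := ∑ j, ‖Du z j‖

lemma gradNorm_nonneg (Du : R3 × ℝ → Fin 3 → R3) (z : R3 × ℝ) : 0 ≤ gradNorm Du z :=
  Finset.sum_nonneg fun _ _ => norm_nonneg _

lemma abs_stress_le (ν₁ ν₂ : ℝ) (Du : R3 × ℝ → Fin 3 → R3) (z : R3 × ℝ) (i j : Fin 3) :
    |stress ν₁ ν₂ (Du z) i j| ≤ (2 * |ν₁| + |ν₂|) * gradNorm Du z := by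
  have h1 : ∀ i j, |Du z i j| ≤ gradNorm Du z := fun i j =>
    (abs_apply_le _ j).trans
      (Finset.single_le_sum (f := fun j => ‖Du z j‖) (fun _ _ => norm_nonneg _) (Finset.mem_univ i))
  have h2 : |∑ k, Du z k k| ≤ gradNorm Du z :=
    (Finset.abs_sum_le_sum_abs _ _).trans (Finset.sum_le_sum fun k _ => abs_apply_le _ k)
  have h0 := gradNorm_nonneg Du z
  unfold stress
  refine (abs_add_le _ _).trans ?_
  rw [add_mul]
  refine add_le_add ?_ ?_
  · rw [abs_mul]
    have := (abs_add_le (Du z j i) (Du z i j)).trans (add_le_add (h1 j i) (h1 i j))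
    calc |ν₁| * |Du z j i + Du z i j| ≤ |ν₁| * (gradNorm Du z + gradNorm Du z) := by gcongr
      _ = _ := by ring
  · split_ifs
    · rw [abs_mul]; gcongr
    · simp; positivity

/-- The part of the interaction integrand without derivatives of the kernel. -/
noncomputable def lowerOrder (ν₁ ν₂ ε m : ℝ) (f : R3 × ℝ → R3) (ϱ : R3 × ℝ → ℝ)
    (u : R3 × ℝ → R3) (Du : R3 × ℝ → Fin 3 → R3) (K : R3 → R3) (Λ : R3 × ℝ → ℝ)
    (z z' : R3 × ℝ) : ℝ :=
  (∑ i, ϱ z * u z i * dt Λ z * (ϱ z' * Λ z') * K (z.1 - z'.1) i)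
    + (∑ i, ϱ z * f z i * Λ z * (ϱ z' * Λ z') * K (z.1 - z'.1) i)
    + (∑ i, ∑ j, flux ν₁ ν₂ ε m ϱ u Du i j z * dx j Λ z * (ϱ z' * Λ z') * K (z.1 - z'.1) i)
    + (∑ i, ϱ z * u z i * Λ z * (ϱ z' * dt Λ z') * K (z.1 - z'.1) i)
    + ∑ i, ∑ j, ϱ z * u z i * Λ z * (ϱ z' * u z' j * dx j Λ z') * K (z.1 - z'.1) i

/-- The diagonal products `u ⊗ u`, `u' ⊗ u'` come from the momentum flux at the two points and the
mixed products from the mass fluxes; as the gradient of the kernel is even, they combine into the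
square of `u - u'`. -/
lemma interaction_symm (ν₁ ν₂ ε m : ℝ) (f : R3 × ℝ → R3) (ϱ : R3 × ℝ → ℝ)
    (u : R3 × ℝ → R3) (Du : R3 × ℝ → Fin 3 → R3) (K : R3 → R3) (Λ : R3 × ℝ → ℝ)
    (z z' : R3 × ℝ) (hK : ∀ i j, fderiv ℝ K (z'.1 - z.1) (e j) i = fderiv ℝ K (z.1 - z'.1) (e j) i) :
    interaction ν₁ ν₂ ε m f ϱ u Du K Λ z z' + interaction ν₁ ν₂ ε m f ϱ u Du K Λ z' z
      = lowerOrder ν₁ ν₂ ε m f ϱ u Du K Λ z z' + lowerOrder ν₁ ν₂ ε m f ϱ u Du K Λ z' z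
        + Λ z * Λ z' * (ϱ z * ϱ z' * (∑ i, ∑ j, (u z - u z') i * (u z - u z') j
              * fderiv ℝ K (z.1 - z'.1) (e j) i)
          + (pressure ε m (ϱ z) * ϱ z' + pressure ε m (ϱ z') * ϱ z)
              * (∑ i, fderiv ℝ K (z.1 - z'.1) (e i) i)
          - ϱ z' * (∑ i, ∑ j, stress ν₁ ν₂ (Du z) i j * fderiv ℝ K (z.1 - z'.1) (e j) i)
          - ϱ z * (∑ i, ∑ j, stress ν₁ ν₂ (Du z') i j * fderiv ℝ K (z.1 - z'.1) (e j) i)) := by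
  have tr : ∑ i, fderiv ℝ K (z.1 - z'.1) (e i) i
      = ∑ i, ∑ j, (if i = j then 1 else 0) * fderiv ℝ K (z.1 - z'.1) (e j) i := by
    simp
  have ifz : ∀ z : R3 × ℝ, ∀ i j : Fin 3, (if i = j then pressure ε m (ϱ z) else 0)
      = pressure ε m (ϱ z) * (if i = j then 1 else 0) := fun z i j => by simp
  have main : (∑ i, ∑ j, flux ν₁ ν₂ ε m ϱ u Du i j z * Λ z * (ϱ z' * Λ z')
          * fderiv ℝ K (z.1 - z'.1) (e j) i)
      - (∑ i, ∑ j, ϱ z * u z i * Λ z * (ϱ z' * u z' j * Λ z') * fderiv ℝ K (z.1 - z'.1) (e j) i)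
      + ((∑ i, ∑ j, flux ν₁ ν₂ ε m ϱ u Du i j z' * Λ z' * (ϱ z * Λ z)
          * fderiv ℝ K (z.1 - z'.1) (e j) i)
      - (∑ i, ∑ j, ϱ z' * u z' i * Λ z' * (ϱ z * u z j * Λ z) * fderiv ℝ K (z.1 - z'.1) (e j) i))
      = Λ z * Λ z' * (ϱ z * ϱ z' * (∑ i, ∑ j, (u z - u z') i * (u z - u z') j
              * fderiv ℝ K (z.1 - z'.1) (e j) i)
          + (pressure ε m (ϱ z) * ϱ z' + pressure ε m (ϱ z') * ϱ z)
              * (∑ i, fderiv ℝ K (z.1 - z'.1) (e i) i)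
          - ϱ z' * (∑ i, ∑ j, stress ν₁ ν₂ (Du z) i j * fderiv ℝ K (z.1 - z'.1) (e j) i)
          - ϱ z * (∑ i, ∑ j, stress ν₁ ν₂ (Du z') i j * fderiv ℝ K (z.1 - z'.1) (e j) i)) := by
    rw [tr]
    simp only [Finset.mul_sum, ← Finset.sum_add_distrib, ← Finset.sum_sub_distrib]
    refine Finset.sum_congr rfl fun i _ => Finset.sum_congr rfl fun j _ => ?_
    simp only [flux, PiLp.sub_apply, ifz]
    ring
  rw [← main]
  simp only [interaction, doubledMomentum, doubledMass, lowerOrder, prodKer, diffKer, diffKer', hK]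
  ring

lemma abs_flux_le (h : Flow Ω T ν₁ ν₂ ε m M E f ϱ u Du) (i j : Fin 3) (z : R3 × ℝ) :
    |flux ν₁ ν₂ ε m ϱ u Du i j z|
      ≤ weight Ω T ε m ϱ u z + (2 * |ν₁| + |ν₂|) * gradNorm Du z := by
  have hρ := h.density_nonneg z
  have hp := pressure_nonneg (m := m) h.eps_pos.le hρ
  unfold flux
  refine (abs_sub _ _).trans (add_le_add ?_ (abs_stress_le _ _ _ _ _ _))
  refine (abs_add_le _ _).trans ?_
  have h1 : |ϱ z * u z i * u z j| ≤ ϱ z * ‖u z‖ ^ 2 := by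
    rw [mul_assoc, abs_mul, abs_of_nonneg hρ, abs_mul, sq]
    have a1 := abs_apply_le (u z) i
    have a2 := abs_apply_le (u z) j
    gcongr
  have h2 : |if i = j then pressure ε m (ϱ z) else 0| ≤ pressure ε m (ϱ z) := by
    split_ifs
    · rw [abs_of_nonneg hp]
    · simpa using hp
  have h3 : 0 ≤ (cylinder Ω T).indicator (1 : R3 × ℝ → ℝ) z :=
    indicator_nonneg (fun _ _ => zero_le_one) z
  unfold weight
  linarith

/-- Bounds for a cut-off function and its first derivatives. -/
structure CutoffBound (Λ : R3 × ℝ → ℝ) (L : ℝ) : Prop where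
  abs_le : ∀ z, |Λ z| ≤ L
  abs_dt_le : ∀ z, |dt Λ z| ≤ L
  abs_dx_le : ∀ j z, |dx j Λ z| ≤ L

lemma abs_sum_le {a : Fin 3 → ℝ} {B : ℝ} (h : ∀ i, |a i| ≤ B) : |∑ i, a i| ≤ 3 * B := by
  refine (Finset.abs_sum_le_sum_abs _ _).trans ((Finset.sum_le_sum fun i _ => h i).trans_eq ?_)
  simp

lemma abs_mul5_le {a b c d k A B C D K : ℝ} (ha : |a| ≤ A) (hb : |b| ≤ B) (hc : |c| ≤ C)
    (hd : |d| ≤ D) (hk : |k| ≤ K) : |a * b * (c * d) * k| ≤ A * B * (C * D) * K := by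
  simp only [abs_mul]
  have := (abs_nonneg a).trans ha
  have := (abs_nonneg b).trans hb
  have := (abs_nonneg c).trans hc
  have := (abs_nonneg d).trans hd
  gcongr

/-- Every summand has a weight or gradient at one point and a density at the other. The exception is
the product of two momenta, split by `2 |u| |u'| ≤ |u|² + |u'|²`; this is why the bound is symmetric
in the points. The number `24` collects `3 + 3 + 9 + 9` terms. -/
lemma abs_lowerOrder_le (h : Flow Ω T ν₁ ν₂ ε m M E f ϱ u Du) {L : ℝ} (hL : CutoffBound Λ L)
    {K : R3 → R3} {z z' : R3 × ℝ} {k : ℝ} (hk : ∀ i, |K (z.1 - z'.1) i| ≤ k) :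
    |lowerOrder ν₁ ν₂ ε m f ϱ u Du K Λ z z'|
      ≤ L ^ 2 * (24 + 3 * M + 9 * (2 * |ν₁| + |ν₂|))
        * ((weight Ω T ε m ϱ u z + gradNorm Du z) * ϱ z' * k
          + (weight Ω T ε m ϱ u z' + gradNorm Du z') * ϱ z * k) := by
  have hk0 : 0 ≤ k := (abs_nonneg _).trans (hk 0)
  have hL0 : 0 ≤ L := (abs_nonneg _).trans (hL.abs_le z)
  have hM0 : 0 ≤ M := (norm_nonneg _).trans (h.force_le z)
  have hρ := h.density_nonneg z
  have hρ' := h.density_nonneg z'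
  have hW := h.weight_nonneg z
  have hW' := h.weight_nonneg z'
  have hG := gradNorm_nonneg Du z
  have hG' := gradNorm_nonneg Du z'
  have hu : ∀ z i, |ϱ z * u z i| ≤ ϱ z * ‖u z‖ := fun z i => by
    rw [abs_mul, abs_of_nonneg (h.density_nonneg z)]
    exact mul_le_mul_of_nonneg_left (abs_apply_le _ i) (h.density_nonneg z)
  have huW : ∀ z i, |ϱ z * u z i| ≤ weight Ω T ε m ϱ u z := fun z i =>
    (hu z i).trans (h.density_mul_norm_le z)
  have hfW : ∀ z i, |ϱ z * f z i| ≤ M * weight Ω T ε m ϱ u z := fun z i => by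
    rw [abs_mul, abs_of_nonneg (h.density_nonneg z), mul_comm]
    exact mul_le_mul ((abs_apply_le _ i).trans (h.force_le z)) (h.density_le z)
      (h.density_nonneg z) hM0
  have hρa : |ϱ z'| ≤ ϱ z' := (abs_of_nonneg hρ').le
  set W := weight Ω T ε m ϱ u z
  set W' := weight Ω T ε m ϱ u z'
  set G := gradNorm Du z
  set G' := gradNorm Du z'
  set ν := 2 * |ν₁| + |ν₂| with hν
  have hν0 : 0 ≤ ν := by positivity
  have b1 := abs_sum_le fun i => abs_mul5_le (huW z i) (hL.abs_dt_le z) hρa (hL.abs_le z') (hk i)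
  have b2 := abs_sum_le fun i => abs_mul5_le (hfW z i) (hL.abs_le z) hρa (hL.abs_le z') (hk i)
  have b3 := abs_sum_le fun i => abs_sum_le fun j =>
    abs_mul5_le (h.abs_flux_le i j z) (hL.abs_dx_le j z) hρa (hL.abs_le z') (hk i)
  have b4 := abs_sum_le fun i => abs_mul5_le (huW z i) (hL.abs_le z) hρa (hL.abs_dt_le z') (hk i)
  have b5 := abs_sum_le fun i => abs_sum_le fun j =>
    abs_mul5_le (hu z i) (hL.abs_le z) (hu z' j) (hL.abs_dx_le j z') (hk i)
  have hcross : ϱ z * ‖u z‖ * (ϱ z' * ‖u z'‖) ≤ W * ϱ z' + W' * ϱ z := by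
    have k1 := h.kinetic_le_weight z
    have k2 := h.kinetic_le_weight z'
    have := mul_nonneg (mul_nonneg hρ hρ') (sq_nonneg (‖u z‖ - ‖u z'‖))
    have h3 := mul_le_mul_of_nonneg_right k1 hρ'
    have h4 := mul_le_mul_of_nonneg_right k2 hρ
    have := mul_nonneg hW hρ'
    have := mul_nonneg hW' hρ
    nlinarith
  have hcross2 : 3 * (3 * (ϱ z * ‖u z‖ * L * (ϱ z' * ‖u z'‖ * L) * k))
      ≤ 9 * L ^ 2 * k * (W * ϱ z' + W' * ϱ z) := by
    have := mul_le_mul_of_nonneg_left hcross (show 0 ≤ 9 * L ^ 2 * k by positivity)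
    linarith
  have tot : |lowerOrder ν₁ ν₂ ε m f ϱ u Du K Λ z z'|
      ≤ 3 * (W * L * (ϱ z' * L) * k) + 3 * (M * W * L * (ϱ z' * L) * k)
        + 3 * (3 * ((W + ν * G) * L * (ϱ z' * L) * k)) + 3 * (W * L * (ϱ z' * L) * k)
        + 9 * L ^ 2 * k * (W * ϱ z' + W' * ϱ z) := by
    unfold lowerOrder
    refine (abs_add_le _ _).trans (add_le_add ?_ (b5.trans hcross2))
    refine (abs_add_le _ _).trans (add_le_add ?_ b4)
    refine (abs_add_le _ _).trans (add_le_add ?_ b3)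
    exact (abs_add_le _ _).trans (add_le_add b1 b2)
  refine tot.trans ?_
  have q1 : 0 ≤ L ^ 2 * k * (W * ϱ z') := by positivity
  have q2 : 0 ≤ L ^ 2 * k * (G * ϱ z') := by positivity
  have q3 : 0 ≤ L ^ 2 * k * (W' * ϱ z) := by positivity
  have q4 : 0 ≤ L ^ 2 * k * (G' * ϱ z) := by positivity
  nlinarith [mul_nonneg hM0 q1, mul_nonneg hM0 q2, mul_nonneg hM0 q3, mul_nonneg hM0 q4,
    mul_nonneg hν0 q1, mul_nonneg hν0 q2, mul_nonneg hν0 q3, mul_nonneg hν0 q4]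

end Flow

namespace Flow

variable {Ω : Set R3} {T ν₁ ν₂ ε m M E : ℝ} {f : R3 × ℝ → R3} {ϱ : R3 × ℝ → ℝ} {u : R3 × ℝ → R3}
  {Du : R3 × ℝ → Fin 3 → R3} {lam : R3 × ℝ → ℝ} {s δ : ℝ}

/-- The squared norm of the velocity in `W^{1,2}` at time `t`. -/
noncomputable def dissip (u : R3 × ℝ → R3) (Du : R3 × ℝ → Fin 3 → R3) (t : ℝ) : ℝ≥0∞ :=
  ∫⁻ x, ENNReal.ofReal (‖u (x, t)‖ ^ 2 + ∑ j, ‖Du (x, t) j‖ ^ 2)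

/-- The time dependent weight in the absorption of the kinetic energy. -/
noncomputable def dissipWeight (u : R3 × ℝ → R3) (Du : R3 × ℝ → Fin 3 → R3) (t : ℝ) : ℝ :=
  1 + (dissip u Du t).toReal

lemma one_le_dissipWeight (u : R3 × ℝ → R3) (Du : R3 × ℝ → Fin 3 → R3) (t : ℝ) :
    1 ≤ dissipWeight u Du t := by
  have : 0 ≤ (dissip u Du t).toReal := ENNReal.toReal_nonneg
  unfold dissipWeight; linarith

/-- The factor in the error terms which depends on one point. -/
noncomputable def errWeight (Ω : Set R3) (T ε m : ℝ) (ϱ : R3 × ℝ → ℝ) (u : R3 × ℝ → R3)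
    (Du : R3 × ℝ → Fin 3 → R3) (lam : R3 × ℝ → ℝ) (z : R3 × ℝ) : ℝ :=
  weight Ω T ε m ϱ u z * dissipWeight u Du z.2 + gradNorm Du z ^ 2
    + (|lam z| * ‖u z‖) ^ 6 / dissipWeight u Du z.2 ^ 2

/-- The interaction energy density. -/
noncomputable def interactionEnergy (s δ : ℝ) (lam ϱ : R3 × ℝ → ℝ) (z z' : R3 × ℝ) : ℝ :=
  lam z ^ 2 * lam z' ^ 2 * ϱ z ^ (3 / 2 : ℝ) * ϱ z' * gker s (‖z.1 - z'.1‖ ^ 2 + δ)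

/-- The error terms. -/
noncomputable def errTerm (s δ : ℝ) (Ω : Set R3) (T ε m : ℝ) (ϱ : R3 × ℝ → ℝ) (u : R3 × ℝ → R3)
    (Du : R3 × ℝ → Fin 3 → R3) (lam : R3 × ℝ → ℝ) (z z' : R3 × ℝ) : ℝ :=
  errWeight Ω T ε m ϱ u Du lam z * weight Ω T ε m ϱ u z'
    + errWeight Ω T ε m ϱ u Du lam z * errKer s (‖z.1 - z'.1‖ ^ 2 + δ)
    + weight Ω T ε m ϱ u z' * errKer s (‖z.1 - z'.1‖ ^ 2 + δ)

lemma errWeight_nonneg (h : Flow Ω T ν₁ ν₂ ε m M E f ϱ u Du) (z : R3 × ℝ) :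
    0 ≤ errWeight Ω T ε m ϱ u Du lam z := by
  have h1 := h.weight_nonneg z
  have h2 := one_le_dissipWeight u Du z.2
  unfold errWeight
  positivity

/-- The viscous error. The Young inequality with three factors applies, as `gradNorm²`, `ϱ^(3/2)`
and `gker^(6/5)` are parts of the factors of `errTerm`. -/
lemma gradient_le_errTerm (h : Flow Ω T ν₁ ν₂ ε m M E f ϱ u Du) (hδ : 0 < δ) (z z' : R3 × ℝ) :
    gradNorm Du z * ϱ z' * gker s (‖z.1 - z'.1‖ ^ 2 + δ)
      ≤ errTerm s δ Ω T ε m ϱ u Du lam z z' := by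
  have hw : 0 < ‖z.1 - z'.1‖ ^ 2 + δ := by positivity
  set w := ‖z.1 - z'.1‖ ^ 2 + δ
  have hg := gker_nonneg (s := s) hw.le
  have hell := ell_pos hw.le
  have hc := cubicKer_nonneg (c := 5 - 3 * s) hw.le
  have hk : gker s w ^ (6 / 5 : ℝ) ≤ errKer s w := by
    have : 0 ≤ ell w ^ (3 * s) := by positivity
    unfold errKer; linarith
  have hρ' := h.density_nonneg z'
  have hp' : ϱ z' ^ (3 / 2 : ℝ) ≤ weight Ω T ε m ϱ u z' :=
    (rpow_le_pressure h.eps_pos.le hρ').trans (h.pressure_le_weight z')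
  have hG := gradNorm_nonneg Du z
  have hA : gradNorm Du z ^ 2 ≤ errWeight Ω T ε m ϱ u Du lam z := by
    have h1 := h.weight_nonneg z
    have h2 := one_le_dissipWeight u Du z.2
    have : 0 ≤ weight Ω T ε m ϱ u z * dissipWeight u Du z.2 := by positivity
    have : 0 ≤ (|lam z| * ‖u z‖) ^ 6 / dissipWeight u Du z.2 ^ 2 := by positivity
    unfold errWeight; linarith
  have hA0 := h.errWeight_nonneg (lam := lam) z
  refine (mul_mul_le_young hG hρ' hg).trans ?_
  have : 0 ≤ gker s w ^ (6 / 5 : ℝ) := by positivity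
  unfold errTerm
  change _ ≤ _ * _ + _ * errKer s w + _ * errKer s w
  have h2 := h.weight_nonneg z'
  gcongr

/-- In the cylinder the weight is at least `1`, so the linear gradient term is dominated by the
weight plus its square; this is the role of the indicator in `weight`. -/
lemma lower_le_errTerm (h : Flow Ω T ν₁ ν₂ ε m M E f ϱ u Du) (hδ : 0 < δ) {z z' : R3 × ℝ}
    (hz : z ∈ cylinder Ω T) :
    (weight Ω T ε m ϱ u z + gradNorm Du z) * ϱ z' * ell (‖z.1 - z'.1‖ ^ 2 + δ) ^ s
      ≤ 2 * errTerm s δ Ω T ε m ϱ u Du lam z z' := by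
  have hw : 0 < ‖z.1 - z'.1‖ ^ 2 + δ := by positivity
  set w := ‖z.1 - z'.1‖ ^ 2 + δ
  have hg := gker_nonneg (s := s) hw.le
  have hell := ell_pos hw.le
  have hc := cubicKer_nonneg (c := 5 - 3 * s) hw.le
  have hk : ell w ^ (3 * s) ≤ errKer s w := by
    have : 0 ≤ gker s w ^ (6 / 5 : ℝ) := by positivity
    unfold errKer; linarith
  have hk0 := errKer_nonneg (s := s) hw.le
  have hρ' := h.density_nonneg z'
  have hp' : ϱ z' ^ (3 / 2 : ℝ) ≤ weight Ω T ε m ϱ u z' :=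
    (rpow_le_pressure h.eps_pos.le hρ').trans (h.pressure_le_weight z')
  have hG := gradNorm_nonneg Du z
  have hW1 : 1 ≤ weight Ω T ε m ϱ u z := by
    have h1 := pressure_nonneg (m := m) h.eps_pos.le (h.density_nonneg z)
    have h2 := h.density_nonneg z
    have : 0 ≤ ϱ z * ‖u z‖ ^ 2 := by positivity
    simp only [weight, indicator_of_mem hz, Pi.one_apply]
    linarith
  have h2 := one_le_dissipWeight u Du z.2
  have hA : weight Ω T ε m ϱ u z + gradNorm Du z ≤ 2 * errWeight Ω T ε m ϱ u Du lam z := by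
    have : 0 ≤ (|lam z| * ‖u z‖) ^ 6 / dissipWeight u Du z.2 ^ 2 := by positivity
    unfold errWeight; nlinarith [sq_nonneg (gradNorm Du z - 1)]
  have hA0 := h.errWeight_nonneg (lam := lam) z
  have hW0 := h.weight_nonneg z'
  calc (weight Ω T ε m ϱ u z + gradNorm Du z) * ϱ z' * ell w ^ s
      = (weight Ω T ε m ϱ u z + gradNorm Du z) * (ϱ z' * ell w ^ s) := by ring
    _ ≤ (2 * errWeight Ω T ε m ϱ u Du lam z) * (weight Ω T ε m ϱ u z' + errKer s w) := by
        have := mul_ell_rpow_le (s := s) hρ' hw.le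
        have h3 : ϱ z' * ell w ^ s ≤ weight Ω T ε m ϱ u z' + errKer s w := by linarith
        have : 0 ≤ ϱ z' * ell w ^ s := by positivity
        gcongr
    _ ≤ _ := by
        unfold errTerm
        change _ ≤ 2 * (_ * _ + _ * errKer s w + _ * errKer s w)
        have := mul_nonneg hW0 hk0
        nlinarith

/-- The localisation `Λ = λ²` is what makes this work: the absorbed term has `λ²`, and the sixth
power that appears is that of `λ|u|`, which the Sobolev inequality controls. -/
lemma kinetic_le_errTerm (h : Flow Ω T ν₁ ν₂ ε m M E f ϱ u Du) (hs2 : s ≤ 2)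
    (hδ : 0 < δ) {L : ℝ} (hL : ∀ z, |lam z ^ 2| ≤ L) (z z' : R3 × ℝ) :
    4 * s * (lam z ^ 2 * lam z' ^ 2 * ϱ z * ‖u z‖ ^ 2 * ϱ z' * gker (s - 1) (‖z.1 - z'.1‖ ^ 2 + δ))
      ≤ 1 / 2 * interactionEnergy s δ lam ϱ z z'
        + 13 * L * errTerm s δ Ω T ε m ϱ u Du lam z z' := by
  have hw : 0 < ‖z.1 - z'.1‖ ^ 2 + δ := by positivity
  set w := ‖z.1 - z'.1‖ ^ 2 + δ with hwdef
  have h2 := one_le_dissipWeight u Du z.2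
  have hρ := h.density_nonneg z
  have hρ' := h.density_nonneg z'
  have key := kinetic_young hs2 (abs_nonneg (lam z)) (sq_nonneg (lam z')) hρ
    (norm_nonneg (u z)) hρ' (zero_lt_one.trans_le h2) hw
  rw [sq_abs] at key
  refine key.trans ?_
  have hg := gker_nonneg (s := s) hw.le
  have hell := ell_pos hw.le
  have hc := cubicKer_nonneg (c := 5 - 3 * s) hw.le
  have hk : cubicKer (5 - 3 * s) w ≤ errKer s w := by
    have : 0 ≤ gker s w ^ (6 / 5 : ℝ) := by positivity
    have : 0 ≤ ell w ^ (3 * s) := by positivity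
    unfold errKer; linarith
  have hk0 := errKer_nonneg (s := s) hw.le
  have hp' : ϱ z' ^ (3 / 2 : ℝ) ≤ weight Ω T ε m ϱ u z' :=
    (rpow_le_pressure h.eps_pos.le hρ').trans (h.pressure_le_weight z')
  have hA : (|lam z| * ‖u z‖) ^ 6 / dissipWeight u Du z.2 ^ 2
      + ϱ z * ‖u z‖ ^ 2 * dissipWeight u Du z.2 ≤ errWeight Ω T ε m ϱ u Du lam z := by
    have h1 := h.kinetic_le_weight z
    have h3 : ϱ z * ‖u z‖ ^ 2 * dissipWeight u Du z.2
        ≤ weight Ω T ε m ϱ u z * dissipWeight u Du z.2 := by gcongr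
    unfold errWeight
    nlinarith [sq_nonneg (gradNorm Du z)]
  have hA0 := h.errWeight_nonneg (lam := lam) z
  have hW0 := h.weight_nonneg z'
  have hL' : lam z' ^ 2 ≤ L := (le_abs_self _).trans (hL z')
  have hL0 : 0 ≤ L := (sq_nonneg _).trans hL'
  refine add_le_add le_rfl ?_
  calc 13 * lam z' ^ 2 * ((|lam z| * ‖u z‖) ^ 6 / dissipWeight u Du z.2 ^ 2
      + ϱ z * ‖u z‖ ^ 2 * dissipWeight u Du z.2) * (ϱ z' ^ (3 / 2 : ℝ) + cubicKer (5 - 3 * s) w)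
      ≤ 13 * L * errWeight Ω T ε m ϱ u Du lam z * (weight Ω T ε m ϱ u z' + errKer s w) := by
        gcongr
    _ ≤ _ := by
        rw [mul_assoc]
        refine mul_le_mul_of_nonneg_left ?_ (by positivity)
        unfold errTerm
        change _ ≤ _ * _ + _ * errKer s w + _ * errKer s w
        have := mul_nonneg hW0 hk0
        nlinarith

/-- The constant in the pointwise bound of the interaction integrand. -/
noncomputable def interactionConst (ν₁ ν₂ M L : ℝ) : ℝ :=
  13 * L + 27 * (2 * |ν₁| + |ν₂|) * L ^ 2
    + 4 * (L ^ 2 * (24 + 3 * M + 9 * (2 * |ν₁| + |ν₂|)))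

/-- The pressure produces the full interaction energy of both orderings. The negative part of the
quadratic form takes half of it, which leaves the factor `1/2`; all the rest is an error term. -/
theorem interaction_lower_bound (h : Flow Ω T ν₁ ν₂ ε m M E f ϱ u Du) (hs : 0 ≤ s) (hs2 : s ≤ 2)
    (hδ : 0 < δ) {L : ℝ} (hL : CutoffBound (fun z => lam z ^ 2) L) {z z' : R3 × ℝ}
    (hz : z ∈ cylinder Ω T) (hz' : z' ∈ cylinder Ω T) :
    1 / 2 * (interactionEnergy s δ lam ϱ z z' + interactionEnergy s δ lam ϱ z' z)
      ≤ interaction ν₁ ν₂ ε m f ϱ u Du (radialKer s δ) (fun z => lam z ^ 2) z z'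
        + interaction ν₁ ν₂ ε m f ϱ u Du (radialKer s δ) (fun z => lam z ^ 2) z' z
        + interactionConst ν₁ ν₂ M L * (errTerm s δ Ω T ε m ϱ u Du lam z z'
            + errTerm s δ Ω T ε m ϱ u Du lam z' z) := by
  have hsymw : ‖z'.1 - z.1‖ = ‖z.1 - z'.1‖ := norm_sub_rev _ _
  have hw : 0 < ‖z.1 - z'.1‖ ^ 2 + δ := by positivity
  have hKsym : ∀ i j, fderiv ℝ (radialKer s δ) (z'.1 - z.1) (e j) i
      = fderiv ℝ (radialKer s δ) (z.1 - z'.1) (e j) i := fun i j => by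
    rw [fderiv_radialKer s hδ, fderiv_radialKer s hδ, hsymw]
    simp only [PiLp.sub_apply]
    ring
  rw [interaction_symm ν₁ ν₂ ε m f ϱ u Du (radialKer s δ) (fun z => lam z ^ 2) z z' hKsym]
  have lo1 := neg_le_of_abs_le (h.abs_lowerOrder_le hL (K := radialKer s δ) (z := z) (z' := z')
    (k := ell (‖z.1 - z'.1‖ ^ 2 + δ) ^ s) fun i => abs_radialKer_le hδ _ i)
  have lo2 := neg_le_of_abs_le (h.abs_lowerOrder_le hL (K := radialKer s δ) (z := z') (z' := z)
    (k := ell (‖z.1 - z'.1‖ ^ 2 + δ) ^ s) fun i => by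
      rw [← hsymw]; exact abs_radialKer_le hδ _ i)
  have el1 := h.lower_le_errTerm (lam := lam) (s := s) hδ (z' := z') hz
  have el2 := h.lower_le_errTerm (lam := lam) (s := s) hδ (z' := z) hz'
  have eg1 := h.gradient_le_errTerm (lam := lam) (s := s) hδ z z'
  have eg2 := h.gradient_le_errTerm (lam := lam) (s := s) hδ z' z
  have ek1 := h.kinetic_le_errTerm (lam := lam) hs2 hδ hL.abs_le z z'
  have ek2 := h.kinetic_le_errTerm (lam := lam) hs2 hδ hL.abs_le z' z
  have quad := radialKer_quadratic hs hδ (z.1 - z'.1) (u z - u z')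
  have trace := radialKer_trace hs hs2 hδ (z.1 - z'.1)
  have hst : ∀ y : R3 × ℝ, |∑ i, ∑ j, stress ν₁ ν₂ (Du y) i j
      * fderiv ℝ (radialKer s δ) (z.1 - z'.1) (e j) i|
      ≤ 27 * (2 * |ν₁| + |ν₂|) * gradNorm Du y * gker s (‖z.1 - z'.1‖ ^ 2 + δ) := fun y => by
    have := abs_sum_le fun i => abs_sum_le fun j => show |stress ν₁ ν₂ (Du y) i j
      * fderiv ℝ (radialKer s δ) (z.1 - z'.1) (e j) i|
      ≤ (2 * |ν₁| + |ν₂|) * gradNorm Du y * (3 * gker s (‖z.1 - z'.1‖ ^ 2 + δ)) by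
        rw [abs_mul]
        exact mul_le_mul (abs_stress_le _ _ _ _ _ _) (abs_fderiv_radialKer_le hs hs2 hδ _ _ _)
          (abs_nonneg _) (mul_nonneg (by positivity) (gradNorm_nonneg _ _))
    exact this.trans_eq (by ring)
  have st1 := (le_abs_self _).trans (hst z)
  have st2 := (le_abs_self _).trans (hst z')
  simp only [hsymw] at el2 eg2 ek2
  set Q := ∑ i, ∑ j, (u z - u z') i * (u z - u z') j
    * fderiv ℝ (radialKer s δ) (z.1 - z'.1) (e j) i
  set tr := ∑ i, fderiv ℝ (radialKer s δ) (z.1 - z'.1) (e i) i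
  set S1 := ∑ i, ∑ j, stress ν₁ ν₂ (Du z) i j * fderiv ℝ (radialKer s δ) (z.1 - z'.1) (e j) i
  set S2 := ∑ i, ∑ j, stress ν₁ ν₂ (Du z') i j * fderiv ℝ (radialKer s δ) (z.1 - z'.1) (e j) i
  set e1 := errTerm s δ Ω T ε m ϱ u Du lam z z'
  set e2 := errTerm s δ Ω T ε m ϱ u Du lam z' z
  set ν := 2 * |ν₁| + |ν₂| with hν
  have hg := gker_nonneg (s := s) hw.le
  have hg1 := gker_nonneg (s := s - 1) hw.le
  have hρ := h.density_nonneg z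
  have hρ' := h.density_nonneg z'
  have hν0 : 0 ≤ ν := by positivity
  have hM0 : 0 ≤ M := (norm_nonneg _).trans (h.force_le z)
  have hΛ := sq_nonneg (lam z)
  have hΛ' := sq_nonneg (lam z')
  have hLz : lam z ^ 2 ≤ L := (le_abs_self _).trans (hL.abs_le z)
  have hLz' : lam z' ^ 2 ≤ L := (le_abs_self _).trans (hL.abs_le z')
  have hL0 : 0 ≤ L := hΛ.trans hLz
  have hΛΛ : lam z ^ 2 * lam z' ^ 2 ≤ L ^ 2 := by
    rw [sq L]; exact mul_le_mul hLz hLz' hΛ' hL0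
  have hG := gradNorm_nonneg Du z
  have hG' := gradNorm_nonneg Du z'
  have hnorm : ‖u z - u z'‖ ^ 2 ≤ 2 * ‖u z‖ ^ 2 + 2 * ‖u z'‖ ^ 2 := by
    have := norm_sub_le (u z) (u z')
    nlinarith [norm_nonneg (u z - u z'), sq_nonneg (‖u z‖ - ‖u z'‖)]
  -- The factor `4s` is `2s` from the quadratic form times `2` from `|u - u'|² ≤ 2|u|² + 2|u'|²`.
  have c1 : -(4 * s * (lam z ^ 2 * lam z' ^ 2 * ϱ z * ‖u z‖ ^ 2 * ϱ z'
        * gker (s - 1) (‖z.1 - z'.1‖ ^ 2 + δ)))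
      - 4 * s * (lam z' ^ 2 * lam z ^ 2 * ϱ z' * ‖u z'‖ ^ 2 * ϱ z
        * gker (s - 1) (‖z.1 - z'.1‖ ^ 2 + δ))
      ≤ lam z ^ 2 * lam z' ^ 2 * (ϱ z * ϱ z' * Q) := by
    have a0 : 0 ≤ lam z ^ 2 * lam z' ^ 2 * (ϱ z * ϱ z') := by positivity
    have a1 := mul_le_mul_of_nonneg_left quad a0
    have a2 := mul_le_mul_of_nonneg_left hnorm
      (show 0 ≤ lam z ^ 2 * lam z' ^ 2 * (ϱ z * ϱ z')
        * (2 * s * gker (s - 1) (‖z.1 - z'.1‖ ^ 2 + δ)) by positivity)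
    linarith
  have c2 : interactionEnergy s δ lam ϱ z z' + interactionEnergy s δ lam ϱ z' z
      ≤ lam z ^ 2 * lam z' ^ 2 * ((pressure ε m (ϱ z) * ϱ z' + pressure ε m (ϱ z') * ϱ z) * tr) := by
    have p1 := rpow_le_pressure (m := m) h.eps_pos.le hρ
    have p2 := rpow_le_pressure (m := m) h.eps_pos.le hρ'
    have r1 : 0 ≤ ϱ z ^ (3 / 2 : ℝ) := by positivity
    have r2 : 0 ≤ ϱ z' ^ (3 / 2 : ℝ) := by positivity
    have e : interactionEnergy s δ lam ϱ z z' + interactionEnergy s δ lam ϱ z' z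
        = lam z ^ 2 * lam z' ^ 2 * ((ϱ z ^ (3 / 2 : ℝ) * ϱ z' + ϱ z' ^ (3 / 2 : ℝ) * ϱ z)
          * gker s (‖z.1 - z'.1‖ ^ 2 + δ)) := by
      unfold interactionEnergy; rw [hsymw]; ring
    rw [e]
    have : 0 ≤ pressure ε m (ϱ z) * ϱ z' + pressure ε m (ϱ z') * ϱ z := by
      have := r1.trans p1
      have := r2.trans p2
      positivity
    gcongr
  have c3 : lam z ^ 2 * lam z' ^ 2 * (ϱ z' * S1) ≤ 27 * ν * L ^ 2 * e1 := by
    calc lam z ^ 2 * lam z' ^ 2 * (ϱ z' * S1)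
        ≤ lam z ^ 2 * lam z' ^ 2 * (ϱ z' * (27 * ν * gradNorm Du z
            * gker s (‖z.1 - z'.1‖ ^ 2 + δ))) := by gcongr
      _ = lam z ^ 2 * lam z' ^ 2 * (27 * ν * (gradNorm Du z * ϱ z'
            * gker s (‖z.1 - z'.1‖ ^ 2 + δ))) := by ring
      _ ≤ L ^ 2 * (27 * ν * e1) := by gcongr
      _ = _ := by ring
  have c4 : lam z ^ 2 * lam z' ^ 2 * (ϱ z * S2) ≤ 27 * ν * L ^ 2 * e2 := by
    calc lam z ^ 2 * lam z' ^ 2 * (ϱ z * S2)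
        ≤ lam z ^ 2 * lam z' ^ 2 * (ϱ z * (27 * ν * gradNorm Du z'
            * gker s (‖z.1 - z'.1‖ ^ 2 + δ))) := by gcongr
      _ = lam z ^ 2 * lam z' ^ 2 * (27 * ν * (gradNorm Du z' * ϱ z
            * gker s (‖z.1 - z'.1‖ ^ 2 + δ))) := by ring
      _ ≤ L ^ 2 * (27 * ν * e2) := by gcongr
      _ = _ := by ring
  have c5 := mul_le_mul_of_nonneg_left (add_le_add el1 el2)
    (show 0 ≤ 2 * (L ^ 2 * (24 + 3 * M + 9 * ν)) by positivity)
  unfold interactionConst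
  rw [← hν]
  linarith

end Flow

/-! ### Integration of the error terms and the bound of the interaction energy. -/

lemma measurePreserving_swapSpace :
    MeasurePreserving (fun d : (R3 × R3) × ℝ => ((d.1.2, d.1.1), d.2)) :=
  (Measure.measurePreserving_swap (μ := (volume : Measure R3)) (ν := (volume : Measure R3))).prod
    (MeasurePreserving.id (volume : Measure ℝ))

lemma lintegral_slices {a : R3 × ℝ → ℝ≥0∞} (ha : Measurable a) :
    ∫⁻ z, a z = ∫⁻ t, ∫⁻ x, a (x, t) := by
  rw [Measure.volume_eq_prod, lintegral_prod_symm _ ha.aemeasurable]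

lemma lintegral_slices_pair {a : (R3 × R3) × ℝ → ℝ≥0∞} (ha : Measurable a) :
    ∫⁻ d, a d = ∫⁻ t, ∫⁻ x, ∫⁻ y, a ((x, y), t) := by
  rw [Measure.volume_eq_prod, lintegral_prod_symm _ ha.aemeasurable]
  refine lintegral_congr fun t => ?_
  rw [Measure.volume_eq_prod, lintegral_prod _ (by fun_prop)]

lemma lintegral_kernel_le {Ω : Set R3} (hΩ : MeasurableSet Ω) {k : R3 → ℝ≥0∞} (hk : Measurable k)
    {C : ℝ≥0∞} (hC : ∀ x ∈ Ω, ∫⁻ y in Ω, k (x - y) ≤ C) {a : R3 × ℝ → ℝ≥0∞} (ha : Measurable a)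
    (ha0 : ∀ x t, x ∉ Ω → a (x, t) = 0) :
    ∫⁻ d : (R3 × R3) × ℝ, a (d.1.1, d.2) * Ω.indicator (fun y => k (d.1.1 - y)) d.1.2
      ≤ C * ∫⁻ z, a z := by
  have hm : Measurable fun d : (R3 × R3) × ℝ => Ω.indicator (fun y => k (d.1.1 - y)) d.1.2 := by
    have : (fun d : (R3 × R3) × ℝ => Ω.indicator (fun y => k (d.1.1 - y)) d.1.2)
        = ((fun d : (R3 × R3) × ℝ => d.1.2) ⁻¹' Ω).indicator fun d => k (d.1.1 - d.1.2) := by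
      funext d; rfl
    rw [this]
    exact (by fun_prop : Measurable fun d : (R3 × R3) × ℝ => k (d.1.1 - d.1.2)).indicator
      (hΩ.preimage (by fun_prop))
  rw [lintegral_slices_pair (by fun_prop), lintegral_slices ha, ← lintegral_const_mul _
    (by exact ha.lintegral_prod_left')]
  refine lintegral_mono fun t => ?_
  rw [← lintegral_const_mul _ (by fun_prop)]
  refine lintegral_mono fun x => ?_
  simp only
  by_cases hx : x ∈ Ω
  · rw [lintegral_const_mul _ ((by fun_prop : Measurable fun y => k (x - y)).indicator hΩ),
      lintegral_indicator hΩ, mul_comm]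
    gcongr
    exact hC x hx
  · simp [ha0 x t hx]

namespace Flow

variable {Ω : Set R3} {T ν₁ ν₂ ε m M E : ℝ} {f : R3 × ℝ → R3} {ϱ : R3 × ℝ → ℝ} {u : R3 × ℝ → R3}
  {Du : R3 × ℝ → Fin 3 → R3} {lam : R3 × ℝ → ℝ} {s δ : ℝ}

lemma measurable_dissip (h : Flow Ω T ν₁ ν₂ ε m M E f ϱ u Du) : Measurable (dissip u Du) := by
  have h1 := h.measurable_velocity
  have h2 := h.measurable_gradient
  have : Measurable fun z : R3 × ℝ => ENNReal.ofReal (‖u z‖ ^ 2 + ∑ j, ‖Du z j‖ ^ 2) := by fun_prop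
  exact this.lintegral_prod_left'

lemma lintegral_dissip (h : Flow Ω T ν₁ ν₂ ε m M E f ϱ u Du) :
    ∫⁻ t, dissip u Du t ≤ ENNReal.ofReal (E ^ 2) := by
  have h1 := h.measurable_velocity
  have h2 := h.measurable_gradient
  have := h.dissipation_le
  rwa [lintegral_slices (by fun_prop)] at this

lemma ae_dissip_lt_top (h : Flow Ω T ν₁ ν₂ ε m M E f ϱ u Du) : ∀ᵐ t, dissip u Du t < ⊤ :=
  ae_lt_top h.measurable_dissip (h.lintegral_dissip.trans_lt ENNReal.ofReal_lt_top).ne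

lemma measurable_dissipWeight (h : Flow Ω T ν₁ ν₂ ε m M E f ϱ u Du) :
    Measurable (dissipWeight u Du) := by
  have := h.measurable_dissip
  unfold dissipWeight; fun_prop

lemma ofReal_dissipWeight {t : ℝ} (ht : dissip u Du t < ⊤) :
    ENNReal.ofReal (dissipWeight u Du t) = 1 + dissip u Du t := by
  unfold dissipWeight
  rw [ENNReal.ofReal_add zero_le_one ENNReal.toReal_nonneg, ENNReal.ofReal_one,
    ENNReal.ofReal_toReal ht.ne]

lemma measurable_errWeight (h : Flow Ω T ν₁ ν₂ ε m M E f ϱ u Du) (hlam : Measurable lam) :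
    Measurable (errWeight Ω T ε m ϱ u Du lam) := by
  have h1 := h.measurable_velocity
  have h2 := h.measurable_gradient
  have h3 := h.measurable_weight
  have h4 := h.measurable_dissipWeight
  unfold errWeight gradNorm
  fun_prop

lemma gradNorm_sq_le (Du : R3 × ℝ → Fin 3 → R3) (z : R3 × ℝ) :
    gradNorm Du z ^ 2 ≤ 3 * ∑ j, ‖Du z j‖ ^ 2 := by
  have := sq_sum_le_card_mul_sum_sq (s := Finset.univ) (f := fun j => ‖Du z j‖)
  simpa [gradNorm] using this

lemma lintegral_weight_total_le (h : Flow Ω T ν₁ ν₂ ε m M E f ϱ u Du) :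
    ∫⁻ z, ENNReal.ofReal (weight Ω T ε m ϱ u z)
      ≤ (volume Ω + ENNReal.ofReal E + ENNReal.ofReal E) * ENNReal.ofReal T := by
  have h3 := h.measurable_weight
  rw [lintegral_slices (by fun_prop)]
  calc ∫⁻ t, ∫⁻ x, ENNReal.ofReal (weight Ω T ε m ϱ u (x, t))
      ≤ ∫⁻ t, (Ioo 0 T).indicator
          (fun _ => volume Ω + ENNReal.ofReal E + ENNReal.ofReal E) t := by
        refine lintegral_mono_ae ?_
        filter_upwards [h.lintegral_weight_le] with t ht
        by_cases htT : t ∈ Ioo 0 T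
        · rwa [indicator_of_mem htT]
        · rw [indicator_of_notMem htT]
          simp [h.weight_of_notMem (fun hz : (_, t) ∈ cylinder Ω T => htT hz.2)]
    _ = _ := by
        rw [lintegral_indicator_const measurableSet_Ioo]; simp

/-- The two powers of `dissipWeight` balance: the spatial integral of the weight is bounded and may
carry one factor `D`, while the sixth power costs `dissip³` and is divided by `D²`. Each term is
then bounded by a multiple of `1 + dissip`, up to localisation in time, and `dissip` is integrable.
-/
lemma lintegral_errWeight_le (h : Flow Ω T ν₁ ν₂ ε m M E f ϱ u Du) (hlam : Measurable lam)
    {C6 : ℝ≥0∞} (hsob : ∀ᵐ t, ∫⁻ x, ENNReal.ofReal ((|lam (x, t)| * ‖u (x, t)‖) ^ 6)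
      ≤ C6 * dissip u Du t ^ 3) :
    ∫⁻ z, ENNReal.ofReal (errWeight Ω T ε m ϱ u Du lam z)
      ≤ (volume Ω + ENNReal.ofReal E + ENNReal.ofReal E)
          * (ENNReal.ofReal T + ENNReal.ofReal (E ^ 2))
        + 3 * ENNReal.ofReal (E ^ 2) + C6 * ENNReal.ofReal (E ^ 2) := by
  set W0 := volume Ω + ENNReal.ofReal E + ENNReal.ofReal E
  have h1 := h.measurable_velocity
  have h2 := h.measurable_gradient
  have h3 := h.measurable_weight
  have h4 := h.measurable_dissipWeight
  have h5 := h.measurable_errWeight hlam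
  have h6 := h.measurable_dissip
  have hgm : Measurable (gradNorm Du) := by unfold gradNorm; fun_prop
  rw [lintegral_slices (by fun_prop)]
  calc ∫⁻ t, ∫⁻ x, ENNReal.ofReal (errWeight Ω T ε m ϱ u Du lam (x, t))
      ≤ ∫⁻ t, ((∫⁻ x, ENNReal.ofReal (weight Ω T ε m ϱ u (x, t))) + W0 * dissip u Du t
          + 3 * dissip u Du t + C6 * dissip u Du t) := by
        refine lintegral_mono_ae ?_
        filter_upwards [h.lintegral_weight_le, hsob, h.ae_dissip_lt_top] with t hW h6t hD
        have hD1 := one_le_dissipWeight u Du t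
        have hD1' : 0 < dissipWeight u Du t := by linarith
        have e : ∀ x, ENNReal.ofReal (errWeight Ω T ε m ϱ u Du lam (x, t))
            ≤ ENNReal.ofReal (weight Ω T ε m ϱ u (x, t)) * (1 + dissip u Du t)
              + 3 * ENNReal.ofReal (‖u (x, t)‖ ^ 2 + ∑ j, ‖Du (x, t) j‖ ^ 2)
              + (ENNReal.ofReal (dissipWeight u Du t) ^ 2)⁻¹
                * ENNReal.ofReal ((|lam (x, t)| * ‖u (x, t)‖) ^ 6) := fun x => by
          unfold errWeight
          refine ENNReal.ofReal_add_le.trans (add_le_add (ENNReal.ofReal_add_le.trans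
            (add_le_add ?_ ?_)) ?_)
          · rw [ENNReal.ofReal_mul (h.weight_nonneg _), ofReal_dissipWeight hD]
          · rw [show (3 : ℝ≥0∞) = ENNReal.ofReal 3 by simp, ← ENNReal.ofReal_mul (by norm_num)]
            apply ENNReal.ofReal_le_ofReal
            have := gradNorm_sq_le Du (x, t)
            nlinarith [sq_nonneg ‖u (x, t)‖]
          · rw [div_eq_mul_inv, mul_comm, ENNReal.ofReal_mul (by positivity),
              ENNReal.ofReal_inv_of_pos (by positivity), ENNReal.ofReal_pow hD1'.le]
        refine (lintegral_mono e).trans ?_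
        rw [lintegral_add_right _ (by fun_prop), lintegral_add_right _ (by fun_prop),
          lintegral_mul_const _ (by fun_prop), lintegral_const_mul _ (by fun_prop),
          lintegral_const_mul _ (by fun_prop), mul_add, mul_one]
        have k6 : (ENNReal.ofReal (dissipWeight u Du t) ^ 2)⁻¹
            * (C6 * dissip u Du t ^ 3) ≤ C6 * dissip u Du t := by
          have hle : dissip u Du t ≤ ENNReal.ofReal (dissipWeight u Du t) := by
            rw [ofReal_dissipWeight hD]; exact le_add_self
          have hne : ENNReal.ofReal (dissipWeight u Du t) ≠ 0 := by simpa using hD1'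
          calc (ENNReal.ofReal (dissipWeight u Du t) ^ 2)⁻¹ * (C6 * dissip u Du t ^ 3)
              = (ENNReal.ofReal (dissipWeight u Du t) ^ 2)⁻¹ * dissip u Du t ^ 2
                * (C6 * dissip u Du t) := by ring
            _ ≤ (ENNReal.ofReal (dissipWeight u Du t) ^ 2)⁻¹
                * ENNReal.ofReal (dissipWeight u Du t) ^ 2 * (C6 * dissip u Du t) := by gcongr
            _ = C6 * dissip u Du t := by
                rw [ENNReal.inv_mul_cancel (pow_ne_zero _ hne) (by finiteness), one_mul]
        refine add_le_add (add_le_add (add_le_add le_rfl ?_) le_rfl) ?_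
        · gcongr
        · exact (by gcongr : _ ≤ _).trans k6
    _ = (∫⁻ t, ∫⁻ x, ENNReal.ofReal (weight Ω T ε m ϱ u (x, t)))
        + W0 * (∫⁻ t, dissip u Du t) + 3 * (∫⁻ t, dissip u Du t)
        + C6 * (∫⁻ t, dissip u Du t) := by
        rw [lintegral_add_right _ (by fun_prop), lintegral_add_right _ (by fun_prop),
          lintegral_add_right _ (by fun_prop), lintegral_const_mul _ h6, lintegral_const_mul _ h6,
          lintegral_const_mul _ h6]
    _ ≤ W0 * ENNReal.ofReal T + W0 * ENNReal.ofReal (E ^ 2) + 3 * ENNReal.ofReal (E ^ 2)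
        + C6 * ENNReal.ofReal (E ^ 2) := by
        have hWt := h.lintegral_weight_total_le
        rw [lintegral_slices (by fun_prop)] at hWt
        have := h.lintegral_dissip
        gcongr
    _ = _ := by rw [mul_add]

/-- The localised error terms. -/
noncomputable def errLoc (s δ : ℝ) (Ω : Set R3) (T ε m : ℝ) (ϱ : R3 × ℝ → ℝ) (u : R3 × ℝ → R3)
    (Du : R3 × ℝ → Fin 3 → R3) (lam : R3 × ℝ → ℝ) (d : (R3 × R3) × ℝ) : ℝ :=
  errWeight Ω T ε m ϱ u Du lam (d.1.1, d.2) * weight Ω T ε m ϱ u (d.1.2, d.2)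
    + errWeight Ω T ε m ϱ u Du lam (d.1.1, d.2)
      * Ω.indicator (fun y => errKer s (‖d.1.1 - y‖ ^ 2 + δ)) d.1.2
    + weight Ω T ε m ϱ u (d.1.2, d.2)
      * Ω.indicator (fun x => errKer s (‖d.1.2 - x‖ ^ 2 + δ)) d.1.1

lemma errLoc_nonneg (h : Flow Ω T ν₁ ν₂ ε m M E f ϱ u Du) (hδ : 0 < δ) (d : (R3 × R3) × ℝ) :
    0 ≤ errLoc s δ Ω T ε m ϱ u Du lam d := by
  have h1 := h.weight_nonneg (d.1.2, d.2)
  have h2 := h.errWeight_nonneg (lam := lam) (d.1.1, d.2)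
  have h3 : ∀ x y : R3, 0 ≤ Ω.indicator (fun y => errKer s (‖x - y‖ ^ 2 + δ)) y := fun x y =>
    indicator_nonneg (fun _ _ => errKer_nonneg (by positivity)) y
  have h4 := h3 d.1.1 d.1.2
  have h5 := h3 d.1.2 d.1.1
  unfold errLoc
  positivity

lemma measurable_indicator_errKer (hΩ : MeasurableSet Ω) (s δ : ℝ) :
    Measurable fun p : R3 × R3 => Ω.indicator (fun y => errKer s (‖p.1 - y‖ ^ 2 + δ)) p.2 := by
  have : (fun p : R3 × R3 => Ω.indicator (fun y => errKer s (‖p.1 - y‖ ^ 2 + δ)) p.2)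
      = (Prod.snd ⁻¹' Ω).indicator fun p : R3 × R3 => errKer s (‖p.1 - p.2‖ ^ 2 + δ) := by
    funext d; rfl
  rw [this]
  exact (by fun_prop : Measurable fun p : R3 × R3 => errKer s (‖p.1 - p.2‖ ^ 2 + δ)).indicator
    (hΩ.preimage measurable_snd)

lemma measurable_errLoc (h : Flow Ω T ν₁ ν₂ ε m M E f ϱ u Du) (hlam : Measurable lam) :
    Measurable (errLoc s δ Ω T ε m ϱ u Du lam) := by
  have h1 := h.measurable_weight
  have h2 := h.measurable_errWeight hlam
  have h3 := measurable_indicator_errKer h.isOpen.measurableSet s δ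
  have h4 : Measurable fun d : (R3 × R3) × ℝ =>
      Ω.indicator (fun y => errKer s (‖d.1.1 - y‖ ^ 2 + δ)) d.1.2 := h3.comp measurable_fst
  have h5 : Measurable fun d : (R3 × R3) × ℝ =>
      Ω.indicator (fun x => errKer s (‖d.1.2 - x‖ ^ 2 + δ)) d.1.1 :=
    h3.comp (f := fun d : (R3 × R3) × ℝ => (d.1.2, d.1.1)) (by fun_prop)
  unfold errLoc
  fun_prop

lemma errWeight_of_notMem (h : Flow Ω T ν₁ ν₂ ε m M E f ϱ u Du) {z : R3 × ℝ}
    (hz : z ∉ cylinder Ω T) : errWeight Ω T ε m ϱ u Du lam z = 0 := by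
  simp [errWeight, h.weight_of_notMem hz, gradNorm, h.gradient_zero z hz, h.velocity_zero z hz]

/-- One product pairs an integrable function with a slice-bounded one on the same time; the other
two pair an integrable function with a spatial kernel of uniformly bounded integral over `Ω`. -/
lemma lintegral_errLoc_le (h : Flow Ω T ν₁ ν₂ ε m M E f ϱ u Du) (hlam : Measurable lam)
    (hδ : 0 < δ) {Ck A0 : ℝ≥0∞}
    (hk : ∀ x ∈ Ω, ∫⁻ y in Ω, ENNReal.ofReal (errKer s (‖x - y‖ ^ 2 + δ)) ≤ Ck)
    (hA : ∫⁻ z, ENNReal.ofReal (errWeight Ω T ε m ϱ u Du lam z) ≤ A0) :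
    ∫⁻ d, ENNReal.ofReal (errLoc s δ Ω T ε m ϱ u Du lam d)
      ≤ (volume Ω + ENNReal.ofReal E + ENNReal.ofReal E) * A0 + Ck * A0
        + Ck * ((volume Ω + ENNReal.ofReal E + ENNReal.ofReal E) * ENNReal.ofReal T) := by
  set W0 := volume Ω + ENNReal.ofReal E + ENNReal.ofReal E
  have h1 := h.measurable_weight
  have h2 := h.measurable_errWeight hlam
  have h3 := measurable_indicator_errKer h.isOpen.measurableSet s δ
  let a : R3 × ℝ → ℝ≥0∞ := fun z => ENNReal.ofReal (errWeight Ω T ε m ϱ u Du lam z)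
  let b : R3 × ℝ → ℝ≥0∞ := fun z => ENNReal.ofReal (weight Ω T ε m ϱ u z)
  let k : R3 → ℝ≥0∞ := fun z => ENNReal.ofReal (errKer s (‖z‖ ^ 2 + δ))
  have ha : Measurable a := by fun_prop
  have hb : Measurable b := by fun_prop
  have hkm : Measurable k := by fun_prop
  have hind : ∀ x y : R3, ENNReal.ofReal (Ω.indicator (fun y => errKer s (‖x - y‖ ^ 2 + δ)) y)
      = Ω.indicator (fun y => k (x - y)) y := fun x y => by
    by_cases hy : y ∈ Ω <;> simp [hy, k]
  have hknn : ∀ x y : R3, 0 ≤ Ω.indicator (fun y => errKer s (‖x - y‖ ^ 2 + δ)) y := fun x y =>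
    indicator_nonneg (fun _ _ => errKer_nonneg (by positivity)) y
  have hpt : ∀ d : (R3 × R3) × ℝ, ENNReal.ofReal (errLoc s δ Ω T ε m ϱ u Du lam d)
      ≤ a (d.1.1, d.2) * b (d.1.2, d.2)
        + a (d.1.1, d.2) * Ω.indicator (fun y => k (d.1.1 - y)) d.1.2
        + b (d.1.2, d.2) * Ω.indicator (fun x => k (d.1.2 - x)) d.1.1 := fun d => by
    unfold errLoc
    refine ENNReal.ofReal_add_le.trans (add_le_add (ENNReal.ofReal_add_le.trans
      (add_le_add ?_ ?_)) ?_)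
    · rw [ENNReal.ofReal_mul (h.errWeight_nonneg _)]
    · rw [ENNReal.ofReal_mul (h.errWeight_nonneg _), hind]
    · rw [ENNReal.ofReal_mul (h.weight_nonneg _), hind]
  have hmk : Measurable fun p : R3 × R3 => Ω.indicator (fun y => k (p.1 - y)) p.2 := by
    have := h3.ennreal_ofReal
    simpa only [hind] using this
  have hmk1 : Measurable fun d : (R3 × R3) × ℝ => Ω.indicator (fun y => k (d.1.1 - y)) d.1.2 :=
    hmk.comp measurable_fst
  have hmk2 : Measurable fun d : (R3 × R3) × ℝ => Ω.indicator (fun x => k (d.1.2 - x)) d.1.1 :=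
    hmk.comp (f := fun d : (R3 × R3) × ℝ => (d.1.2, d.1.1)) (by fun_prop)
  refine (lintegral_mono hpt).trans ?_
  rw [lintegral_add_right _ (by fun_prop), lintegral_add_right _ (by fun_prop)]
  refine add_le_add (add_le_add ?_ ?_) ?_
  · refine (lintegral_diag_le ha hb h.lintegral_weight_le).trans ?_
    gcongr
  · refine (lintegral_kernel_le h.isOpen.measurableSet hkm hk ha fun x t hx => ?_).trans ?_
    · simp only [a]
      rw [h.errWeight_of_notMem fun hz => hx hz.1, ENNReal.ofReal_zero]
    · gcongr
  · have := measurePreserving_swapSpace.lintegral_comp (f := fun d : (R3 × R3) × ℝ =>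
      b (d.1.1, d.2) * Ω.indicator (fun y => k (d.1.1 - y)) d.1.2) (by fun_prop)
    simp only at this
    rw [this]
    refine (lintegral_kernel_le h.isOpen.measurableSet hkm hk hb fun x t hx => ?_).trans ?_
    · simp only [b]
      rw [h.weight_of_notMem fun hz => hx hz.1, ENNReal.ofReal_zero]
    · gcongr
      exact h.lintegral_weight_total_le

lemma interaction_eq_zero_left (h : Flow Ω T ν₁ ν₂ ε m M E f ϱ u Du) {Λ : R3 × ℝ → ℝ}
    (hΛ : IsTest (cylinder Ω T) Λ) (K : R3 → R3) {z : R3 × ℝ} (hz : z ∉ cylinder Ω T)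
    (z' : R3 × ℝ) : interaction ν₁ ν₂ ε m f ϱ u Du K Λ z z' = 0 := by
  simp [interaction, doubledMomentum, doubledMass, prodKer, h.density_zero z hz, hΛ.eq_zero hz, dx,
    hΛ.fderiv_eq_zero hz]

lemma interaction_eq_zero_right (h : Flow Ω T ν₁ ν₂ ε m M E f ϱ u Du) (Λ : R3 × ℝ → ℝ)
    (K : R3 → R3) {z' : R3 × ℝ} (hz : z' ∉ cylinder Ω T)
    (z : R3 × ℝ) : interaction ν₁ ν₂ ε m f ϱ u Du K Λ z z' = 0 := by
  simp [interaction, doubledMomentum, doubledMass, prodKer, h.density_zero z' hz]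

lemma interactionEnergy_nonneg (h : Flow Ω T ν₁ ν₂ ε m M E f ϱ u Du) (hδ : 0 ≤ δ)
    (z z' : R3 × ℝ) : 0 ≤ interactionEnergy s δ lam ϱ z z' := by
  have h1 := h.density_nonneg z
  have h2 := h.density_nonneg z'
  have h3 := gker_nonneg (s := s) (w := ‖z.1 - z'.1‖ ^ 2 + δ) (by positivity)
  unfold interactionEnergy; positivity

/-- The interaction integrates to zero, also after exchanging the points. So integrating the
pointwise lower bound leaves only the error terms. -/
theorem lintegral_interactionEnergy_le (h : Flow Ω T ν₁ ν₂ ε m M E f ϱ u Du)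
    (hlam : IsTest (cylinder Ω T) fun z => lam z ^ 2) (hlm : Measurable lam) (hM : 0 ≤ M)
    (hs : 0 ≤ s) (hs2 : s ≤ 2)
    (hδ : 0 < δ) {L : ℝ} (hL : CutoffBound (fun z => lam z ^ 2) L) {R0 : ℝ≥0∞} (hR0 : R0 ≠ ⊤)
    (hR : ∫⁻ d, ENNReal.ofReal (errLoc s δ Ω T ε m ϱ u Du lam d) ≤ R0) :
    ∫⁻ d : (R3 × R3) × ℝ,
        ENNReal.ofReal (interactionEnergy s δ lam ϱ (d.1.1, d.2) (d.1.2, d.2))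
      ≤ ENNReal.ofReal (4 * interactionConst ν₁ ν₂ M L) * R0 := by
  set Ci := interactionConst ν₁ ν₂ M L with hCi
  have hL0 : 0 ≤ L := (abs_nonneg _).trans (hL.abs_le 0)
  have hCi0 : 0 ≤ Ci := by rw [hCi]; unfold interactionConst; positivity
  obtain ⟨hI, hI0⟩ := h.integral_doubled_eq_zero (smoothKernel_radialKer hs hs2 hδ) hlam
  let I : (R3 × R3) × ℝ → ℝ := fun d => interaction ν₁ ν₂ ε m f ϱ u Du (radialKer s δ)
    (fun z => lam z ^ 2) (d.1.1, d.2) (d.1.2, d.2)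
  have hI : Integrable I := hI
  have hI0 : ∫ d, I d = 0 := hI0
  let sw : (R3 × R3) × ℝ → (R3 × R3) × ℝ := fun d => ((d.1.2, d.1.1), d.2)
  have hsw : MeasurePreserving sw := measurePreserving_swapSpace
  have hIs : Integrable fun d => I (sw d) := hsw.integrable_comp_of_integrable hI
  have hIs0 : ∫ d, I (sw d) = 0 := by
    have := integral_map hsw.measurable.aemeasurable (f := I) (by rw [hsw.map_eq]; exact hI.1)
    rw [hsw.map_eq, hI0] at this
    exact this.symm
  set er := errLoc s δ Ω T ε m ϱ u Du lam with her
  have herm : Measurable er := h.measurable_errLoc hlm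
  have hernn : ∀ d, 0 ≤ er d := fun d => h.errLoc_nonneg hδ d
  have heri : Integrable er := by
    refine ⟨herm.aestronglyMeasurable, ?_⟩
    rw [hasFiniteIntegral_iff_ofReal (ae_of_all _ hernn)]
    exact hR.trans_lt hR0.lt_top
  have heris : Integrable fun d => er (sw d) := hsw.integrable_comp_of_integrable heri
  have hRs : ∫⁻ d, ENNReal.ofReal (er (sw d)) ≤ R0 := by
    rw [hsw.lintegral_comp (f := fun d => ENNReal.ofReal (er d)) (by fun_prop)]
    exact hR
  let b : (R3 × R3) × ℝ → ℝ := fun d => interactionEnergy s δ lam ϱ (d.1.1, d.2) (d.1.2, d.2)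
  have hb0 : ∀ d, 0 ≤ b d := fun d => h.interactionEnergy_nonneg hδ.le _ _
  have hpt : ∀ d, 1 / 2 * (b d + b (sw d)) ≤ I d + I (sw d) + Ci * (er d + er (sw d)) := by
    intro d
    obtain ⟨⟨x, y⟩, t⟩ := d
    by_cases hx : (x, t) ∈ cylinder Ω T
    · by_cases hy : (y, t) ∈ cylinder Ω T
      · have := h.interaction_lower_bound hs hs2 hδ hL hx hy
        have e1 : er ((x, y), t) = errTerm s δ Ω T ε m ϱ u Du lam (x, t) (y, t) := by
          simp only [her, errLoc, errTerm, indicator_of_mem hx.1, indicator_of_mem hy.1]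
          rw [norm_sub_rev y x]
        have e2 : er (sw ((x, y), t)) = errTerm s δ Ω T ε m ϱ u Du lam (y, t) (x, t) := by
          simp only [her, sw, errLoc, errTerm, indicator_of_mem hx.1, indicator_of_mem hy.1]
          rw [norm_sub_rev y x]
        rw [e1, e2]
        exact this
      · have e1 : I ((x, y), t) = 0 := h.interaction_eq_zero_right _ _ hy _
        have e2 : I (sw ((x, y), t)) = 0 := h.interaction_eq_zero_left hlam _ hy _
        have e3 : b ((x, y), t) = 0 := by simp [b, interactionEnergy, h.density_zero _ hy]
        have e4 : b (sw ((x, y), t)) = 0 := by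
          simp [b, sw, interactionEnergy, h.density_zero _ hy]
        rw [e1, e2, e3, e4]
        have := hernn ((x, y), t)
        have := hernn (sw ((x, y), t))
        simp only [add_zero, mul_zero, zero_add]
        positivity
    · have e1 : I ((x, y), t) = 0 := h.interaction_eq_zero_left hlam _ hx _
      have e2 : I (sw ((x, y), t)) = 0 := h.interaction_eq_zero_right _ _ hx _
      have e3 : b ((x, y), t) = 0 := by simp [b, interactionEnergy, h.density_zero _ hx]
      have e4 : b (sw ((x, y), t)) = 0 := by
        simp [b, sw, interactionEnergy, h.density_zero _ hx]
      rw [e1, e2, e3, e4]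
      have := hernn ((x, y), t)
      have := hernn (sw ((x, y), t))
      simp only [add_zero, mul_zero, zero_add]
      positivity
  -- Although the interaction has no sign, this majorant does, so its lower Lebesgue integral is a
  -- Bochner integral, in which the interaction drops out.
  have hJ0 : ∀ d, 0 ≤ I d + I (sw d) + Ci * (er d + er (sw d)) := fun d => by
    have := hb0 d
    have := hb0 (sw d)
    exact le_trans (by positivity) (hpt d)
  have i1 : Integrable fun d => I d + I (sw d) := hI.add hIs
  have i2 : Integrable fun d => Ci * (er d + er (sw d)) := (heri.add heris).const_mul Ci
  calc ∫⁻ d, ENNReal.ofReal (b d)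
      ≤ ∫⁻ d, 2 * ENNReal.ofReal (I d + I (sw d) + Ci * (er d + er (sw d))) := by
        refine lintegral_mono fun d => ?_
        rw [show (2 : ℝ≥0∞) = ENNReal.ofReal 2 by simp, ← ENNReal.ofReal_mul (by norm_num)]
        apply ENNReal.ofReal_le_ofReal
        have := hpt d
        have := hb0 (sw d)
        linarith
    _ = 2 * ENNReal.ofReal (∫ d, (I d + I (sw d) + Ci * (er d + er (sw d)))) := by
        rw [lintegral_const_mul' _ _ (by simp),
          ofReal_integral_eq_lintegral_ofReal
            (f := fun d => I d + I (sw d) + Ci * (er d + er (sw d))) (i1.add i2) (ae_of_all _ hJ0)]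
    _ = 2 * ENNReal.ofReal (∫ d, Ci * (er d + er (sw d))) := by
        rw [integral_add i1 i2, integral_add hI hIs, hI0, hIs0]; simp
    _ = 2 * ∫⁻ d, ENNReal.ofReal (Ci * (er d + er (sw d))) := by
        rw [ofReal_integral_eq_lintegral_ofReal i2 (ae_of_all _ fun d =>
          mul_nonneg hCi0 (add_nonneg (hernn _) (hernn _)))]
    _ = 2 * (ENNReal.ofReal Ci * ((∫⁻ d, ENNReal.ofReal (er d))
          + ∫⁻ d, ENNReal.ofReal (er (sw d)))) := by
        have hms : Measurable sw := hsw.measurable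
        congr 1
        rw [← lintegral_add_left (by fun_prop), ← lintegral_const_mul _ (by fun_prop)]
        refine lintegral_congr fun d => ?_
        rw [ENNReal.ofReal_mul hCi0, ENNReal.ofReal_add (hernn _) (hernn _)]
    _ ≤ 2 * (ENNReal.ofReal Ci * (R0 + R0)) := by gcongr
    _ = ENNReal.ofReal (4 * Ci) * R0 := by
        rw [ENNReal.ofReal_mul (by norm_num)]
        simp
        ring

/-- Fatou's lemma along `δ = 1/(n+1)`. -/
theorem lintegral_interactionEnergy_zero_le (h : Flow Ω T ν₁ ν₂ ε m M E f ϱ u Du)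
    (hlm : Measurable lam) {C : ℝ≥0∞}
    (hC : ∀ δ > 0, ∫⁻ d : (R3 × R3) × ℝ,
        ENNReal.ofReal (interactionEnergy s δ lam ϱ (d.1.1, d.2) (d.1.2, d.2)) ≤ C) :
    ∫⁻ d : (R3 × R3) × ℝ,
        ENNReal.ofReal (interactionEnergy s 0 lam ϱ (d.1.1, d.2) (d.1.2, d.2)) ≤ C := by
  let F : ℕ → (R3 × R3) × ℝ → ℝ≥0∞ := fun n d => ENNReal.ofReal
    (interactionEnergy s (1 / ((n : ℝ) + 1)) lam ϱ (d.1.1, d.2) (d.1.2, d.2))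
  have hρm := h.measurable_density
  have hFm : ∀ n, Measurable (F n) := fun n => by
    simp only [F, interactionEnergy]; fun_prop
  have hF : ∀ d, ENNReal.ofReal (interactionEnergy s 0 lam ϱ (d.1.1, d.2) (d.1.2, d.2))
      ≤ liminf (fun n => F n d) atTop := by
    intro d
    -- On the spatial diagonal the convention `0 ^ (-1/2) = 0` makes the unregularised energy
    -- vanish, so nothing has to converge there.
    rcases eq_or_ne d.1.1 d.1.2 with he | hne
    · have : interactionEnergy s 0 lam ϱ (d.1.1, d.2) (d.1.2, d.2) = 0 := by
        simp only [interactionEnergy, gker, he, sub_self, norm_zero, add_zero]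
        rw [zero_pow (by norm_num), Real.zero_rpow (by norm_num)]
        simp
      rw [this]; simp
    · refine le_of_eq (Tendsto.liminf_eq ?_).symm
      refine ENNReal.tendsto_ofReal ?_
      unfold interactionEnergy
      refine Tendsto.const_mul _ ?_
      have hp : 0 < ‖d.1.1 - d.1.2‖ ^ 2 + 0 := by
        have := norm_pos_iff.2 (sub_ne_zero.2 hne)
        positivity
      have h1 : ContinuousAt (gker s) (‖d.1.1 - d.1.2‖ ^ 2 + 0) :=
        (hasDerivAt_gker s hp).continuousAt
      have h2 : Tendsto (fun n : ℕ => ‖d.1.1 - d.1.2‖ ^ 2 + 1 / ((n : ℝ) + 1)) atTop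
          (𝓝 (‖d.1.1 - d.1.2‖ ^ 2 + 0)) :=
        tendsto_one_div_add_atTop_nhds_zero_nat.const_add _
      exact h1.tendsto.comp h2
  calc _ ≤ ∫⁻ d, liminf (fun n => F n d) atTop := lintegral_mono hF
    _ ≤ liminf (fun n => ∫⁻ d, F n d) atTop := lintegral_liminf_le hFm
    _ ≤ liminf (fun _ : ℕ => C) atTop :=
        liminf_le_liminf (Eventually.of_forall fun n => hC _ (by positivity))
    _ = C := by simp

end Flow

/-! ### Cauchy-Schwarz inequalities, weak gradients and mollification. -/

section CauchySchwarz

variable {α : Type*} [MeasurableSpace α] {κ : Measure α} {a b w : α → ℝ≥0∞}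

lemma sq_lintegral_mul_le (ha : AEMeasurable a κ) (hb : AEMeasurable b κ) :
    (∫⁻ x, a x * b x ∂κ) ^ 2 ≤ (∫⁻ x, a x ^ 2 ∂κ) * ∫⁻ x, b x ^ 2 ∂κ := by
  have h := ENNReal.lintegral_mul_norm_pow_le (p := 1 / 2) (q := 1 / 2) (ha.pow_const 2)
    (hb.pow_const 2) (by norm_num) (by norm_num) (by norm_num)
  have e : ∀ c : ℝ≥0∞, (c ^ 2) ^ (1 / 2 : ℝ) = c := fun c => by
    rw [← ENNReal.rpow_natCast, ← ENNReal.rpow_mul]; norm_num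
  have e' : ∀ c : ℝ≥0∞, (c ^ (1 / 2 : ℝ)) ^ 2 = c := fun c => by
    rw [← ENNReal.rpow_natCast, ← ENNReal.rpow_mul]; norm_num
  simp only [e] at h
  calc _ ≤ ((∫⁻ x, a x ^ 2 ∂κ) ^ (1 / 2 : ℝ) * (∫⁻ x, b x ^ 2 ∂κ) ^ (1 / 2 : ℝ)) ^ 2 := by gcongr
    _ = _ := by rw [mul_pow, e', e']

lemma sq_lintegral_weight_mul_le (hw : AEMeasurable w κ) (hb : AEMeasurable b κ) :
    (∫⁻ x, w x * b x ∂κ) ^ 2 ≤ (∫⁻ x, w x ∂κ) * ∫⁻ x, w x * b x ^ 2 ∂κ := by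
  have e' : ∀ c : ℝ≥0∞, (c ^ (1 / 2 : ℝ)) ^ 2 = c := fun c => by
    rw [← ENNReal.rpow_natCast, ← ENNReal.rpow_mul]; norm_num
  have h := sq_lintegral_mul_le (κ := κ) (hw.pow_const (1 / 2 : ℝ))
    ((hw.pow_const (1 / 2 : ℝ)).mul hb)
  simp only [Pi.mul_apply, ← mul_assoc, ← sq, mul_pow, e'] at h
  exact h

end CauchySchwarz

section WeakGradient

variable {U : Set R3} {g : R3 → R3} {G G' : R3 → Fin 3 → R3}

lemma integrable_smul_of_tsupport_subset {χ : R3 → ℝ} (hχ : Continuous χ)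
    (hc : HasCompactSupport χ) (hs : tsupport χ ⊆ U) {A : R3 → R3} (hA : LocallyIntegrableOn A U) :
    Integrable fun x => χ x • A x := by
  refine IntegrableOn.integrable_of_forall_notMem_eq_zero (s := tsupport χ) ?_ fun x hx => ?_
  · exact (hA.integrableOn_compact_subset hs hc).continuousOn_smul hχ.continuousOn hc
  · rw [image_eq_zero_of_notMem_tsupport hx, zero_smul]

lemma HasWeakGradient.ae_eq (hU : IsOpen U) (h : HasWeakGradient U g G)
    (h' : HasWeakGradient U g G') : ∀ᵐ x ∂(volume.restrict U), G x = G' x := by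
  have key : ∀ j, ∀ᵐ x, x ∈ U → G x j - G' x j = 0 := fun j => by
    have i1 : LocallyIntegrableOn (fun x => G x j) U := (h.2 j).1
    have i2 : LocallyIntegrableOn (fun x => G' x j) U := (h'.2 j).1
    have hsub : LocallyIntegrableOn (fun x => G x j - G' x j) U := i1.sub i2
    refine hU.ae_eq_zero_of_integral_contDiff_smul_eq_zero hsub fun φ h1 h2 h3 => ?_
    have j1 : Integrable fun x => φ x • G x j :=
      integrable_smul_of_tsupport_subset h1.continuous h2 h3 i1
    have j2 : Integrable fun x => φ x • G' x j :=
      integrable_smul_of_tsupport_subset h1.continuous h2 h3 i2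
    have e1 := (h.2 j).2 φ ⟨h1, h2, h3⟩
    have e2 := (h'.2 j).2 φ ⟨h1, h2, h3⟩
    calc ∫ x, φ x • (G x j - G' x j) = ∫ x, (φ x • G x j - φ x • G' x j) := by
          simp only [smul_sub]
      _ = 0 := by rw [integral_sub j1 j2, sub_eq_zero, ← neg_inj, ← e1, ← e2]
  rw [ae_restrict_iff' hU.measurableSet]
  filter_upwards [ae_all_iff.2 key] with x hx hxU
  funext j
  exact sub_eq_zero.1 (hx j hxU)

lemma HasWeakGradient.sobolevNorm_eq (hU : IsOpen U) (h : HasWeakGradient U g G) :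
    sobolevNorm U g
      = (∫⁻ x in U, ENNReal.ofReal (‖g x‖ ^ 2 + ∑ j, ‖G x j‖ ^ 2)) ^ (1 / 2 : ℝ) := by
  unfold sobolevNorm
  congr 1
  refine le_antisymm (iInf₂_le G h) (le_iInf₂ fun G' h' => le_of_eq ?_)
  refine lintegral_congr_ae ?_
  filter_upwards [h.ae_eq hU h'] with x hx
  rw [hx]

lemma HasWeakGradient.sobolevNorm_sq (hU : IsOpen U) (h : HasWeakGradient U g G) :
    sobolevNorm U g ^ 2 = ∫⁻ x in U, ENNReal.ofReal (‖g x‖ ^ 2 + ∑ j, ‖G x j‖ ^ 2) := by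
  rw [h.sobolevNorm_eq hU, ← ENNReal.rpow_natCast, ← ENNReal.rpow_mul]; norm_num

/-- For an arbitrary test function `φ` on the whole space, `φ χ` is a test function in `U`; the
Leibniz rule moves the derivative of `χ` to the other side. Extension by zero creates no boundary
term. -/
lemma HasWeakGradient.smul_test {χ : R3 → ℝ} (hχ : IsTest U χ) (h : HasWeakGradient U g G) :
    HasWeakGradient univ (fun x => χ x • g x)
      (fun x j => χ x • G x j + fderiv ℝ χ x (e j) • g x) := by
  have hd : ∀ j, Continuous fun x => fderiv ℝ χ x (e j) := fun j =>
    (hχ.1.continuous_fderiv (by simp)).clm_apply continuous_const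
  have hdc : ∀ j, HasCompactSupport fun x => fderiv ℝ χ x (e j) := fun j =>
    hχ.2.1.fderiv_apply ℝ _
  have hds : ∀ j, tsupport (fun x => fderiv ℝ χ x (e j)) ⊆ U := fun j =>
    (tsupport_fderiv_apply_subset ℝ _).trans hχ.2.2
  have i1 := integrable_smul_of_tsupport_subset hχ.1.continuous hχ.2.1 hχ.2.2 h.1
  have i2 := fun j => integrable_smul_of_tsupport_subset hχ.1.continuous hχ.2.1 hχ.2.2 (h.2 j).1
  have i3 := fun j => integrable_smul_of_tsupport_subset (hd j) (hdc j) (hds j) h.1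
  refine ⟨i1.locallyIntegrable.locallyIntegrableOn _, fun j =>
    ⟨((i2 j).add (i3 j)).locallyIntegrable.locallyIntegrableOn _, fun φ hφ => ?_⟩⟩
  have hφd : Continuous fun x => fderiv ℝ φ x (e j) :=
    (hφ.1.continuous_fderiv (by simp)).clm_apply continuous_const
  have htest : IsTest U fun x => φ x * χ x :=
    ⟨hφ.1.mul hχ.1, hχ.2.1.mul_left, (tsupport_mul_subset_right).trans hχ.2.2⟩
  have hf : ∀ x, fderiv ℝ (fun x => φ x * χ x) x (e j)
      = φ x * fderiv ℝ χ x (e j) + fderiv ℝ φ x (e j) * χ x := fun x => by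
    have h1 := (hφ.1.differentiable (by simp)) x
    have h2 := (hχ.1.differentiable (by simp)) x
    rw [show (fun x => φ x * χ x) = φ * χ from rfl, fderiv_mul h1 h2]
    simp [mul_comm]
  have hk := (h.2 j).2 _ htest
  obtain ⟨C, hC⟩ := hφ.2.1.exists_bound_of_continuous hφ.1.continuous
  obtain ⟨C', hC'⟩ := (hφ.2.1.fderiv_apply ℝ (e j)).exists_bound_of_continuous hφd
  have j1 : Integrable fun x => φ x • fderiv ℝ χ x (e j) • g x :=
    (i3 j).bdd_smul C hφ.1.continuous.aestronglyMeasurable (ae_of_all _ hC)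
  have j2 : Integrable fun x => fderiv ℝ φ x (e j) • χ x • g x :=
    i1.bdd_smul C' hφd.aestronglyMeasurable (ae_of_all _ hC')
  have j3 : Integrable fun x => φ x • χ x • G x j :=
    (i2 j).bdd_smul C hφ.1.continuous.aestronglyMeasurable (ae_of_all _ hC)
  simp only [hf, add_smul, mul_smul] at hk
  rw [integral_add j1 j2] at hk
  simp only [smul_add]
  rw [integral_add j3 j1, neg_add, ← hk]
  abel

end WeakGradient

section Mollification

variable {g : R3 → R3} {G : R3 → Fin 3 → R3}

/-- The mollification of a vector field. -/
noncomputable def mollify (ψ : R3 → ℝ) (g : R3 → R3) (x : R3) : R3 := ∫ y, ψ (x - y) • g y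

lemma mollify_eq_convolution (ψ : R3 → ℝ) (g : R3 → R3) :
    mollify ψ g = convolution g ψ (ContinuousLinearMap.lsmul ℝ ℝ).flip volume := by
  funext x
  simp [mollify, convolution]

lemma contDiff_mollify {ψ : R3 → ℝ} (hψ : ContDiff ℝ ∞ ψ) (hc : HasCompactSupport ψ)
    (hg : LocallyIntegrable g) : ContDiff ℝ ∞ (mollify ψ g) := by
  rw [mollify_eq_convolution]
  exact hc.contDiff_convolution_right _ hg hψ

lemma fderiv_mollify {ψ : R3 → ℝ} (hψ : ContDiff ℝ ∞ ψ) (hc : HasCompactSupport ψ)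
    (h : HasWeakGradient univ g G) (x : R3) (j : Fin 3) :
    fderiv ℝ (mollify ψ g) x (e j) = mollify ψ (fun y => G y j) x := by
  have hψd : Continuous fun x => fderiv ℝ ψ x := hψ.continuous_fderiv (by simp)
  have hg := locallyIntegrableOn_univ.1 h.1
  have h1 := hc.hasFDerivAt_convolution_right (ContinuousLinearMap.lsmul ℝ ℝ).flip hg
    (hψ.of_le (by simp)) x
  rw [mollify_eq_convolution, h1.fderiv, convolution_precompR_apply _ hg (hc.fderiv ℝ) hψd]
  have htest : IsTest univ fun y => ψ (x - y) := by
    refine ⟨hψ.comp (contDiff_const.sub contDiff_id), ?_, subset_univ _⟩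
    exact hc.comp_homeomorph (Homeomorph.subLeft x)
  have hd : ∀ y, fderiv ℝ (fun y => ψ (x - y)) y (e j) = - fderiv ℝ ψ (x - y) (e j) := fun y => by
    have h2 : HasFDerivAt (fun y : R3 => x - y) (-ContinuousLinearMap.id ℝ R3) y :=
      (hasFDerivAt_id y).const_sub x
    have h3 : HasFDerivAt ψ (fderiv ℝ ψ (x - y)) (x - y) :=
      ((hψ.differentiable (by simp)) _).hasFDerivAt
    have h4 : HasFDerivAt (fun y : R3 => ψ (x - y)) _ y := h3.comp y h2
    rw [h4.fderiv]
    simp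
  have hk := (h.2 j).2 _ htest
  simp only [hd, neg_smul, integral_neg] at hk
  have hk' := neg_injective hk
  simpa [mollify, convolution] using hk'

/-- Cauchy-Schwarz with the probability density `ψ (x - ·)`, then Tonelli's theorem. -/
lemma lintegral_mollify_sq_le {ψ : R3 → ℝ} (hψ : Continuous ψ) (h0 : ∀ x, 0 ≤ ψ x)
    (h1 : ∫⁻ x, ENNReal.ofReal (ψ x) = 1) {A : R3 → R3} (hA : AEStronglyMeasurable A) :
    ∫⁻ x, ‖mollify ψ A x‖ₑ ^ 2 ≤ ∫⁻ x, ‖A x‖ₑ ^ 2 := by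
  have hAm := hA.enorm
  have hpt : ∀ x, ‖mollify ψ A x‖ₑ ^ 2 ≤ ∫⁻ y, ENNReal.ofReal (ψ (x - y)) * ‖A y‖ₑ ^ 2 := fun x => by
    have e1 : ‖mollify ψ A x‖ₑ ≤ ∫⁻ y, ENNReal.ofReal (ψ (x - y)) * ‖A y‖ₑ := by
      refine (enorm_integral_le_lintegral_enorm _).trans (le_of_eq ?_)
      refine lintegral_congr fun y => ?_
      rw [enorm_smul, Real.enorm_eq_ofReal (h0 _)]
    have e2 := sq_lintegral_weight_mul_le (κ := volume) (w := fun y => ENNReal.ofReal (ψ (x - y)))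
      (by fun_prop) hAm
    rw [lintegral_sub_left_eq_self (fun y => ENNReal.ofReal (ψ y)), h1, one_mul] at e2
    exact (pow_le_pow_left' e1 2).trans e2
  refine (lintegral_mono hpt).trans (le_of_eq ?_)
  rw [lintegral_lintegral_swap]
  · refine lintegral_congr fun y => ?_
    rw [lintegral_mul_const _ (by fun_prop), lintegral_sub_right_eq_self
      (fun y => ENNReal.ofReal (ψ y)), h1, one_mul]
  · have : AEMeasurable (fun p : R3 × R3 => ‖A p.2‖ₑ ^ 2) (volume.prod volume) :=
      (hAm.comp_snd).pow_const 2
    exact AEMeasurable.mul (by fun_prop) this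

/-- Mollification commutes with the weak gradient and does not increase `L²` norms. Almost
everywhere convergence with a uniform gradient bound suffices, since the inequalities passed to the
limit below use Fatou's lemma. -/
theorem HasWeakGradient.exists_approx (h : HasWeakGradient univ g G) (hc : HasCompactSupport g) :
    ∃ φ : ℕ → R3 → R3, (∀ n, ContDiff ℝ ∞ (φ n)) ∧ (∀ n, HasCompactSupport (φ n)) ∧
      (∀ᵐ x, Tendsto (fun n => φ n x) atTop (𝓝 (g x))) ∧
      ∀ n, ∫⁻ x, ∑ j, ‖fderiv ℝ (φ n) x (e j)‖ₑ ^ 2 ≤ ∫⁻ x, ∑ j, ‖G x j‖ₑ ^ 2 := by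
  have hg := locallyIntegrableOn_univ.1 h.1
  have hG := fun j => (locallyIntegrableOn_univ.1 (h.2 j).1).aestronglyMeasurable
  let b : ℕ → ContDiffBump (0 : R3) := fun n =>
    ⟨1 / ((n : ℝ) + 1), 2 * (1 / ((n : ℝ) + 1)), by positivity, by
      have : 0 < 1 / ((n : ℝ) + 1) := by positivity
      linarith⟩
  let ψ : ℕ → R3 → ℝ := fun n => (b n).normed volume
  have hψ : ∀ n, ContDiff ℝ ∞ (ψ n) := fun n => (b n).contDiff_normed
  have hψc : ∀ n, HasCompactSupport (ψ n) := fun n => (b n).hasCompactSupport_normed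
  refine ⟨fun n => mollify (ψ n) g, fun n => contDiff_mollify (hψ n) (hψc n) hg, fun n => ?_, ?_,
    fun n => ?_⟩
  · simp only [mollify_eq_convolution]
    exact hc.convolution _ (hψc n)
  · have := ContDiffBump.ae_convolution_tendsto_right_of_locallyIntegrable (φ := b) (l := atTop)
      (K := 2) (μ := (volume : Measure R3)) (g := g) ?_ ?_ hg
    · filter_upwards [this] with x hx
      refine hx.congr fun n => ?_
      rw [mollify_eq_convolution, convolution_flip]
    · have := (tendsto_one_div_add_atTop_nhds_zero_nat (𝕜 := ℝ)).const_mul 2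
      simpa [b] using this
    · exact Eventually.of_forall fun n => le_rfl
  · have h1 : ∫⁻ x, ENNReal.ofReal (ψ n x) = 1 := by
      rw [← ofReal_integral_eq_lintegral_ofReal (b n).integrable_normed
        (ae_of_all _ (b n).nonneg_normed), (b n).integral_normed, ENNReal.ofReal_one]
    have hm : ∀ j, AEMeasurable (fun x => ‖G x j‖ₑ ^ 2) := fun j => (hG j).enorm.pow_const 2
    have hm' : ∀ j, Measurable (fun x => ‖fderiv ℝ (mollify (ψ n) g) x (e j)‖ₑ ^ 2) := fun j => by
      have : Continuous fun x => fderiv ℝ (mollify (ψ n) g) x (e j) :=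
        ((contDiff_mollify (hψ n) (hψc n) hg).continuous_fderiv (by simp)).clm_apply
          continuous_const
      fun_prop
    rw [lintegral_finsetSum' _ fun j _ => hm j, lintegral_finsetSum _ fun j _ => hm' j]
    refine Finset.sum_le_sum fun j _ => ?_
    simp only [fderiv_mollify (hψ n) (hψc n) h]
    exact lintegral_mollify_sq_le (hψ n).continuous (b n).nonneg_normed h1 (hG j)

end Mollification

/-! ### The Sobolev inequality for weak gradients. -/

section Sobolev

lemma enorm_sq_le_sum (A : R3 →L[ℝ] R3) : ‖A‖ₑ ^ 2 ≤ 3 * ∑ j, ‖A (e j)‖ₑ ^ 2 := by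
  have h : ‖A‖ ≤ ∑ j, ‖A (e j)‖ := by
    refine A.opNorm_le_bound (by positivity) fun x => ?_
    have hx : x = ∑ j, x j • e j := by
      ext i; simp [e, Finset.sum_apply, Pi.single_apply]
    calc ‖A x‖ = ‖∑ j, x j • A (e j)‖ := by
          conv_lhs => rw [hx]
          simp only [map_sum, map_smul]
      _ ≤ ∑ j, ‖x j • A (e j)‖ := norm_sum_le _ _
      _ ≤ ∑ j, ‖A (e j)‖ * ‖x‖ := by
          refine Finset.sum_le_sum fun j _ => ?_
          rw [norm_smul, mul_comm]
          gcongr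
          exact PiLp.norm_apply_le x j
      _ = _ := by rw [Finset.sum_mul]
  have h2 : ‖A‖ ^ 2 ≤ 3 * ∑ j, ‖A (e j)‖ ^ 2 := by
    have := sq_sum_le_card_mul_sum_sq (s := Finset.univ) (f := fun j => ‖A (e j)‖)
    simp only [Finset.card_univ, Fintype.card_fin, Nat.cast_ofNat] at this
    exact (pow_le_pow_left₀ (norm_nonneg _) h 2).trans this
  have h3 := ENNReal.ofReal_le_ofReal h2
  rw [ENNReal.ofReal_mul (by norm_num), ENNReal.ofReal_sum_of_nonneg fun _ _ => by positivity] at h3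
  simpa only [ENNReal.ofReal_pow (norm_nonneg _), ofReal_norm, ENNReal.ofReal_ofNat] using h3

lemma exists_lintegral_pow_six_le : ∃ C : ℝ≥0∞, C ≠ ⊤ ∧ ∀ φ : R3 → R3, ContDiff ℝ ∞ φ →
    HasCompactSupport φ →
      ∫⁻ x, ‖φ x‖ₑ ^ 6 ≤ C * (∫⁻ x, ∑ j, ‖fderiv ℝ φ x (e j)‖ₑ ^ 2) ^ 3 := by
  let C0 := eLpNormLESNormFDerivOfEqInnerConst (volume : Measure R3) 2
  refine ⟨(C0 : ℝ≥0∞) ^ 6 * 3 ^ 3, by finiteness, fun φ h1 h2 => ?_⟩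
  have h := eLpNorm_le_eLpNorm_fderiv_of_eq_inner (volume : Measure R3) (h1.of_le (by simp)) h2
    (p := 2) (p' := 6) (by norm_num) (by simp) (by simp; norm_num)
  have h6 := pow_le_pow_left' h 6
  have e6 : eLpNorm φ ((6 : NNReal) : ℝ≥0∞) volume ^ 6 = ∫⁻ x, ‖φ x‖ₑ ^ 6 := by
    have := eLpNorm_nnreal_pow_eq_lintegral (f := φ) (μ := volume) (p := 6) (by norm_num)
    simpa using this
  have e2 : eLpNorm (fderiv ℝ φ) ((2 : NNReal) : ℝ≥0∞) volume ^ 2 = ∫⁻ x, ‖fderiv ℝ φ x‖ₑ ^ 2 := by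
    have := eLpNorm_nnreal_pow_eq_lintegral (f := fderiv ℝ φ) (μ := volume) (p := 2) (by norm_num)
    simpa using this
  rw [e6, mul_pow, show 6 = 2 * 3 from rfl, pow_mul (eLpNorm (fderiv ℝ φ) _ _) 2 3, e2] at h6
  refine h6.trans ?_
  have hm : Measurable fun x => ∑ j, ‖fderiv ℝ φ x (e j)‖ₑ ^ 2 := by
    have : ∀ j, Continuous fun x => fderiv ℝ φ x (e j) := fun j =>
      (h1.continuous_fderiv (by simp)).clm_apply continuous_const
    fun_prop
  calc _ ≤ (C0 : ℝ≥0∞) ^ (2 * 3) * (∫⁻ x, 3 * ∑ j, ‖fderiv ℝ φ x (e j)‖ₑ ^ 2) ^ 3 := by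
        gcongr with x
        · exact le_rfl
        · exact enorm_sq_le_sum _
    _ = _ := by rw [lintegral_const_mul _ hm, mul_pow]; ring

theorem exists_lintegral_pow_six_le_of_hasWeakGradient : ∃ C : ℝ≥0∞, C ≠ ⊤ ∧
    ∀ (g : R3 → R3) (G : R3 → Fin 3 → R3), HasWeakGradient univ g G → HasCompactSupport g →
      ∫⁻ x, ‖g x‖ₑ ^ 6 ≤ C * (∫⁻ x, ∑ j, ‖G x j‖ₑ ^ 2) ^ 3 := by
  obtain ⟨C, hC, h6⟩ := exists_lintegral_pow_six_le
  refine ⟨C, hC, fun g G h hc => ?_⟩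
  obtain ⟨φ, h1, h2, h3, h4⟩ := h.exists_approx hc
  calc ∫⁻ x, ‖g x‖ₑ ^ 6 ≤ ∫⁻ x, liminf (fun n => ‖φ n x‖ₑ ^ 6) atTop := by
        refine lintegral_mono_ae ?_
        filter_upwards [h3] with x hx
        exact le_of_eq (Tendsto.liminf_eq ((ENNReal.continuous_pow 6).tendsto _ |>.comp
          hx.enorm)).symm
    _ ≤ liminf (fun n => ∫⁻ x, ‖φ n x‖ₑ ^ 6) atTop :=
        lintegral_liminf_le fun n => by
          have := (h1 n).continuous
          fun_prop
    _ ≤ liminf (fun _ : ℕ => C * (∫⁻ x, ∑ j, ‖G x j‖ₑ ^ 2) ^ 3) atTop := by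
        refine liminf_le_liminf (Eventually.of_forall fun n => ?_)
        refine (h6 _ (h1 n) (h2 n)).trans ?_
        exact mul_le_mul_right (pow_le_pow_left' (h4 n) 3) C
    _ = _ := by simp

end Sobolev

lemma lintegral_eq_mul_lintegral_comp_smul {r : ℝ} (hr : r ≠ 0) {F : R3 → ℝ≥0∞}
    (hF : Measurable F) : ∫⁻ z, F z = ENNReal.ofReal (|r| ^ 3) * ∫⁻ y, F (r • y) := by
  have h := Measure.map_addHaar_smul (volume : Measure R3) hr
  have h1 : ∫⁻ z, F z ∂(Measure.map (fun x : R3 => r • x) volume) = ∫⁻ y, F (r • y) :=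
    lintegral_map hF (by fun_prop)
  rw [← h1, h, lintegral_smul_measure, smul_eq_mul, ← mul_assoc, ← ENNReal.ofReal_mul (by positivity)]
  simp only [finrank_euclideanSpace, Fintype.card_fin, abs_inv, abs_pow]
  rw [mul_inv_cancel₀ (by positivity)]
  simp

/-! ### The pointwise bound by the Riesz potential of the gradient. -/

section Riesz

variable {φ : R3 → R3}

lemma enorm_le_lintegral_ray (h1 : ContDiff ℝ ∞ φ) (h2 : HasCompactSupport φ) (x : R3) {y : R3}
    (hy : y ≠ 0) : ‖φ x‖ₑ ≤ ∫⁻ r in Iic (0 : ℝ), ‖fderiv ℝ φ (x + r • y)‖ₑ * ‖y‖ₑ := by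
  have hc : ContDiff ℝ ∞ fun r : ℝ => φ (x + r • y) :=
    h1.comp (contDiff_const.add (contDiff_id.smul contDiff_const))
  have hcs : HasCompactSupport fun r : ℝ => φ (x + r • y) := by
    refine h2.comp_isClosedEmbedding ?_
    exact (Homeomorph.addLeft x).isClosedEmbedding.comp (isClosedEmbedding_smul_left hy)
  have h := hcs.enorm_le_lintegral_Ici_deriv (hc.of_le (by simp)) 0
  simp only [zero_smul, add_zero] at h
  refine h.trans (lintegral_mono fun r => ?_)
  have hd : HasDerivAt (fun r : ℝ => x + r • y) y r := by
    simpa using ((hasDerivAt_id r).smul_const y).const_add x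
  have := ((h1.differentiable (by simp)) (x + r • y)).hasFDerivAt.comp_hasDerivAt r hd
  have h3 : deriv (fun r : ℝ => φ (x + r • y)) r = fderiv ℝ φ (x + r • y) y := this.deriv
  rw [h3]
  exact ContinuousLinearMap.le_opENorm _ _

/-- The spherical shell of radii `1` and `2`. -/
def shell : Set R3 := {y | 1 < ‖y‖ ∧ ‖y‖ < 2}

lemma measurableSet_shell : MeasurableSet shell :=
  ((isOpen_lt continuous_const continuous_norm).inter
    (isOpen_lt continuous_norm continuous_const)).measurableSet

lemma volume_shell_ne_zero : volume shell ≠ 0 := by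
  have ho : IsOpen shell := (isOpen_lt continuous_const continuous_norm).inter
    (isOpen_lt continuous_norm continuous_const)
  refine (ho.measure_pos volume ⟨EuclideanSpace.single 0 (3 / 2), ?_⟩).ne'
  simp only [shell, mem_ofPred_eq, PiLp.norm_single]
  norm_num

lemma volume_shell_ne_top : volume shell ≠ ⊤ := by
  have : shell ⊆ Metric.ball 0 2 := fun y hy => by simpa using hy.2
  exact ((measure_mono this).trans_lt measure_ball_lt_top).ne

/-- Substitute `z = r y`: the shell becomes `|r| < |z| < 2|r|`, and there the Jacobian `|r|⁻³` is at
most `8 |z|⁻³`. -/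
lemma lintegral_shell_le {D : R3 → ℝ≥0∞} (hD : Measurable D) {r : ℝ} (hr : r ≠ 0) :
    ∫⁻ y in shell, D (r • y)
      ≤ ∫⁻ z, D z * (8 * (‖z‖ₑ ^ 3)⁻¹) * (Ioo (‖z‖ / 2) ‖z‖).indicator 1 |r| := by
  have hr0 : 0 < |r| := abs_pos.2 hr
  let F : R3 → ℝ≥0∞ := fun z => {z : R3 | |r| < ‖z‖ ∧ ‖z‖ < 2 * |r|}.indicator D z
  have hs : MeasurableSet {z : R3 | |r| < ‖z‖ ∧ ‖z‖ < 2 * |r|} :=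
    ((isOpen_lt continuous_const continuous_norm).inter
      (isOpen_lt continuous_norm continuous_const)).measurableSet
  have hF : Measurable F := hD.indicator hs
  have e1 : ∫⁻ y in shell, D (r • y) = ∫⁻ y, F (r • y) := by
    rw [← lintegral_indicator measurableSet_shell]
    refine lintegral_congr fun y => ?_
    have : y ∈ shell ↔ r • y ∈ {z : R3 | |r| < ‖z‖ ∧ ‖z‖ < 2 * |r|} := by
      simp only [shell, mem_ofPred_eq, norm_smul, Real.norm_eq_abs]
      constructor
      · rintro ⟨h1, h2⟩; constructor <;> nlinarith
      · rintro ⟨h1, h2⟩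
        exact ⟨by by_contra h; nlinarith, by by_contra h; nlinarith⟩
    by_cases hy : y ∈ shell
    · rw [indicator_of_mem hy]; simp only [F]; rw [indicator_of_mem (this.1 hy)]
    · rw [indicator_of_notMem hy]; simp only [F]; rw [indicator_of_notMem (mt this.2 hy)]
  have e2 := lintegral_eq_mul_lintegral_comp_smul hr hF
  have e3 : ∫⁻ y, F (r • y) = (ENNReal.ofReal (|r| ^ 3))⁻¹ * ∫⁻ z, F z := by
    rw [e2, ← mul_assoc, ENNReal.inv_mul_cancel (by simpa using hr) ENNReal.ofReal_ne_top,
      one_mul]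
  rw [e1, e3, ← lintegral_const_mul _ hF]
  refine lintegral_mono fun z => ?_
  simp only [F]
  by_cases hz : z ∈ {z : R3 | |r| < ‖z‖ ∧ ‖z‖ < 2 * |r|}
  · have hz' : |r| ∈ Ioo (‖z‖ / 2) ‖z‖ := ⟨by linarith [hz.2], hz.1⟩
    rw [indicator_of_mem hz, indicator_of_mem hz', Pi.one_apply, mul_one, mul_comm]
    gcongr
    have hz0 : 0 < ‖z‖ := hr0.trans hz.1
    rw [← ofReal_norm, ← ENNReal.ofReal_pow hz0.le, ← ENNReal.ofReal_inv_of_pos (by positivity),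
      ← ENNReal.ofReal_inv_of_pos (by positivity), show (8 : ℝ≥0∞) = ENNReal.ofReal 8 by simp,
      ← ENNReal.ofReal_mul (by norm_num)]
    apply ENNReal.ofReal_le_ofReal
    rw [← div_eq_mul_inv, inv_eq_one_div, div_le_div_iff₀ (by positivity) (by positivity)]
    calc 1 * ‖z‖ ^ 3 ≤ 1 * (2 * |r|) ^ 3 := by gcongr; exact hz.2.le
      _ = 8 * |r| ^ 3 := by ring
  · rw [indicator_of_notMem hz, mul_zero]
    exact zero_le

lemma lintegral_indicator_abs_le (z : R3) :
    ∫⁻ r in Iic (0 : ℝ), (Ioo (‖z‖ / 2) ‖z‖).indicator (1 : ℝ → ℝ≥0∞) |r| ≤ ‖z‖ₑ := by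
  calc _ ≤ ∫⁻ r in Iic (0 : ℝ), (Icc (-‖z‖) 0).indicator (1 : ℝ → ℝ≥0∞) r := by
        refine setLIntegral_mono' measurableSet_Iic fun r hr => ?_
        by_cases h : |r| ∈ Ioo (‖z‖ / 2) ‖z‖
        · have : r ∈ Icc (-‖z‖) 0 := ⟨(abs_lt.1 h.2).1.le, hr⟩
          rw [indicator_of_mem h, indicator_of_mem this]; simp
        · rw [indicator_of_notMem h]; exact zero_le
    _ ≤ ∫⁻ r, (Icc (-‖z‖) 0).indicator (1 : ℝ → ℝ≥0∞) r := setLIntegral_le_lintegral _ _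
    _ = ‖z‖ₑ := by
        rw [lintegral_indicator_one measurableSet_Icc, Real.volume_Icc]; simp

lemma inv_pow_three_mul_le (z : R3) : (‖z‖ₑ ^ 3)⁻¹ * ‖z‖ₑ ≤ (‖z‖ₑ ^ 2)⁻¹ := by
  rcases eq_or_ne z 0 with rfl | hz
  · simp
  · have h0 : ‖z‖ₑ ≠ 0 := by simpa using hz
    rw [pow_succ, ENNReal.mul_inv (by simp) (by simp [h0]), mul_assoc,
      ENNReal.inv_mul_cancel h0 (by simp), mul_one]

lemma measurable_indicator_abs :
    Measurable fun p : R3 × ℝ => (Ioo (‖p.1‖ / 2) ‖p.1‖).indicator (1 : ℝ → ℝ≥0∞) |p.2| := by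
  have hs1 : MeasurableSet {p : R3 × ℝ | ‖p.1‖ / 2 < |p.2|} :=
    measurableSet_lt (by fun_prop) (by fun_prop)
  have hs2 : MeasurableSet {p : R3 × ℝ | |p.2| < ‖p.1‖} :=
    measurableSet_lt (by fun_prop) (by fun_prop)
  exact (measurable_const (a := (1 : ℝ≥0∞))).indicator (hs1.inter hs2)

lemma lintegral_ray_le (z : R3) (d : ℝ≥0∞) :
    ∫⁻ r in Iic (0 : ℝ), d * (8 * (‖z‖ₑ ^ 3)⁻¹) * (Ioo (‖z‖ / 2) ‖z‖).indicator 1 |r| * 2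
      ≤ 16 * (d * (‖z‖ₑ ^ 2)⁻¹) := by
  have hm : Measurable fun r : ℝ => (Ioo (‖z‖ / 2) ‖z‖).indicator (1 : ℝ → ℝ≥0∞) |r| :=
    ((measurable_const (a := (1 : ℝ≥0∞))).indicator measurableSet_Ioo).comp
      continuous_abs.measurable
  rw [lintegral_mul_const _ (hm.const_mul _), lintegral_const_mul _ hm]
  have h1 := lintegral_indicator_abs_le z
  have h2 := inv_pow_three_mul_le z
  generalize ∫⁻ r in Iic (0 : ℝ), (Ioo (‖z‖ / 2) ‖z‖).indicator (1 : ℝ → ℝ≥0∞) |r| = I at h1 ⊢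
  calc d * (8 * (‖z‖ₑ ^ 3)⁻¹) * I * 2 ≤ d * (8 * (‖z‖ₑ ^ 3)⁻¹) * ‖z‖ₑ * 2 := by gcongr
    _ = 16 * (d * ((‖z‖ₑ ^ 3)⁻¹ * ‖z‖ₑ)) := by ring
    _ ≤ 16 * (d * (‖z‖ₑ ^ 2)⁻¹) := by gcongr

/-- Average the fundamental theorem of calculus along the rays through `x` over directions `y` in
the shell. After substituting `z = r y`, a point `z` is met only for `|r|` between `|z|/2` and
`|z|`, and integrating `|z|⁻³` over these `r` gives `|z|⁻²`. A solid shell avoids surface measure;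
`16` is `8` from the Jacobian times `2` from `|y| < 2`. -/
lemma exists_enorm_le_riesz : ∃ C : ℝ≥0∞, C ≠ ⊤ ∧ ∀ φ : R3 → R3, ContDiff ℝ ∞ φ →
    HasCompactSupport φ → ∀ x, ‖φ x‖ₑ ≤ C * ∫⁻ z, ‖fderiv ℝ φ z‖ₑ * (‖x - z‖ₑ ^ 2)⁻¹ := by
  refine ⟨(volume shell)⁻¹ * 16, ENNReal.mul_ne_top (ENNReal.inv_ne_top.2 volume_shell_ne_zero)
    (by simp), fun φ h1 h2 x => ?_⟩
  have hDc : Continuous fun z => ‖fderiv ℝ φ z‖ₑ := (h1.continuous_fderiv (by simp)).enorm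
  let D : R3 → ℝ≥0∞ := fun z => ‖fderiv ℝ φ (x + z)‖ₑ
  have hDc' : Continuous D := hDc.comp (continuous_const.add continuous_id)
  have hD : Measurable D := hDc'.measurable
  have hball := measurable_indicator_abs
  have key : volume shell * ‖φ x‖ₑ ≤ 16 * ∫⁻ z, D z * (‖z‖ₑ ^ 2)⁻¹ := by
    calc volume shell * ‖φ x‖ₑ = ∫⁻ y in shell, ‖φ x‖ₑ := by
          rw [setLIntegral_const, mul_comm]
      _ ≤ ∫⁻ y in shell, ∫⁻ r in Iic (0 : ℝ), D (r • y) * 2 := by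
          refine setLIntegral_mono' measurableSet_shell fun y hy => ?_
          have hy0 : y ≠ 0 := by
            rintro rfl
            have := hy.1
            simp at this
            linarith
          refine (enorm_le_lintegral_ray h1 h2 x hy0).trans (lintegral_mono fun r => ?_)
          have : ‖y‖ₑ ≤ 2 := by
            rw [← ofReal_norm]
            exact ENNReal.ofReal_le_of_le_toReal (by simpa using hy.2.le)
          gcongr
      _ = ∫⁻ r in Iic (0 : ℝ), (∫⁻ y in shell, D (r • y)) * 2 := by
          rw [lintegral_lintegral_swap (by
            have : Measurable fun p : R3 × ℝ => D (p.2 • p.1) * 2 := by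
              have := hD.comp (f := fun p : R3 × ℝ => p.2 • p.1) (by fun_prop)
              exact this.mul_const 2
            exact this.aemeasurable)]
          refine lintegral_congr fun r => ?_
          exact lintegral_mul_const _ (hD.comp (by fun_prop : Measurable fun y : R3 => r • y))
      _ ≤ ∫⁻ r in Iic (0 : ℝ), (∫⁻ z, D z * (8 * (‖z‖ₑ ^ 3)⁻¹)
            * (Ioo (‖z‖ / 2) ‖z‖).indicator 1 |r|) * 2 := by
          refine lintegral_mono_ae ?_
          filter_upwards [Measure.ae_ne (μ := volume.restrict (Iic (0 : ℝ))) 0] with r hr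
          exact mul_le_mul_left (lintegral_shell_le hD hr) 2
      _ = ∫⁻ z, ∫⁻ r in Iic (0 : ℝ), D z * (8 * (‖z‖ₑ ^ 3)⁻¹)
            * (Ioo (‖z‖ / 2) ‖z‖).indicator 1 |r| * 2 := by
          have hm : Measurable fun p : R3 × ℝ => D p.1 * (8 * (‖p.1‖ₑ ^ 3)⁻¹)
            * (Ioo (‖p.1‖ / 2) ‖p.1‖).indicator 1 |p.2| := by
            refine Measurable.mul ?_ hball
            fun_prop
          rw [lintegral_lintegral_swap (by exact (hm.mul_const 2).aemeasurable)]
          refine lintegral_congr fun r => ?_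
          exact (lintegral_mul_const _
            (hm.comp (by fun_prop : Measurable fun z : R3 => (z, r)))).symm
      _ ≤ ∫⁻ z, 16 * (D z * (‖z‖ₑ ^ 2)⁻¹) := lintegral_mono fun z => lintegral_ray_le z _
      _ = _ := by rw [lintegral_const_mul _ (by fun_prop)]
  have e : ∫⁻ z, D z * (‖z‖ₑ ^ 2)⁻¹ = ∫⁻ z, ‖fderiv ℝ φ z‖ₑ * (‖x - z‖ₑ ^ 2)⁻¹ := by
    rw [← lintegral_add_left_eq_self (fun z => ‖fderiv ℝ φ z‖ₑ * (‖x - z‖ₑ ^ 2)⁻¹) x]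
    refine lintegral_congr fun z => ?_
    simp [D]
  rw [e] at key
  rw [mul_assoc]
  calc ‖φ x‖ₑ = (volume shell)⁻¹ * (volume shell * ‖φ x‖ₑ) := by
        rw [← mul_assoc, ENNReal.inv_mul_cancel volume_shell_ne_zero volume_shell_ne_top, one_mul]
    _ ≤ _ := by gcongr

end Riesz

/-! ### Composition of Riesz kernels and the potential estimate. -/

section Composition

lemma lintegral_profile_lt_top :
    ∫⁻ z : R3, (‖z‖ₑ ^ 2)⁻¹ * ((‖z‖ₑ + 1) ^ 2)⁻¹ < ⊤ := by
  rw [← lintegral_add_compl _ (Metric.isOpen_ball (x := (0 : R3)) (ε := 1)).measurableSet]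
  refine ENNReal.add_lt_top.2 ⟨?_, ?_⟩
  · have h : IntegrableOn (fun z : R3 => (fun r : ℝ => (r ^ 2)⁻¹) ‖z‖) (Metric.ball 0 1) := by
      rw [integrableOn_fun_norm_addHaar volume (f := fun r : ℝ => (r ^ 2)⁻¹)]
      have : IntegrableOn (fun _ : ℝ => (1 : ℝ)) (Ioo 0 1) := by simp
      refine this.congr_fun (fun r hr => ?_) measurableSet_Ioo
      have : r ≠ 0 := hr.1.ne'
      simp [this]
    refine lt_of_le_of_lt ?_ h.2
    refine lintegral_mono_ae ?_
    filter_upwards [Measure.ae_ne (μ := volume.restrict (Metric.ball (0 : R3) 1)) 0] with z hz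
    have hz' : 0 < ‖z‖ := norm_pos_iff.2 hz
    rw [Real.enorm_eq_ofReal (by positivity), ENNReal.ofReal_inv_of_pos (by positivity),
      ENNReal.ofReal_pow hz'.le, ofReal_norm]
    refine mul_le_of_le_one_right zero_le ?_
    rw [ENNReal.inv_le_one]
    exact one_le_pow₀ (by simp)
  · have h := (integrable_one_add_norm (E := R3) (μ := volume) (r := 4) (by simp; norm_num)).2
    have h4 : ∫⁻ z : R3, 4 * ‖(1 + ‖z‖) ^ (-4 : ℝ)‖ₑ < ⊤ := by
      rw [lintegral_const_mul' _ _ (by simp)]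
      exact ENNReal.mul_lt_top (by simp) h
    refine lt_of_le_of_lt ((setLIntegral_mono' (Metric.isOpen_ball.measurableSet.compl)
      fun z hz => ?_).trans (setLIntegral_le_lintegral _ _)) h4
    have hz1 : 1 ≤ ‖z‖ := by simpa using hz
    have hp : (1 + ‖z‖) ^ (-4 : ℝ) = ((1 + ‖z‖) ^ 4)⁻¹ := by
      rw [Real.rpow_neg (by positivity)]; norm_cast
    rw [Real.enorm_eq_ofReal (by positivity), hp, ← ofReal_norm,
      show (1 : ℝ≥0∞) = ENNReal.ofReal 1 by simp, ← ENNReal.ofReal_add (by positivity) zero_le_one,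
      ← ENNReal.ofReal_pow (by positivity), ← ENNReal.ofReal_pow (by positivity),
      ← ENNReal.ofReal_inv_of_pos (by positivity), ← ENNReal.ofReal_inv_of_pos (by positivity),
      ← ENNReal.ofReal_mul (by positivity), show (4 : ℝ≥0∞) = ENNReal.ofReal 4 by simp,
      ← ENNReal.ofReal_mul (by positivity)]
    apply ENNReal.ofReal_le_ofReal
    rw [← mul_inv, ← div_eq_mul_inv, inv_eq_one_div, div_le_div_iff₀ (by positivity) (by positivity),
      show (1 + ‖z‖) ^ 4 = (1 + ‖z‖) ^ 2 * (‖z‖ + 1) ^ 2 by ring]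
    calc 1 * ((1 + ‖z‖) ^ 2 * (‖z‖ + 1) ^ 2) ≤ 1 * ((2 * ‖z‖) ^ 2 * (‖z‖ + 1) ^ 2) := by
          gcongr; linarith
      _ = _ := by ring

/-- Homogeneity: scaling by `c` gives `c³` from the volume and `c⁻⁴` from the profile. -/
lemma lintegral_scaled_profile {c : ℝ≥0∞} (hc0 : c ≠ 0) (hc : c ≠ ⊤) :
    ∫⁻ z : R3, (‖z‖ₑ ^ 2)⁻¹ * ((‖z‖ₑ + c) ^ 2)⁻¹
      = c⁻¹ * ∫⁻ z : R3, (‖z‖ₑ ^ 2)⁻¹ * ((‖z‖ₑ + 1) ^ 2)⁻¹ := by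
  have hr : 0 < c.toReal := ENNReal.toReal_pos hc0 hc
  rw [lintegral_eq_mul_lintegral_comp_smul hr.ne' (by fun_prop), abs_of_pos hr,
    ENNReal.ofReal_pow hr.le, ENNReal.ofReal_toReal hc]
  have e : ∀ z : R3, (‖c.toReal • z‖ₑ ^ 2)⁻¹ * ((‖c.toReal • z‖ₑ + c) ^ 2)⁻¹
      = (c⁻¹) ^ 4 * ((‖z‖ₑ ^ 2)⁻¹ * ((‖z‖ₑ + 1) ^ 2)⁻¹) := fun z => by
    rw [enorm_smul, Real.enorm_eq_ofReal hr.le, ENNReal.ofReal_toReal hc,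
      show c * ‖z‖ₑ + c = c * (‖z‖ₑ + 1) by ring, mul_pow, mul_pow,
      ENNReal.mul_inv (Or.inl (by simp [hc0])) (Or.inl (by simp [hc])),
      ENNReal.mul_inv (Or.inl (by simp [hc0])) (Or.inl (by simp [hc])),
      ENNReal.inv_pow (a := c)]
    ring
  simp only [e]
  rw [lintegral_const_mul _ (by fun_prop), ← mul_assoc]
  congr 1
  calc c ^ 3 * c⁻¹ ^ 4 = (c * c⁻¹) ^ 3 * c⁻¹ := by ring
    _ = c⁻¹ := by rw [ENNReal.mul_inv_cancel hc0 hc]; simp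

/-- If `b` is the larger distance then `a + c ≤ 3b`, so `b⁻²` may be replaced by `9 (a + c)⁻²`. The
product of two kernels centred at different points thus splits into two functions with one centre
each. -/
lemma inv_sq_mul_inv_sq_le {a b c : ℝ≥0∞} (hc : c ≤ a + b) :
    (a ^ 2)⁻¹ * (b ^ 2)⁻¹
      ≤ 9 * ((a ^ 2)⁻¹ * ((a + c) ^ 2)⁻¹ + (b ^ 2)⁻¹ * ((b + c) ^ 2)⁻¹) := by
  have key : ∀ {a b c : ℝ≥0∞}, c ≤ a + b → a ≤ b →
      (a ^ 2)⁻¹ * (b ^ 2)⁻¹ ≤ 9 * ((a ^ 2)⁻¹ * ((a + c) ^ 2)⁻¹) := fun {a b c} hc hab => by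
    have h3 : a + c ≤ 3 * b := by
      calc a + c ≤ b + (b + b) := by gcongr; exact hc.trans (by gcongr)
        _ = 3 * b := by ring
    have h9 : ((3 * b) ^ 2)⁻¹ ≤ ((a + c) ^ 2)⁻¹ := ENNReal.inv_le_inv.2 (by gcongr)
    calc (a ^ 2)⁻¹ * (b ^ 2)⁻¹ = 9 * ((a ^ 2)⁻¹ * ((3 * b) ^ 2)⁻¹) := by
          rw [mul_pow, ENNReal.mul_inv (Or.inl (by simp)) (Or.inl (by simp)),
            show (3 : ℝ≥0∞) ^ 2 = 9 by norm_num]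
          calc (a ^ 2)⁻¹ * (b ^ 2)⁻¹ = (9 * 9⁻¹) * ((a ^ 2)⁻¹ * (b ^ 2)⁻¹) := by
                rw [ENNReal.mul_inv_cancel (by simp) (by simp), one_mul]
            _ = _ := by ring
      _ ≤ _ := by gcongr
  rcases le_total a b with h | h
  · exact (key hc h).trans (by gcongr; exact le_self_add)
  · rw [mul_comm]
    rw [add_comm] at hc
    exact (key hc h).trans (by gcongr; exact le_add_self)

lemma exists_lintegral_riesz_comp_le : ∃ C : ℝ≥0∞, C ≠ ⊤ ∧ ∀ x y : R3,
    ∫⁻ z, (‖x - z‖ₑ ^ 2)⁻¹ * (‖y - z‖ₑ ^ 2)⁻¹ ≤ C * ‖x - y‖ₑ⁻¹ := by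
  set J := ∫⁻ z : R3, (‖z‖ₑ ^ 2)⁻¹ * ((‖z‖ₑ + 1) ^ 2)⁻¹ with hJ
  -- `J + 1` instead of `J` makes the constant visibly nonzero, so that the right side is `⊤` when
  -- `x = y`.
  refine ⟨18 * (J + 1), ENNReal.mul_ne_top (by simp)
    (ENNReal.add_ne_top.2 ⟨lintegral_profile_lt_top.ne, by simp⟩), fun x y => ?_⟩
  rcases eq_or_ne x y with rfl | hxy
  · rw [sub_self, enorm_zero, ENNReal.inv_zero, ENNReal.mul_top (by simp)]
    exact le_top
  have hc0 : ‖x - y‖ₑ ≠ 0 := by simpa [sub_eq_zero] using hxy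
  have hc : ‖x - y‖ₑ ≠ ⊤ := by simp
  set c := ‖x - y‖ₑ
  have e : ∀ w : R3, ∫⁻ z, (‖w - z‖ₑ ^ 2)⁻¹ * ((‖w - z‖ₑ + c) ^ 2)⁻¹ = c⁻¹ * J := fun w => by
    rw [lintegral_sub_left_eq_self (fun z : R3 => (‖z‖ₑ ^ 2)⁻¹ * ((‖z‖ₑ + c) ^ 2)⁻¹) w,
      lintegral_scaled_profile hc0 hc]
  calc _ ≤ ∫⁻ z, 9 * ((‖x - z‖ₑ ^ 2)⁻¹ * ((‖x - z‖ₑ + c) ^ 2)⁻¹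
        + (‖y - z‖ₑ ^ 2)⁻¹ * ((‖y - z‖ₑ + c) ^ 2)⁻¹) := by
        refine lintegral_mono fun z => inv_sq_mul_inv_sq_le ?_
        have : x - y = (x - z) - (y - z) := by abel
        simp only [c]
        rw [this]
        exact enorm_sub_le
    _ = 18 * J * c⁻¹ := by
        rw [lintegral_const_mul _ (by fun_prop), lintegral_add_left (by fun_prop), e, e]
        ring
    _ ≤ _ := by gcongr; exact le_self_add

end Composition

/-- By the Riesz bound the integral is at most `C ∫ |∇g| P`, where `P` is the convolution of `a`
with `|·|⁻²`. Cauchy-Schwarz leaves `∫ P²`, and expanding the square composes two Riesz kernels to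
`|x - y|⁻¹`. The smooth case passes to weak gradients by Fatou's lemma. -/
theorem exists_sq_lintegral_mul_enorm_le : ∃ C : ℝ≥0∞, C ≠ ⊤ ∧ ∀ (g : R3 → R3)
    (G : R3 → Fin 3 → R3), HasWeakGradient univ g G → HasCompactSupport g →
    ∀ a : R3 → ℝ≥0∞, Measurable a →
      (∫⁻ x, a x * ‖g x‖ₑ) ^ 2
        ≤ C * (∫⁻ x, ∑ j, ‖G x j‖ₑ ^ 2) * ∫⁻ x, ∫⁻ y, a x * a y * ‖x - y‖ₑ⁻¹ := by
  obtain ⟨C1, hC1, h1⟩ := exists_enorm_le_riesz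
  obtain ⟨C2, hC2, h2⟩ := exists_lintegral_riesz_comp_le
  refine ⟨C1 ^ 2 * 3 * C2, by finiteness, fun g G h hc a ha => ?_⟩
  set A := ∫⁻ x, ∫⁻ y, a x * a y * ‖x - y‖ₑ⁻¹ with hA
  let P : R3 → ℝ≥0∞ := fun z => ∫⁻ x, a x * (‖x - z‖ₑ ^ 2)⁻¹
  have hP : Measurable P := by
    have : Measurable fun p : R3 × R3 => a p.2 * (‖p.2 - p.1‖ₑ ^ 2)⁻¹ := by fun_prop
    exact this.lintegral_prod_right'
  have hP2 : ∫⁻ z, P z ^ 2 ≤ C2 * A := by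
    calc ∫⁻ z, P z ^ 2
        = ∫⁻ z, ∫⁻ x, ∫⁻ y, (a x * a y) * ((‖x - z‖ₑ ^ 2)⁻¹ * (‖y - z‖ₑ ^ 2)⁻¹) := by
          refine lintegral_congr fun z => ?_
          rw [sq]
          simp only [P]
          rw [← lintegral_mul_const _ (by fun_prop)]
          refine lintegral_congr fun x => ?_
          rw [← lintegral_const_mul _ (by fun_prop)]
          refine lintegral_congr fun y => ?_
          ring
      _ = ∫⁻ x, ∫⁻ y, ∫⁻ z, (a x * a y) * ((‖x - z‖ₑ ^ 2)⁻¹ * (‖y - z‖ₑ ^ 2)⁻¹) := by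
          rw [lintegral_lintegral_swap]
          · refine lintegral_congr fun x => ?_
            rw [lintegral_lintegral_swap (by fun_prop)]
          · have : Measurable fun q : (R3 × R3) × R3 => (a q.1.2 * a q.2)
              * ((‖q.1.2 - q.1.1‖ₑ ^ 2)⁻¹ * (‖q.2 - q.1.1‖ₑ ^ 2)⁻¹) := by fun_prop
            exact this.lintegral_prod_right'.aemeasurable
      _ ≤ ∫⁻ x, ∫⁻ y, C2 * (a x * a y * ‖x - y‖ₑ⁻¹) := by
          refine lintegral_mono fun x => lintegral_mono fun y => ?_
          simp only
          rw [lintegral_const_mul _ (by fun_prop)]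
          calc _ ≤ a x * a y * (C2 * ‖x - y‖ₑ⁻¹) := by gcongr; exact h2 x y
            _ = _ := by ring
      _ = C2 * A := by
          rw [hA, ← lintegral_const_mul]
          · refine lintegral_congr fun x => ?_
            rw [lintegral_const_mul _ (by fun_prop)]
          · have : Measurable fun p : R3 × R3 => a p.1 * a p.2 * ‖p.1 - p.2‖ₑ⁻¹ := by fun_prop
            exact this.lintegral_prod_right'
  have smooth : ∀ φ : R3 → R3, ContDiff ℝ ∞ φ → HasCompactSupport φ →
      (∫⁻ x, a x * ‖φ x‖ₑ) ^ 2
        ≤ C1 ^ 2 * 3 * C2 * (∫⁻ x, ∑ j, ‖fderiv ℝ φ x (e j)‖ₑ ^ 2) * A := fun φ hφ hφc => by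
    have hDc : Continuous fun z => ‖fderiv ℝ φ z‖ₑ := (hφ.continuous_fderiv (by simp)).enorm
    have hDm := hDc.measurable
    have hDj : ∀ j, Continuous fun z => fderiv ℝ φ z (e j) := fun j =>
      (hφ.continuous_fderiv (by simp)).clm_apply continuous_const
    have e1 : ∫⁻ x, a x * ‖φ x‖ₑ ≤ C1 * ∫⁻ z, ‖fderiv ℝ φ z‖ₑ * P z := by
      calc ∫⁻ x, a x * ‖φ x‖ₑ
          ≤ ∫⁻ x, ∫⁻ z, C1 * (‖fderiv ℝ φ z‖ₑ * (a x * (‖x - z‖ₑ ^ 2)⁻¹)) := by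
            refine lintegral_mono fun x => ?_
            calc a x * ‖φ x‖ₑ ≤ a x * (C1 * ∫⁻ z, ‖fderiv ℝ φ z‖ₑ * (‖x - z‖ₑ ^ 2)⁻¹) := by
                  gcongr; exact h1 φ hφ hφc x
              _ = ∫⁻ z, a x * C1 * (‖fderiv ℝ φ z‖ₑ * (‖x - z‖ₑ ^ 2)⁻¹) := by
                  rw [lintegral_const_mul _ (by fun_prop)]; ring
              _ = _ := lintegral_congr fun z => by ring
        _ = ∫⁻ z, ∫⁻ x, C1 * (‖fderiv ℝ φ z‖ₑ * (a x * (‖x - z‖ₑ ^ 2)⁻¹)) := by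
            rw [lintegral_lintegral_swap (by fun_prop)]
        _ = _ := by
            rw [← lintegral_const_mul _ (by fun_prop)]
            refine lintegral_congr fun z => ?_
            rw [lintegral_const_mul _ (by fun_prop), lintegral_const_mul _ (by fun_prop)]
    have e2 := sq_lintegral_mul_le (κ := volume) hDm.aemeasurable hP.aemeasurable
    have e3 : ∫⁻ z, ‖fderiv ℝ φ z‖ₑ ^ 2 ≤ 3 * ∫⁻ x, ∑ j, ‖fderiv ℝ φ x (e j)‖ₑ ^ 2 := by
      rw [← lintegral_const_mul _ (by fun_prop)]
      exact lintegral_mono fun z => enorm_sq_le_sum _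
    calc (∫⁻ x, a x * ‖φ x‖ₑ) ^ 2 ≤ (C1 * ∫⁻ z, ‖fderiv ℝ φ z‖ₑ * P z) ^ 2 :=
          pow_le_pow_left' e1 2
      _ = C1 ^ 2 * (∫⁻ z, ‖fderiv ℝ φ z‖ₑ * P z) ^ 2 := by rw [mul_pow]
      _ ≤ C1 ^ 2 * ((3 * ∫⁻ x, ∑ j, ‖fderiv ℝ φ x (e j)‖ₑ ^ 2) * (C2 * A)) :=
          mul_le_mul_right (e2.trans (mul_le_mul' e3 hP2)) _
      _ = _ := by ring
  obtain ⟨φ, k1, k2, k3, k4⟩ := h.exists_approx hc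
  have fatou : ∫⁻ x, a x * ‖g x‖ₑ ≤ liminf (fun n => ∫⁻ x, a x * ‖φ n x‖ₑ) atTop := by
    calc ∫⁻ x, a x * ‖g x‖ₑ ≤ ∫⁻ x, liminf (fun n => a x * ‖φ n x‖ₑ) atTop := by
          refine lintegral_mono_ae ?_
          filter_upwards [k3] with x hx
          -- As `a x` may be infinite, multiplication by it is continuous only away from `0`; where
          -- `g x = 0` the bound is trivial.
          rcases eq_or_ne (g x) 0 with h0 | h0
          · simp [h0]
          · refine le_of_eq (Tendsto.liminf_eq ?_).symm
            exact ENNReal.Tendsto.const_mul hx.enorm (Or.inl (by simpa using h0))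
      _ ≤ _ := lintegral_liminf_le fun n => by
          have := (k1 n).continuous
          fun_prop
  set S := C1 ^ 2 * 3 * C2 * (∫⁻ x, ∑ j, ‖G x j‖ₑ ^ 2) * A
  have hn : ∀ n, ∫⁻ x, a x * ‖φ n x‖ₑ ≤ S ^ (1 / 2 : ℝ) := fun n => by
    have h3 : (∫⁻ x, a x * ‖φ n x‖ₑ) ^ 2 ≤ S :=
      (smooth _ (k1 n) (k2 n)).trans
        (mul_le_mul_left (mul_le_mul_right (k4 n) _) _)
    calc ∫⁻ x, a x * ‖φ n x‖ₑ = ((∫⁻ x, a x * ‖φ n x‖ₑ) ^ 2) ^ (1 / 2 : ℝ) := by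
          rw [← ENNReal.rpow_natCast, ← ENNReal.rpow_mul]; norm_num
      _ ≤ _ := ENNReal.rpow_le_rpow h3 (by norm_num)
  have : ∫⁻ x, a x * ‖g x‖ₑ ≤ S ^ (1 / 2 : ℝ) := by
    refine fatou.trans ?_
    calc _ ≤ liminf (fun _ : ℕ => S ^ (1 / 2 : ℝ)) atTop :=
          liminf_le_liminf (Eventually.of_forall hn)
      _ = _ := by simp
  calc _ ≤ (S ^ (1 / 2 : ℝ)) ^ 2 := pow_le_pow_left' this 2
    _ = S := by rw [← ENNReal.rpow_natCast, ← ENNReal.rpow_mul]; norm_num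

/-! ### Trading logarithms of the kinetic energy for logarithms of the distance. -/

section Logarithm

lemma log_rpow_div_le {κ Z r : ℝ} (hκ : 0 ≤ κ) (hκ2 : κ ≤ 4 / 3) (hZ : 0 ≤ Z) (hr : 0 < r) :
    Real.log (1 + Z) ^ κ * r⁻¹
      ≤ 256 * (ell (r ^ 2) ^ κ * r⁻¹ + (1 + Z) ^ (1 / 6 : ℝ)) := by
  have hl0 : 0 ≤ Real.log (1 + Z) := Real.log_nonneg (by linarith)
  have hZ1 : (1 : ℝ) ≤ 1 + Z := by linarith
  have hell := ell_pos (w := r ^ 2) (by positivity)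
  have hZ6 : 0 ≤ (1 + Z) ^ (1 / 6 : ℝ) := by positivity
  have hek : 0 ≤ ell (r ^ 2) ^ κ := by positivity
  have hri : 0 < r⁻¹ := by positivity
  -- Below the threshold `log (1 + Z) ≤ 6 ell(r²)`. Above it both `r⁻¹` and, up to a constant, the
  -- logarithm to the power `κ ≤ 4/3` are at most `(1 + Z)^(1/12)`; together they give the exponent
  -- `1/6`.
  rcases le_or_gt (1 + Z) ((r⁻¹) ^ 12) with h | h
  · have h1 : Real.log (1 + Z) ≤ 6 * ell (r ^ 2) := by
      have e1 := Real.log_le_log (by linarith) h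
      have e2 : Real.log ((r⁻¹) ^ 12) = 6 * Real.log ((r ^ 2)⁻¹) := by
        rw [← inv_pow, Real.log_pow, Real.log_pow]; push_cast; ring
      have e3 : Real.log ((r ^ 2)⁻¹) ≤ Real.log (1 + (r ^ 2)⁻¹) :=
        Real.log_le_log (by positivity) (by linarith)
      unfold ell
      linarith
    have h2 : Real.log (1 + Z) ^ κ ≤ 36 * ell (r ^ 2) ^ κ := by
      calc Real.log (1 + Z) ^ κ ≤ (6 * ell (r ^ 2)) ^ κ := Real.rpow_le_rpow hl0 h1 hκ
        _ = 6 ^ κ * ell (r ^ 2) ^ κ := Real.mul_rpow (by norm_num) hell.le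
        _ ≤ 6 ^ (2 : ℝ) * ell (r ^ 2) ^ κ := by
            gcongr
            · norm_num
            · linarith
        _ = _ := by norm_num
    calc Real.log (1 + Z) ^ κ * r⁻¹ ≤ 36 * ell (r ^ 2) ^ κ * r⁻¹ := by gcongr
      _ ≤ _ := by nlinarith [mul_nonneg hek hri.le]
  · have h1 : r⁻¹ ≤ (1 + Z) ^ (1 / 12 : ℝ) := by
      calc r⁻¹ = ((r⁻¹) ^ 12) ^ (1 / 12 : ℝ) := by
            rw [← Real.rpow_natCast, ← Real.rpow_mul hri.le]; norm_num
        _ ≤ _ := Real.rpow_le_rpow (by positivity) h.le (by norm_num)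
    have h2 : Real.log (1 + Z) ≤ 16 * (1 + Z) ^ (1 / 16 : ℝ) := by
      have := Real.log_le_rpow_div (x := 1 + Z) (by linarith) (show (0 : ℝ) < 1 / 16 by norm_num)
      linarith
    have h3 : Real.log (1 + Z) ^ κ ≤ 256 * (1 + Z) ^ (1 / 12 : ℝ) := by
      calc Real.log (1 + Z) ^ κ ≤ (16 * (1 + Z) ^ (1 / 16 : ℝ)) ^ κ := Real.rpow_le_rpow hl0 h2 hκ
        _ = 16 ^ κ * (1 + Z) ^ (1 / 16 * κ) := by
            rw [Real.mul_rpow (by norm_num) (by positivity), ← Real.rpow_mul (by linarith)]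
        _ ≤ 16 ^ (2 : ℝ) * (1 + Z) ^ (1 / 12 : ℝ) := by
            gcongr
            · norm_num
            · linarith
            · linarith
        _ = _ := by norm_num
    have h4 : Real.log (1 + Z) ^ κ * r⁻¹ ≤ 256 * (1 + Z) ^ (1 / 6 : ℝ) := by
      calc Real.log (1 + Z) ^ κ * r⁻¹
          ≤ 256 * (1 + Z) ^ (1 / 12 : ℝ) * (1 + Z) ^ (1 / 12 : ℝ) := by gcongr
        _ = _ := by
          rw [mul_assoc, ← Real.rpow_add (by linarith)]; norm_num
    nlinarith [mul_nonneg hek hri.le]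

lemma log_rpow_mul_log_rpow_div_le {μ Y Y' r : ℝ} (hμ : 0 ≤ μ) (hμ2 : μ ≤ 2 / 3) (hY : 0 ≤ Y)
    (hY' : 0 ≤ Y') (hr : 0 < r) :
    Real.log (1 + Y) ^ μ * Real.log (1 + Y') ^ μ * r⁻¹
      ≤ 256 * (ell (r ^ 2) ^ (2 * μ) * r⁻¹ + (1 + Y) ^ (1 / 6 : ℝ) * (1 + Y') ^ (1 / 6 : ℝ)) := by
  have key : ∀ {Y Y' : ℝ}, 0 ≤ Y → 0 ≤ Y' → Y ≤ Y' →
      Real.log (1 + Y) ^ μ * Real.log (1 + Y') ^ μ * r⁻¹ ≤ 256 * (ell (r ^ 2) ^ (2 * μ) * r⁻¹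
        + (1 + Y) ^ (1 / 6 : ℝ) * (1 + Y') ^ (1 / 6 : ℝ)) := fun {Y Y'} hY hY' h => by
    have h0 : 0 ≤ Real.log (1 + Y) := Real.log_nonneg (by linarith)
    have h0' : 0 ≤ Real.log (1 + Y') := Real.log_nonneg (by linarith)
    have h1 : Real.log (1 + Y) ^ μ * Real.log (1 + Y') ^ μ ≤ Real.log (1 + Y') ^ (2 * μ) := by
      rw [two_mul, Real.rpow_add_of_nonneg h0' hμ hμ]
      gcongr
    have h2 : (1 : ℝ) ≤ (1 + Y) ^ (1 / 6 : ℝ) := Real.one_le_rpow (by linarith) (by norm_num)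
    have h3 : (1 + Y') ^ (1 / 6 : ℝ) ≤ (1 + Y) ^ (1 / 6 : ℝ) * (1 + Y') ^ (1 / 6 : ℝ) :=
      le_mul_of_one_le_left (by positivity) h2
    calc _ ≤ Real.log (1 + Y') ^ (2 * μ) * r⁻¹ := by gcongr
      _ ≤ _ := log_rpow_div_le (by linarith) (by linarith) hY' hr
      _ ≤ _ := by gcongr
  rcases le_total Y Y' with h | h
  · exact key hY hY' h
  · rw [mul_comm (Real.log (1 + Y) ^ μ), mul_comm ((1 + Y) ^ (1 / 6 : ℝ))]
    exact key hY' hY h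

lemma rpow_five_fourths_mul_le {a b : ℝ} (ha : 0 ≤ a) (hb : 0 ≤ b) :
    a ^ (5 / 4 : ℝ) * b ^ (5 / 4 : ℝ)
      ≤ 1 / 2 * (a ^ (3 / 2 : ℝ) * b + b ^ (3 / 2 : ℝ) * a) := by
  have e : ∀ {c : ℝ}, 0 ≤ c → c ^ (5 / 4 : ℝ) = (c ^ (1 / 4 : ℝ)) ^ 5
      ∧ c ^ (3 / 2 : ℝ) = (c ^ (1 / 4 : ℝ)) ^ 6 ∧ c = (c ^ (1 / 4 : ℝ)) ^ 4 := fun {c} hc => by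
    refine ⟨?_, ?_, ?_⟩ <;> rw [← Real.rpow_natCast, ← Real.rpow_mul hc] <;> norm_num
  obtain ⟨a1, a2, a3⟩ := e ha
  obtain ⟨b1, b2, b3⟩ := e hb
  set x := a ^ (1 / 4 : ℝ)
  set y := b ^ (1 / 4 : ℝ)
  rw [a1, b1, a2, b2, a3, b3]
  have : 0 ≤ x ^ 4 * y ^ 4 * (x - y) ^ 2 := by positivity
  nlinarith

/-- Young with weights `5/6` and `1/6`, since `5/4 = (3/2)(5/6)`. This fixes `1/6` as the power of
the kinetic energy that the energy bounds can pay for. -/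
lemma rpow_five_fourths_mul_rpow_sixth_le {a k : ℝ} (ha : 0 ≤ a) (hk : 0 ≤ k) :
    a ^ (5 / 4 : ℝ) * k ^ (1 / 6 : ℝ) ≤ a ^ (3 / 2 : ℝ) + k := by
  have h := Real.geom_mean_le_arith_mean2_weighted (w₁ := 5 / 6) (w₂ := 1 / 6)
    (p₁ := a ^ (3 / 2 : ℝ)) (p₂ := k) (by norm_num) (by norm_num) (by positivity) hk (by norm_num)
  rw [← Real.rpow_mul ha] at h
  norm_num at h
  have : 0 ≤ a ^ (3 / 2 : ℝ) := by positivity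
  norm_num
  linarith

end Logarithm

/-! ### Pointwise bounds for the amplitude. -/

/-- The kinetic energy density of the localised flow. -/
noncomputable def locKinetic (lam ϱ : R3 × ℝ → ℝ) (u : R3 × ℝ → R3) (z : R3 × ℝ) : ℝ :=
  locDensity lam ϱ z * ‖locVelocity lam u z‖ ^ 2

/-- The power `5/4` of the localised density with a logarithmic weight. -/
noncomputable def amplitude (μ : ℝ) (lam ϱ : R3 × ℝ → ℝ) (u : R3 × ℝ → R3) (z : R3 × ℝ) : ℝ :=
  locDensity lam ϱ z ^ (5 / 4 : ℝ) * Real.log (1 + locKinetic lam ϱ u z) ^ μ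

section Pointwise

variable {lam ϱ : R3 × ℝ → ℝ} {u : R3 × ℝ → R3} {μ K : ℝ} {z z' : R3 × ℝ}

lemma locDensity_nonneg (hϱ : 0 ≤ ϱ z) : 0 ≤ locDensity lam ϱ z := by
  unfold locDensity; positivity

lemma locKinetic_nonneg (hϱ : 0 ≤ ϱ z) : 0 ≤ locKinetic lam ϱ u z := by
  have := locDensity_nonneg (lam := lam) hϱ
  unfold locKinetic; positivity

lemma amplitude_nonneg (hϱ : 0 ≤ ϱ z) : 0 ≤ amplitude μ lam ϱ u z := by
  have h1 := locDensity_nonneg (lam := lam) hϱ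
  have h2 : 0 ≤ Real.log (1 + locKinetic lam ϱ u z) :=
    Real.log_nonneg (by linarith [locKinetic_nonneg (lam := lam) (u := u) hϱ])
  unfold amplitude; positivity

lemma locDensity_rpow (hl : 0 ≤ lam z) (hϱ : 0 ≤ ϱ z) :
    locDensity lam ϱ z ^ (5 / 4 : ℝ) = lam z ^ 5 * ϱ z ^ (5 / 4 : ℝ) := by
  unfold locDensity
  rw [Real.mul_rpow (by positivity) hϱ]
  congr 1
  rw [← Real.rpow_natCast, ← Real.rpow_mul hl, ← Real.rpow_natCast]; norm_num

lemma locKinetic_eq : locKinetic lam ϱ u z = lam z ^ 6 * (ϱ z * ‖u z‖ ^ 2) := by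
  unfold locKinetic locDensity locVelocity
  rw [norm_smul, mul_pow, Real.norm_eq_abs, sq_abs]; ring

lemma locDensity_rpow_mul_le (hK : 1 ≤ K) (hl : 0 ≤ lam z) (hlK : lam z ≤ K) (hϱ : 0 ≤ ϱ z) :
    locDensity lam ϱ z ^ (5 / 4 : ℝ) * (1 + locKinetic lam ϱ u z) ^ (1 / 6 : ℝ)
      ≤ K ^ 6 * (ϱ z ^ (3 / 2 : ℝ) + (1 + ϱ z * ‖u z‖ ^ 2)) := by
  have hK0 : 0 ≤ K := by linarith
  have hk : 0 ≤ ϱ z * ‖u z‖ ^ 2 := by positivity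
  have h1 : 1 + locKinetic lam ϱ u z ≤ K ^ 6 * (1 + ϱ z * ‖u z‖ ^ 2) := by
    rw [locKinetic_eq]
    have e1 : lam z ^ 6 ≤ K ^ 6 := by gcongr
    have e2 : 1 ≤ K ^ 6 := one_le_pow₀ hK
    nlinarith
  have h2 : (1 + locKinetic lam ϱ u z) ^ (1 / 6 : ℝ)
      ≤ K * (1 + ϱ z * ‖u z‖ ^ 2) ^ (1 / 6 : ℝ) := by
    have h0 := locKinetic_nonneg (lam := lam) (u := u) hϱ
    refine (Real.rpow_le_rpow (by linarith) h1 (by norm_num)).trans (le_of_eq ?_)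
    rw [Real.mul_rpow (by positivity) (by positivity)]
    congr 1
    rw [← Real.rpow_natCast, ← Real.rpow_mul hK0]; norm_num
  have h0 := locKinetic_nonneg (lam := lam) (u := u) hϱ
  rw [locDensity_rpow hl hϱ]
  calc lam z ^ 5 * ϱ z ^ (5 / 4 : ℝ) * (1 + locKinetic lam ϱ u z) ^ (1 / 6 : ℝ)
      ≤ K ^ 5 * ϱ z ^ (5 / 4 : ℝ) * (K * (1 + ϱ z * ‖u z‖ ^ 2) ^ (1 / 6 : ℝ)) := by gcongr
    _ = K ^ 6 * (ϱ z ^ (5 / 4 : ℝ) * (1 + ϱ z * ‖u z‖ ^ 2) ^ (1 / 6 : ℝ)) := by ring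
    _ ≤ _ := by
      gcongr
      exact rpow_five_fourths_mul_rpow_sixth_le hϱ (by positivity)

lemma interactionEnergy_zero_eq (s : ℝ) (h : 0 < ‖z.1 - z'.1‖) :
    Flow.interactionEnergy s 0 lam ϱ z z' = lam z ^ 2 * lam z' ^ 2 * ϱ z ^ (3 / 2 : ℝ) * ϱ z'
      * (ell (‖z.1 - z'.1‖ ^ 2) ^ s * ‖z.1 - z'.1‖⁻¹) := by
  have e : (‖z.1 - z'.1‖ ^ 2) ^ (-(1 / 2) : ℝ) = ‖z.1 - z'.1‖⁻¹ := by
    rw [← Real.rpow_natCast, ← Real.rpow_mul h.le, ← Real.rpow_neg_one]; norm_num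
  unfold Flow.interactionEnergy gker
  rw [add_zero, e, mul_comm (‖z.1 - z'.1‖⁻¹)]

/-- The density powers satisfy `2 (a b)^(5/4) ≤ a^(3/2) b + b^(3/2) a`, which matches the
interaction energy when the logarithms become `ell^(2μ)`. In the other case the kernel has
disappeared and the bound is a product of functions of one point. -/
lemma amplitude_mul_amplitude_le (hμ : 0 ≤ μ) (hμ2 : μ ≤ 2 / 3) (hK : 1 ≤ K)
    (hl : ∀ z, 0 ≤ lam z) (hlK : ∀ z, lam z ≤ K) (hϱ : ∀ z, 0 ≤ ϱ z) (h : 0 < ‖z.1 - z'.1‖) :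
    amplitude μ lam ϱ u z * amplitude μ lam ϱ u z' * ‖z.1 - z'.1‖⁻¹
      ≤ 256 * K ^ 6 * (Flow.interactionEnergy (2 * μ) 0 lam ϱ z z'
          + Flow.interactionEnergy (2 * μ) 0 lam ϱ z' z)
        + 256 * ((locDensity lam ϱ z ^ (5 / 4 : ℝ) * (1 + locKinetic lam ϱ u z) ^ (1 / 6 : ℝ))
          * (locDensity lam ϱ z' ^ (5 / 4 : ℝ) * (1 + locKinetic lam ϱ u z') ^ (1 / 6 : ℝ))) := by
  have hL := log_rpow_mul_log_rpow_div_le hμ hμ2 (locKinetic_nonneg (lam := lam) (u := u) (hϱ z))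
    (locKinetic_nonneg (lam := lam) (u := u) (hϱ z')) h
  have q1 : 0 ≤ locDensity lam ϱ z ^ (5 / 4 : ℝ) :=
    Real.rpow_nonneg (locDensity_nonneg (hϱ z)) _
  have q2 : 0 ≤ locDensity lam ϱ z' ^ (5 / 4 : ℝ) :=
    Real.rpow_nonneg (locDensity_nonneg (hϱ z')) _
  have h' : 0 < ‖z'.1 - z.1‖ := by rwa [norm_sub_rev]
  rw [interactionEnergy_zero_eq _ h, interactionEnergy_zero_eq _ h', norm_sub_rev z'.1 z.1]
  set k := ell (‖z.1 - z'.1‖ ^ 2) ^ (2 * μ) * ‖z.1 - z'.1‖⁻¹ with hk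
  have hk0 : 0 ≤ k := by
    have := ell_pos (w := ‖z.1 - z'.1‖ ^ 2) (by positivity)
    positivity
  have hqq : locDensity lam ϱ z ^ (5 / 4 : ℝ) * locDensity lam ϱ z' ^ (5 / 4 : ℝ)
      ≤ K ^ 6 * (lam z ^ 2 * lam z' ^ 2 * ϱ z ^ (3 / 2 : ℝ) * ϱ z'
        + lam z' ^ 2 * lam z ^ 2 * ϱ z' ^ (3 / 2 : ℝ) * ϱ z) := by
    rw [locDensity_rpow (hl z) (hϱ z), locDensity_rpow (hl z') (hϱ z')]
    have e := rpow_five_fourths_mul_le (hϱ z) (hϱ z')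
    have p1 := hϱ z
    have p2 := hϱ z'
    have l1 := hl z
    have l2 := hl z'
    set S := ϱ z ^ (3 / 2 : ℝ) * ϱ z' + ϱ z' ^ (3 / 2 : ℝ) * ϱ z with hS
    have hS0 : 0 ≤ S := by positivity
    calc lam z ^ 5 * ϱ z ^ (5 / 4 : ℝ) * (lam z' ^ 5 * ϱ z' ^ (5 / 4 : ℝ))
        = lam z ^ 3 * lam z' ^ 3 * (lam z ^ 2 * lam z' ^ 2)
          * (ϱ z ^ (5 / 4 : ℝ) * ϱ z' ^ (5 / 4 : ℝ)) := by ring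
      _ ≤ K ^ 3 * K ^ 3 * (lam z ^ 2 * lam z' ^ 2) * S := by
          gcongr
          · exact hlK z
          · exact hlK z'
          · linarith
      _ = _ := by rw [hS]; ring
  unfold amplitude
  calc _ = locDensity lam ϱ z ^ (5 / 4 : ℝ) * locDensity lam ϱ z' ^ (5 / 4 : ℝ)
        * (Real.log (1 + locKinetic lam ϱ u z) ^ μ * Real.log (1 + locKinetic lam ϱ u z') ^ μ
          * ‖z.1 - z'.1‖⁻¹) := by ring
    _ ≤ locDensity lam ϱ z ^ (5 / 4 : ℝ) * locDensity lam ϱ z' ^ (5 / 4 : ℝ)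
        * (256 * (k + (1 + locKinetic lam ϱ u z) ^ (1 / 6 : ℝ)
            * (1 + locKinetic lam ϱ u z') ^ (1 / 6 : ℝ))) := by gcongr
    _ = 256 * (locDensity lam ϱ z ^ (5 / 4 : ℝ) * locDensity lam ϱ z' ^ (5 / 4 : ℝ)) * k
        + 256 * ((locDensity lam ϱ z ^ (5 / 4 : ℝ) * (1 + locKinetic lam ϱ u z) ^ (1 / 6 : ℝ))
          * (locDensity lam ϱ z' ^ (5 / 4 : ℝ) * (1 + locKinetic lam ϱ u z') ^ (1 / 6 : ℝ))) := by
        ring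
    _ ≤ 256 * (K ^ 6 * (lam z ^ 2 * lam z' ^ 2 * ϱ z ^ (3 / 2 : ℝ) * ϱ z'
          + lam z' ^ 2 * lam z ^ 2 * ϱ z' ^ (3 / 2 : ℝ) * ϱ z)) * k
        + 256 * ((locDensity lam ϱ z ^ (5 / 4 : ℝ) * (1 + locKinetic lam ϱ u z) ^ (1 / 6 : ℝ))
          * (locDensity lam ϱ z' ^ (5 / 4 : ℝ) * (1 + locKinetic lam ϱ u z') ^ (1 / 6 : ℝ))) := by
        gcongr
    _ = _ := by ring

/-- The exponents balance as `(5/4)(4/5) = 1` for the density and `4/5 + 6/5 = 2` for the velocity;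
the logarithm gets `μ · 4/5`, the origin of `α = 4μ/5`. -/
lemma locKinetic_mul_log_le (hϱ : 0 ≤ ϱ z) :
    locKinetic lam ϱ u z * Real.log (1 + locKinetic lam ϱ u z) ^ (4 * μ / 5)
      = (amplitude μ lam ϱ u z * ‖locVelocity lam u z‖) ^ (4 / 5 : ℝ)
        * (‖locVelocity lam u z‖ ^ 6) ^ (1 / 5 : ℝ) := by
  have h1 := locDensity_nonneg (lam := lam) hϱ
  have h2 : 0 ≤ Real.log (1 + locKinetic lam ϱ u z) :=
    Real.log_nonneg (by linarith [locKinetic_nonneg (lam := lam) (u := u) hϱ])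
  unfold amplitude
  rw [Real.mul_rpow (by positivity) (norm_nonneg _), Real.mul_rpow (by positivity) (by positivity),
    ← Real.rpow_mul h1, ← Real.rpow_mul h2, ← Real.rpow_natCast, ← Real.rpow_mul (norm_nonneg _),
    mul_assoc, ← Real.rpow_add_of_nonneg (norm_nonneg _) (by norm_num) (by norm_num),
    show (5 / 4 * (4 / 5) : ℝ) = 1 by norm_num, Real.rpow_one,
    show μ * (4 / 5) = 4 * μ / 5 by ring,
    show (4 / 5 + ((6 : ℕ) : ℝ) * (1 / 5) : ℝ) = (2 : ℕ) by norm_num, Real.rpow_natCast]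
  unfold locKinetic
  ring

end Pointwise

lemma lintegral_mul_add_add_mul {α : Type*} [MeasurableSpace α] {κ : Measure α} {a b k : α → ℝ≥0∞}
    (ha : Measurable a) (hb : Measurable b) (hk : Measurable k) {c d : ℝ≥0∞} :
    ∫⁻ x, (c * (a x + b x) + d * k x) ∂κ
      = c * ((∫⁻ x, a x ∂κ) + ∫⁻ x, b x ∂κ) + d * ∫⁻ x, k x ∂κ := by
  rw [lintegral_add_right _ (hk.const_mul d), lintegral_const_mul _ hk,
    lintegral_const_mul _ (by fun_prop), lintegral_add_left ha]

/-! ### Time slices of the localised flow. -/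

section Cutoff

variable {Ω : Set R3} {T : ℝ} {lam : R3 × ℝ → ℝ}

lemma hasFDerivAt_mk_left (x : R3) (t : ℝ) :
    HasFDerivAt (fun y : R3 => (y, t)) (ContinuousLinearMap.inl ℝ R3 ℝ) x :=
  hasFDerivAt_prodMk_left x t

lemma isClosedEmbedding_mk_left (t : ℝ) : Topology.IsClosedEmbedding fun x : R3 => (x, t) := by
  refine Topology.IsClosedEmbedding.of_continuous_injective_isClosedMap (by fun_prop)
    (fun x y h => (Prod.ext_iff.1 h).1) fun S hS => ?_
  have : (fun x : R3 => (x, t)) '' S = S ×ˢ {t} := by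
    ext ⟨x, r⟩
    simp [eq_comm]
  rw [this]
  exact hS.prod isClosed_singleton

lemma hasCompactSupport_slice (hlam : HasCompactSupport lam) (t : ℝ) :
    HasCompactSupport fun x => lam (x, t) :=
  hlam.comp_isClosedEmbedding (isClosedEmbedding_mk_left t)

lemma IsTest.slice (hlam : IsTest (cylinder Ω T) lam) (t : ℝ) : IsTest Ω fun x => lam (x, t) := by
  refine ⟨hlam.1.comp (by fun_prop), hasCompactSupport_slice hlam.2.1 t, fun x hx => ?_⟩
  have h : tsupport (fun x => lam (x, t)) ⊆ (fun x : R3 => (x, t)) ⁻¹' tsupport lam :=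
    closure_minimal (fun y hy => subset_tsupport _ hy)
      ((isClosed_tsupport lam).preimage (by fun_prop))
  exact (hlam.2.2 (h hx)).1

lemma fderiv_slice (hlam : ContDiff ℝ ∞ lam) (x : R3) (t : ℝ) (j : Fin 3) :
    fderiv ℝ (fun x => lam (x, t)) x (e j) = dx j lam (x, t) := by
  have h1 : HasFDerivAt lam (fderiv ℝ lam (x, t)) (x, t) :=
    ((hlam.differentiable (by simp)) _).hasFDerivAt
  have h2 : HasFDerivAt (fun x => lam (x, t)) _ x := h1.comp x (hasFDerivAt_mk_left x t)
  rw [h2.fderiv]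
  rfl

lemma hasWeakGradient_zero : HasWeakGradient univ (0 : R3 → R3) (0 : R3 → Fin 3 → R3) := by
  have h0 : LocallyIntegrableOn (fun _ : R3 => (0 : R3)) univ :=
    (integrable_zero R3 R3 volume).locallyIntegrable.locallyIntegrableOn _
  exact ⟨h0, fun j => ⟨h0, fun φ _ => by simp⟩⟩

end Cutoff

/-- The weak gradient of the localised velocity. -/
noncomputable def locGradient (lam : R3 × ℝ → ℝ) (u : R3 × ℝ → R3) (Du : R3 × ℝ → Fin 3 → R3)
    (z : R3 × ℝ) (j : Fin 3) : R3 :=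
  lam z • Du z j + dx j lam z • u z

/-- Bounds of a function and of its spatial derivatives. -/
structure SpaceBound (lam : R3 × ℝ → ℝ) (K : ℝ) : Prop where
  one_le : 1 ≤ K
  nonneg : ∀ z, 0 ≤ lam z
  le : ∀ z, lam z ≤ K
  abs_dx_le : ∀ z j, |dx j lam z| ≤ K

namespace Flow

variable {Ω : Set R3} {T ν₁ ν₂ ε m M E : ℝ} {f : R3 × ℝ → R3} {ϱ : R3 × ℝ → ℝ} {u : R3 × ℝ → R3}
  {Du : R3 × ℝ → Fin 3 → R3} {lam : R3 × ℝ → ℝ} {s μ K : ℝ}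

lemma hasWeakGradient_locVelocity (h : Flow Ω T ν₁ ν₂ ε m M E f ϱ u Du)
    (hlam : IsTest (cylinder Ω T) lam) :
    ∀ᵐ t, HasWeakGradient univ (fun x => locVelocity lam u (x, t))
      (fun x => locGradient lam u Du (x, t)) := by
  filter_upwards [(ae_restrict_iff' measurableSet_Ioo).1 h.gradient_weak] with t ht
  by_cases htT : t ∈ Ioo 0 T
  · have := (ht htT).smul_test (hlam.slice t)
    simp only [fderiv_slice hlam.1] at this
    exact this
  · have h1 : ∀ x, lam (x, t) = 0 := fun x => hlam.eq_zero fun hz => htT hz.2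
    have h2 : ∀ x j, dx j lam (x, t) = 0 := fun x j => by
      unfold dx; rw [hlam.fderiv_eq_zero fun hz => htT hz.2]; rfl
    have e1 : (fun x => locVelocity lam u (x, t)) = 0 := by
      funext x; simp [locVelocity, h1]
    have e2 : (fun x => locGradient lam u Du (x, t)) = 0 := by
      funext x j; simp [locGradient, h1, h2]
    rw [e1, e2]
    exact hasWeakGradient_zero

/-- The coefficient of `|u|²` is `7 = 1 + 3 · 2`: one from the velocity itself and two from each of
the three products `∂ⱼλ u`. -/
lemma norm_locGradient_sq_le (hK : SpaceBound lam K) (z : R3 × ℝ) :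
    ‖locVelocity lam u z‖ ^ 2 + ∑ j, ‖locGradient lam u Du z j‖ ^ 2
      ≤ 7 * K ^ 2 * (‖u z‖ ^ 2 + ∑ j, ‖Du z j‖ ^ 2) := by
  have h1 : ∀ j, ‖locGradient lam u Du z j‖ ^ 2 ≤ 2 * K ^ 2 * (‖Du z j‖ ^ 2 + ‖u z‖ ^ 2) := by
    intro j
    have e : ‖locGradient lam u Du z j‖ ≤ K * (‖Du z j‖ + ‖u z‖) := by
      unfold locGradient
      refine (norm_add_le _ _).trans ?_
      rw [norm_smul, norm_smul, mul_add, Real.norm_eq_abs, Real.norm_eq_abs, abs_of_nonneg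
        (hK.nonneg z)]
      have := hK.le z
      have := hK.abs_dx_le z j
      gcongr
    calc ‖locGradient lam u Du z j‖ ^ 2 ≤ (K * (‖Du z j‖ + ‖u z‖)) ^ 2 := by gcongr
      _ = K ^ 2 * (‖Du z j‖ + ‖u z‖) ^ 2 := by ring
      _ ≤ K ^ 2 * (2 * (‖Du z j‖ ^ 2 + ‖u z‖ ^ 2)) := by
          gcongr; exact add_sq_le
      _ = _ := by ring
  have h2 : ‖locVelocity lam u z‖ ^ 2 ≤ K ^ 2 * ‖u z‖ ^ 2 := by
    unfold locVelocity
    rw [norm_smul, mul_pow, Real.norm_eq_abs, abs_of_nonneg (hK.nonneg z)]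
    have := hK.le z
    have := hK.nonneg z
    gcongr
  have h3 := Finset.sum_le_sum fun j (_ : j ∈ Finset.univ) => h1 j
  rw [← Finset.mul_sum, Finset.sum_add_distrib] at h3
  simp only [Finset.sum_const, Finset.card_univ, Fintype.card_fin, nsmul_eq_mul, Nat.cast_ofNat]
    at h3
  have h4 : 0 ≤ K ^ 2 * ∑ j, ‖Du z j‖ ^ 2 := by positivity
  nlinarith

lemma measurable_locVelocity (h : Flow Ω T ν₁ ν₂ ε m M E f ϱ u Du) (hlm : Measurable lam) :
    Measurable (locVelocity lam u) := by
  have := h.measurable_velocity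
  unfold locVelocity; fun_prop

lemma N_sq_le (h : Flow Ω T ν₁ ν₂ ε m M E f ϱ u Du) (hlam : IsTest (cylinder Ω T) lam)
    (hK : SpaceBound lam K) :
    ∀ᵐ t, N (locVelocity lam u) t ^ 2 ≤ ENNReal.ofReal (7 * K ^ 2) * dissip u Du t := by
  filter_upwards [h.hasWeakGradient_locVelocity hlam] with t ht
  unfold N
  rw [ht.sobolevNorm_sq isOpen_univ, Measure.restrict_univ]
  have h1 := h.measurable_velocity
  have h2 := h.measurable_gradient
  unfold dissip
  rw [← lintegral_const_mul _ (by fun_prop)]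
  refine lintegral_mono fun x => ?_
  rw [← ENNReal.ofReal_mul (by positivity)]
  exact ENNReal.ofReal_le_ofReal (norm_locGradient_sq_le hK _)

lemma lintegral_locGradient_le (h : Flow Ω T ν₁ ν₂ ε m M E f ϱ u Du)
    (hlam : IsTest (cylinder Ω T) lam) :
    ∀ᵐ t, ∫⁻ x, ∑ j, ‖locGradient lam u Du (x, t) j‖ₑ ^ 2 ≤ N (locVelocity lam u) t ^ 2 := by
  filter_upwards [h.hasWeakGradient_locVelocity hlam] with t ht
  unfold N
  rw [ht.sobolevNorm_sq isOpen_univ, Measure.restrict_univ]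
  refine lintegral_mono fun x => ?_
  rw [ENNReal.ofReal_add (by positivity) (by positivity),
    ENNReal.ofReal_sum_of_nonneg fun _ _ => by positivity]
  refine le_trans (le_of_eq (Finset.sum_congr rfl fun j _ => ?_)) le_add_self
  rw [ENNReal.ofReal_pow (norm_nonneg _), ofReal_norm]

lemma lintegral_locVelocity_pow_six_le (h : Flow Ω T ν₁ ν₂ ε m M E f ϱ u Du)
    (hlam : IsTest (cylinder Ω T) lam) {C6 : ℝ≥0∞}
    (hC6 : ∀ (g : R3 → R3) (G : R3 → Fin 3 → R3), HasWeakGradient univ g G →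
      HasCompactSupport g → ∫⁻ x, ‖g x‖ₑ ^ 6 ≤ C6 * (∫⁻ x, ∑ j, ‖G x j‖ₑ ^ 2) ^ 3) :
    ∀ᵐ t, ∫⁻ x, ‖locVelocity lam u (x, t)‖ₑ ^ 6 ≤ C6 * (N (locVelocity lam u) t ^ 2) ^ 3 := by
  filter_upwards [h.hasWeakGradient_locVelocity hlam, h.lintegral_locGradient_le hlam] with t h1 h2
  refine (hC6 _ _ h1 ((hasCompactSupport_slice hlam.2.1 t).smul_right)).trans ?_
  gcongr

lemma lintegral_abs_mul_norm_pow_six_le (h : Flow Ω T ν₁ ν₂ ε m M E f ϱ u Du)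
    (hlam : IsTest (cylinder Ω T) lam) (hK : SpaceBound lam K) {C6 : ℝ≥0∞}
    (hC6 : ∀ (g : R3 → R3) (G : R3 → Fin 3 → R3), HasWeakGradient univ g G →
      HasCompactSupport g → ∫⁻ x, ‖g x‖ₑ ^ 6 ≤ C6 * (∫⁻ x, ∑ j, ‖G x j‖ₑ ^ 2) ^ 3) :
    ∀ᵐ t, ∫⁻ x, ENNReal.ofReal ((|lam (x, t)| * ‖u (x, t)‖) ^ 6)
      ≤ C6 * ENNReal.ofReal (7 * K ^ 2) ^ 3 * dissip u Du t ^ 3 := by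
  filter_upwards [h.lintegral_locVelocity_pow_six_le hlam hC6, h.N_sq_le hlam hK] with t h1 h2
  have e : ∀ x, ENNReal.ofReal ((|lam (x, t)| * ‖u (x, t)‖) ^ 6)
      = ‖locVelocity lam u (x, t)‖ₑ ^ 6 := fun x => by
    unfold locVelocity
    rw [ENNReal.ofReal_pow (by positivity), ← Real.norm_eq_abs, ← norm_smul, ofReal_norm]
  simp only [e]
  refine h1.trans ?_
  calc C6 * (N (locVelocity lam u) t ^ 2) ^ 3
      ≤ C6 * (ENNReal.ofReal (7 * K ^ 2) * dissip u Du t) ^ 3 := by gcongr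
    _ = _ := by ring

/-- The interaction energy at a given time. -/
noncomputable def sliceEnergy (s : ℝ) (lam ϱ : R3 × ℝ → ℝ) (t : ℝ) : ℝ≥0∞ :=
  ∫⁻ x, ∫⁻ y, ENNReal.ofReal (interactionEnergy s 0 lam ϱ (x, t) (y, t))

lemma measurable_interactionEnergy (h : Flow Ω T ν₁ ν₂ ε m M E f ϱ u Du) (hlm : Measurable lam) :
    Measurable fun d : (R3 × R3) × ℝ => ENNReal.ofReal
      (interactionEnergy s 0 lam ϱ (d.1.1, d.2) (d.1.2, d.2)) := by
  have := h.measurable_density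
  unfold interactionEnergy
  fun_prop

lemma measurable_sliceEnergy (h : Flow Ω T ν₁ ν₂ ε m M E f ϱ u Du) (hlm : Measurable lam) :
    Measurable (sliceEnergy s lam ϱ) := by
  have h1 := h.measurable_interactionEnergy (s := s) hlm
  have h2 : Measurable fun p : (ℝ × R3) × R3 => ENNReal.ofReal
      (interactionEnergy s 0 lam ϱ (p.1.2, p.1.1) (p.2, p.1.1)) :=
    h1.comp (f := fun p : (ℝ × R3) × R3 => ((p.1.2, p.2), p.1.1)) (by fun_prop)
  exact h2.lintegral_prod_right'.lintegral_prod_right'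

lemma lintegral_sliceEnergy (h : Flow Ω T ν₁ ν₂ ε m M E f ϱ u Du) (hlm : Measurable lam) :
    ∫⁻ t, sliceEnergy s lam ϱ t = ∫⁻ d : (R3 × R3) × ℝ,
      ENNReal.ofReal (interactionEnergy s 0 lam ϱ (d.1.1, d.2) (d.1.2, d.2)) :=
  (lintegral_slices_pair (h.measurable_interactionEnergy hlm)).symm

lemma measurable_locDensity (h : Flow Ω T ν₁ ν₂ ε m M E f ϱ u Du) (hlm : Measurable lam) :
    Measurable (locDensity lam ϱ) := by
  have := h.measurable_density
  unfold locDensity; fun_prop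

lemma measurable_amplitude (h : Flow Ω T ν₁ ν₂ ε m M E f ϱ u Du) (hlm : Measurable lam) :
    Measurable (amplitude μ lam ϱ u) := by
  have h1 := h.measurable_locDensity hlm
  have h2 := h.measurable_locVelocity hlm
  unfold amplitude locKinetic; fun_prop

lemma locDensity_rpow_mul_le_weight (h : Flow Ω T ν₁ ν₂ ε m M E f ϱ u Du) (hK : SpaceBound lam K)
    (z : R3 × ℝ) :
    locDensity lam ϱ z ^ (5 / 4 : ℝ) * (1 + locKinetic lam ϱ u z) ^ (1 / 6 : ℝ)
      ≤ K ^ 6 * weight Ω T ε m ϱ u z := by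
  by_cases hz : z ∈ cylinder Ω T
  · refine (locDensity_rpow_mul_le hK.one_le (hK.nonneg z) (hK.le z) (h.density_nonneg z)).trans ?_
    have hK0 : 0 ≤ K := by linarith [hK.one_le]
    have := rpow_le_pressure (m := m) h.eps_pos.le (h.density_nonneg z)
    gcongr
    simp only [weight, indicator_of_mem hz, Pi.one_apply]
    linarith
  · rw [h.weight_of_notMem hz, mul_zero]
    unfold locDensity
    rw [h.density_zero z hz, mul_zero, Real.zero_rpow (by norm_num), zero_mul]

/-- Integrating the pointwise bound, the kernel term gives twice the interaction energy by symmetry,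
and the term without a kernel is at most the square of the slice bound of the weight. -/
lemma lintegral_amplitude_energy_le (h : Flow Ω T ν₁ ν₂ ε m M E f ϱ u Du) (hlm : Measurable lam)
    (hK : SpaceBound lam K) (hμ : 0 ≤ μ) (hμ2 : μ ≤ 2 / 3) :
    ∀ᵐ t, ∫⁻ x, ∫⁻ y, ENNReal.ofReal (amplitude μ lam ϱ u (x, t))
        * ENNReal.ofReal (amplitude μ lam ϱ u (y, t)) * ‖x - y‖ₑ⁻¹
      ≤ ENNReal.ofReal (512 * K ^ 6) * sliceEnergy (2 * μ) lam ϱ t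
        + ENNReal.ofReal (256 * K ^ 12)
          * (volume Ω + ENNReal.ofReal E + ENNReal.ofReal E) ^ 2 := by
  set W0 := volume Ω + ENNReal.ofReal E + ENNReal.ofReal E
  have hK0 : 0 ≤ K := by linarith [hK.one_le]
  filter_upwards [h.lintegral_weight_le] with t hW
  let IE : R3 → R3 → ℝ≥0∞ := fun x y =>
    ENNReal.ofReal (interactionEnergy (2 * μ) 0 lam ϱ (x, t) (y, t))
  let w : R3 → ℝ≥0∞ := fun x => ENNReal.ofReal (weight Ω T ε m ϱ u (x, t))
  have hIE : Measurable fun p : R3 × R3 => IE p.1 p.2 :=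
    (h.measurable_interactionEnergy hlm).comp (f := fun p : R3 × R3 => (p, t)) (by fun_prop)
  have hIE' : Measurable fun p : R3 × R3 => IE p.2 p.1 :=
    hIE.comp (f := fun p : R3 × R3 => (p.2, p.1)) (by fun_prop)
  have hw : Measurable w := by
    have := h.measurable_weight
    fun_prop
  have hI0 := fun z z' => h.interactionEnergy_nonneg (lam := lam) (s := 2 * μ) le_rfl z z'
  have hpt : ∀ x y : R3, y ≠ x → ENNReal.ofReal (amplitude μ lam ϱ u (x, t))
        * ENNReal.ofReal (amplitude μ lam ϱ u (y, t)) * ‖x - y‖ₑ⁻¹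
      ≤ ENNReal.ofReal (256 * K ^ 6) * (IE x y + IE y x)
        + ENNReal.ofReal (256 * K ^ 12) * (w x * w y) := fun x y hxy => by
    have hn : 0 < ‖x - y‖ := norm_pos_iff.2 (sub_ne_zero.2 hxy.symm)
    have hp := amplitude_mul_amplitude_le (u := u) (z := (x, t)) (z' := (y, t)) hμ hμ2 hK.one_le
      hK.nonneg hK.le h.density_nonneg hn
    have w1 := h.weight_nonneg (x, t)
    have w2 := h.weight_nonneg (y, t)
    have q2 : 0 ≤ locDensity lam ϱ (y, t) ^ (5 / 4 : ℝ)
        * (1 + locKinetic lam ϱ u (y, t)) ^ (1 / 6 : ℝ) := by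
      have e1 := locDensity_nonneg (lam := lam) (h.density_nonneg (y, t))
      have e2 := locKinetic_nonneg (lam := lam) (u := u) (h.density_nonneg (y, t))
      positivity
    have hq : (locDensity lam ϱ (x, t) ^ (5 / 4 : ℝ)
          * (1 + locKinetic lam ϱ u (x, t)) ^ (1 / 6 : ℝ))
        * (locDensity lam ϱ (y, t) ^ (5 / 4 : ℝ)
          * (1 + locKinetic lam ϱ u (y, t)) ^ (1 / 6 : ℝ))
        ≤ (K ^ 6 * weight Ω T ε m ϱ u (x, t)) * (K ^ 6 * weight Ω T ε m ϱ u (y, t)) :=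
      mul_le_mul (h.locDensity_rpow_mul_le_weight hK _) (h.locDensity_rpow_mul_le_weight hK _) q2
        (by positivity)
    rw [← ofReal_norm, ← ENNReal.ofReal_inv_of_pos hn,
      ← ENNReal.ofReal_mul (amplitude_nonneg (h.density_nonneg _)),
      ← ENNReal.ofReal_mul (mul_nonneg (amplitude_nonneg (h.density_nonneg _))
        (amplitude_nonneg (h.density_nonneg _)))]
    simp only [IE, w]
    rw [← ENNReal.ofReal_add (hI0 _ _) (hI0 _ _), ← ENNReal.ofReal_mul w1,
      ← ENNReal.ofReal_mul (by positivity), ← ENNReal.ofReal_mul (by positivity),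
      ← ENNReal.ofReal_add (mul_nonneg (by positivity) (add_nonneg (hI0 _ _) (hI0 _ _)))
        (by positivity)]
    apply ENNReal.ofReal_le_ofReal
    refine hp.trans ?_
    nlinarith
  calc _ ≤ ∫⁻ x, ∫⁻ y, (ENNReal.ofReal (256 * K ^ 6) * (IE x y + IE y x)
        + ENNReal.ofReal (256 * K ^ 12) * (w x * w y)) := by
        refine lintegral_mono fun x => lintegral_mono_ae ?_
        filter_upwards [Measure.ae_ne volume x] with y hy
        exact hpt x y hy
    _ = ∫⁻ x, (ENNReal.ofReal (256 * K ^ 6) * ((∫⁻ y, IE x y) + ∫⁻ y, IE y x)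
        + ENNReal.ofReal (256 * K ^ 12) * (w x * ∫⁻ y, w y)) := by
        refine lintegral_congr fun x => ?_
        have m1 : Measurable fun y => IE x y := hIE.comp (f := fun y => (x, y)) (by fun_prop)
        have m2 : Measurable fun y => IE y x := hIE.comp (f := fun y => (y, x)) (by fun_prop)
        rw [lintegral_mul_add_add_mul m1 m2 (hw.const_mul _), lintegral_const_mul _ hw]
    _ = ENNReal.ofReal (256 * K ^ 6) * ((∫⁻ x, ∫⁻ y, IE x y) + ∫⁻ x, ∫⁻ y, IE y x)
        + ENNReal.ofReal (256 * K ^ 12) * ((∫⁻ x, w x) * ∫⁻ y, w y) := by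
        have m1 : Measurable fun x => ∫⁻ y, IE x y := hIE.lintegral_prod_right'
        have m2 : Measurable fun x => ∫⁻ y, IE y x := hIE'.lintegral_prod_right'
        rw [lintegral_mul_add_add_mul m1 m2 (hw.mul_const _), lintegral_mul_const _ hw]
    _ = ENNReal.ofReal (512 * K ^ 6) * sliceEnergy (2 * μ) lam ϱ t
        + ENNReal.ofReal (256 * K ^ 12) * (∫⁻ x, w x) ^ 2 := by
        have e1 : ∫⁻ x, ∫⁻ y, IE x y = sliceEnergy (2 * μ) lam ϱ t := rfl
        have e2 : ∫⁻ x, ∫⁻ y, IE y x = ∫⁻ x, ∫⁻ y, IE x y :=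
          lintegral_lintegral_swap hIE'.aemeasurable
        rw [e2, e1, show 512 * K ^ 6 = 2 * (256 * K ^ 6) by ring,
          ENNReal.ofReal_mul (p := 2) (by norm_num), ENNReal.ofReal_ofNat]
        ring
    _ ≤ _ := by gcongr

end Flow

/-! ### The logarithmic energy and the integrable factor. -/

lemma rpow_two_fifths_mul_rpow_le {x y : ℝ≥0∞} :
    x ^ (2 / 5 : ℝ) * y ^ (3 / 5 : ℝ) ≤ x + y := by
  calc x ^ (2 / 5 : ℝ) * y ^ (3 / 5 : ℝ) ≤ (x + y) ^ (2 / 5 : ℝ) * (x + y) ^ (3 / 5 : ℝ) := by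
        gcongr
        · exact le_self_add
        · exact le_add_self
    _ = x + y := by
        rw [← ENNReal.rpow_add_of_nonneg _ _ (by norm_num) (by norm_num)]; norm_num

/-- The exponents `2/5` and `3/5` add up to one, so the product is integrable in time when both
factors are; the smaller power `3/8` is dominated after adding `1` to the base. -/
lemma rpow_mul_rpow_add_rpow_le (B X : ℝ≥0∞) :
    (1 + B) ^ (2 / 5 : ℝ) * (X ^ (3 / 5 : ℝ) + X ^ (3 / 8 : ℝ)) ≤ 2 * (2 + B + X) := by
  have h1 : X ^ (3 / 5 : ℝ) ≤ (1 + X) ^ (3 / 5 : ℝ) := by gcongr; exact le_add_self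
  have h2 : X ^ (3 / 8 : ℝ) ≤ (1 + X) ^ (3 / 5 : ℝ) := by
    calc X ^ (3 / 8 : ℝ) ≤ (1 + X) ^ (3 / 8 : ℝ) := by gcongr; exact le_add_self
      _ ≤ (1 + X) ^ (3 / 5 : ℝ) :=
        ENNReal.rpow_le_rpow_of_exponent_le le_self_add (by norm_num)
  calc _ ≤ (1 + B) ^ (2 / 5 : ℝ) * ((1 + X) ^ (3 / 5 : ℝ) + (1 + X) ^ (3 / 5 : ℝ)) := by gcongr
    _ = 2 * ((1 + B) ^ (2 / 5 : ℝ) * (1 + X) ^ (3 / 5 : ℝ)) := by ring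
    _ ≤ 2 * ((1 + B) + (1 + X)) := by gcongr; exact rpow_two_fifths_mul_rpow_le
    _ = _ := by ring

namespace Flow

variable {Ω : Set R3} {T ν₁ ν₂ ε m M E : ℝ} {f : R3 × ℝ → R3} {ϱ : R3 × ℝ → ℝ} {u : R3 × ℝ → R3}
  {Du : R3 × ℝ → Fin 3 → R3} {lam : R3 × ℝ → ℝ} {s μ K : ℝ}

/-- The constant in the bound of the logarithmic energy by the interaction energy. -/
noncomputable def logEnergyConst (Ω : Set R3) (E K : ℝ) (C1 C6 : ℝ≥0∞) : ℝ≥0∞ :=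
  (C1 * (ENNReal.ofReal (512 * K ^ 6) + ENNReal.ofReal (256 * K ^ 12)
    * (volume Ω + ENNReal.ofReal E + ENNReal.ofReal E) ^ 2)) ^ (2 / 5 : ℝ) * C6 ^ (1 / 5 : ℝ)

/-- Hölder with exponents `4/5` and `1/5`. The potential estimate gives `(N² (1 + B))^(2/5)` for the
first factor and the Sobolev inequality `(N⁶)^(1/5)` for the second: altogether `(1 + B)^(2/5) N²`.
-/
theorem H_le (h : Flow Ω T ν₁ ν₂ ε m M E f ϱ u Du) (hlam : IsTest (cylinder Ω T) lam)
    (hK : SpaceBound lam K) (hμ : 0 ≤ μ) (hμ2 : μ ≤ 2 / 3) {C1 C6 : ℝ≥0∞}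
    (hC1 : ∀ (g : R3 → R3) (G : R3 → Fin 3 → R3), HasWeakGradient univ g G →
      HasCompactSupport g → ∀ a : R3 → ℝ≥0∞, Measurable a → (∫⁻ x, a x * ‖g x‖ₑ) ^ 2
        ≤ C1 * (∫⁻ x, ∑ j, ‖G x j‖ₑ ^ 2) * ∫⁻ x, ∫⁻ y, a x * a y * ‖x - y‖ₑ⁻¹)
    (hC6 : ∀ (g : R3 → R3) (G : R3 → Fin 3 → R3), HasWeakGradient univ g G →
      HasCompactSupport g → ∫⁻ x, ‖g x‖ₑ ^ 6 ≤ C6 * (∫⁻ x, ∑ j, ‖G x j‖ₑ ^ 2) ^ 3) :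
    ∀ᵐ t, H (4 * μ / 5) (locDensity lam ϱ) (locVelocity lam u) t
      ≤ logEnergyConst Ω E K C1 C6 * (1 + sliceEnergy (2 * μ) lam ϱ t) ^ (2 / 5 : ℝ)
        * N (locVelocity lam u) t ^ 2 := by
  have hlm : Measurable lam := hlam.1.continuous.measurable
  set W0 := volume Ω + ENNReal.ofReal E + ENNReal.ofReal E with hW0
  filter_upwards [h.hasWeakGradient_locVelocity hlam, h.lintegral_locGradient_le hlam,
    h.lintegral_amplitude_energy_le hlm hK hμ hμ2, h.lintegral_locVelocity_pow_six_le hlam hC6]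
    with t h1 h2 h3 h4
  set n := N (locVelocity lam u) t ^ 2 with hn
  set B := sliceEnergy (2 * μ) lam ϱ t with hB
  set CA := ENNReal.ofReal (512 * K ^ 6) + ENNReal.ofReal (256 * K ^ 12) * W0 ^ 2 with hCA
  let a : R3 → ℝ≥0∞ := fun x => ENNReal.ofReal (amplitude μ lam ϱ u (x, t))
  have ha : Measurable a := by
    have := h.measurable_amplitude (μ := μ) hlm
    fun_prop
  have hvm : Measurable fun x => ‖locVelocity lam u (x, t)‖ₑ := by
    have := h.measurable_locVelocity hlm
    fun_prop
  have hA : ∫⁻ x, ∫⁻ y, a x * a y * ‖x - y‖ₑ⁻¹ ≤ CA * (1 + B) := by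
    refine h3.trans ?_
    rw [hCA, add_mul, mul_add, mul_add, mul_one, mul_one]
    exact add_le_add le_add_self le_self_add
  have hG : (∫⁻ x, a x * ‖locVelocity lam u (x, t)‖ₑ) ^ 2 ≤ C1 * n * (CA * (1 + B)) := by
    refine (hC1 _ _ h1 ((hasCompactSupport_slice hlam.2.1 t).smul_right) a ha).trans ?_
    gcongr
  have hH : H (4 * μ / 5) (locDensity lam ϱ) (locVelocity lam u) t
      = ∫⁻ x, (a x * ‖locVelocity lam u (x, t)‖ₑ) ^ (4 / 5 : ℝ)
        * (‖locVelocity lam u (x, t)‖ₑ ^ 6) ^ (1 / 5 : ℝ) := by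
    refine lintegral_congr fun x => ?_
    have e := locKinetic_mul_log_le (lam := lam) (u := u) (μ := μ) (h.density_nonneg (x, t))
    have e0 := amplitude_nonneg (lam := lam) (u := u) (μ := μ) (h.density_nonneg (x, t))
    simp only [a]
    rw [← ofReal_norm, ← ENNReal.ofReal_mul e0, ← ENNReal.ofReal_pow (norm_nonneg _),
      ENNReal.ofReal_rpow_of_nonneg (by positivity) (by norm_num),
      ENNReal.ofReal_rpow_of_nonneg (by positivity) (by norm_num),
      ← ENNReal.ofReal_mul (by positivity), ← e]
    rfl
  rw [hH]
  have p1 : (∫⁻ x, a x * ‖locVelocity lam u (x, t)‖ₑ) ^ (4 / 5 : ℝ)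
      ≤ (C1 * n * (CA * (1 + B))) ^ (2 / 5 : ℝ) := by
    calc _ = ((∫⁻ x, a x * ‖locVelocity lam u (x, t)‖ₑ) ^ 2) ^ (2 / 5 : ℝ) := by
          rw [← ENNReal.rpow_natCast, ← ENNReal.rpow_mul]; norm_num
      _ ≤ _ := by gcongr
  have p2 : n ^ (2 / 5 : ℝ) * (n ^ 3) ^ (1 / 5 : ℝ) = n := by
    rw [← ENNReal.rpow_natCast, ← ENNReal.rpow_mul,
      ← ENNReal.rpow_add_of_nonneg _ _ (by norm_num) (by norm_num)]
    norm_num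
  calc _ ≤ (∫⁻ x, a x * ‖locVelocity lam u (x, t)‖ₑ) ^ (4 / 5 : ℝ)
        * (∫⁻ x, ‖locVelocity lam u (x, t)‖ₑ ^ 6) ^ (1 / 5 : ℝ) :=
        ENNReal.lintegral_mul_norm_pow_le (ha.mul hvm).aemeasurable (hvm.pow_const 6).aemeasurable
          (by norm_num) (by norm_num) (by norm_num)
    _ ≤ (C1 * n * (CA * (1 + B))) ^ (2 / 5 : ℝ) * (C6 * n ^ 3) ^ (1 / 5 : ℝ) := by gcongr
    _ = (C1 * CA) ^ (2 / 5 : ℝ) * C6 ^ (1 / 5 : ℝ) * (1 + B) ^ (2 / 5 : ℝ)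
        * (n ^ (2 / 5 : ℝ) * (n ^ 3) ^ (1 / 5 : ℝ)) := by
        rw [show C1 * n * (CA * (1 + B)) = C1 * CA * (1 + B) * n by ring,
          ENNReal.mul_rpow_of_nonneg _ n (by norm_num),
          ENNReal.mul_rpow_of_nonneg _ (1 + B) (by norm_num),
          ENNReal.mul_rpow_of_nonneg C6 _ (by norm_num)]
        ring
    _ = _ := by rw [p2]; rfl

/-- The logarithmic kinetic energy of a flow is controlled by powers of the Sobolev norm of the
velocity, with an integrable factor. -/
theorem exists_bound (h : Flow Ω T ν₁ ν₂ ε m M E f ϱ u Du) (hlam : IsTest (cylinder Ω T) lam)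
    (hK : SpaceBound lam K) {C CB : ℝ≥0∞} (hC : C ≠ ⊤) (hCB : CB ≠ ⊤)
    (hB : ∫⁻ t, sliceEnergy (2 * μ) lam ϱ t ≤ CB)
    (hH : ∀ᵐ t, H (4 * μ / 5) (locDensity lam ϱ) (locVelocity lam u) t
      ≤ C * (1 + sliceEnergy (2 * μ) lam ϱ t) ^ (2 / 5 : ℝ) * N (locVelocity lam u) t ^ 2) :
    ∃ F : ℝ → ℝ, (∀ t, 0 ≤ F t) ∧ Integrable F volume ∧
      ∫ t, F t ≤ (C * (2 * (2 * ENNReal.ofReal T + CB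
        + ENNReal.ofReal (7 * K ^ 2) * ENNReal.ofReal (E ^ 2)))).toReal ∧
      ∀ᵐ t : ℝ, N (locVelocity lam u) t < ⊤ ∧
        H (4 * μ / 5) (locDensity lam ϱ) (locVelocity lam u) t
          ≤ ENNReal.ofReal (F t) * N (locVelocity lam u) t ^ (4 / 5 : ℝ) ∧
        H (4 * μ / 5) (locDensity lam ϱ) (locVelocity lam u) t
          ≤ ENNReal.ofReal (F t) * N (locVelocity lam u) t ^ (5 / 4 : ℝ) := by
  have hlm : Measurable lam := hlam.1.continuous.measurable
  set c := ENNReal.ofReal (7 * K ^ 2) with hc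
  have hBm := h.measurable_sliceEnergy (s := 2 * μ) hlm
  have hDm := h.measurable_dissip
  let X : ℝ → ℝ≥0∞ := fun t => c * dissip u Du t
  have hXm : Measurable X := hDm.const_mul c
  -- One factor serves both inequalities. It is defined through `X`, which bounds `N²` almost
  -- everywhere and is measurable, and it is cut off in time because the constant `1` is not
  -- integrable on the line.
  let G : ℝ → ℝ≥0∞ := (Ioo 0 T).indicator fun t =>
    C * ((1 + sliceEnergy (2 * μ) lam ϱ t) ^ (2 / 5 : ℝ)
      * (X t ^ (3 / 5 : ℝ) + X t ^ (3 / 8 : ℝ)))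
  have hGm : Measurable G := by
    refine Measurable.indicator ?_ measurableSet_Ioo
    fun_prop
  have hG : ∫⁻ t, G t ≤ C * (2 * (2 * ENNReal.ofReal T + CB + c * ENNReal.ofReal (E ^ 2))) := by
    simp only [G]
    rw [lintegral_indicator measurableSet_Ioo]
    calc _ ≤ ∫⁻ t in Ioo 0 T, C * (2 * (2 + sliceEnergy (2 * μ) lam ϱ t + X t)) :=
          lintegral_mono fun t => mul_le_mul_right (rpow_mul_rpow_add_rpow_le _ _) C
      _ = C * (2 * (2 * ENNReal.ofReal T + (∫⁻ t in Ioo 0 T, sliceEnergy (2 * μ) lam ϱ t)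
          + c * ∫⁻ t in Ioo 0 T, dissip u Du t)) := by
          rw [lintegral_const_mul _ (by fun_prop), lintegral_const_mul _ (by fun_prop),
            lintegral_add_right _ hXm, lintegral_add_right _ hBm, setLIntegral_const,
            Real.volume_Ioo, sub_zero, lintegral_const_mul _ hDm]
      _ ≤ _ := by
          gcongr
          · exact (setLIntegral_le_lintegral _ _).trans hB
          · exact (setLIntegral_le_lintegral _ _).trans h.lintegral_dissip
  have hfin : C * (2 * (2 * ENNReal.ofReal T + CB + c * ENNReal.ofReal (E ^ 2))) ≠ ⊤ := by
    rw [hc]; finiteness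
  have hGfin : ∫⁻ t, G t ≠ ⊤ := (hG.trans_lt hfin.lt_top).ne
  refine ⟨fun t => (G t).toReal, fun t => ENNReal.toReal_nonneg,
    integrable_toReal_of_lintegral_ne_top hGm.aemeasurable hGfin, ?_, ?_⟩
  · rw [integral_toReal hGm.aemeasurable (ae_lt_top hGm hGfin)]
    exact ENNReal.toReal_mono hfin hG
  · filter_upwards [ae_lt_top hGm hGfin, hH, h.N_sq_le hlam hK, h.ae_dissip_lt_top]
      with t hGt hHt hN hD
    set n := N (locVelocity lam u) t with hn
    have hNt : n < ⊤ := by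
      have : n ^ 2 < ⊤ := hN.trans_lt (ENNReal.mul_lt_top ENNReal.ofReal_lt_top hD)
      by_contra hcon
      rw [not_lt, top_le_iff] at hcon
      simp [hcon] at this
    refine ⟨hNt, ?_⟩
    rw [ENNReal.ofReal_toReal hGt.ne]
    by_cases htT : t ∈ Ioo 0 T
    · have key : ∀ p q r : ℝ, 0 ≤ p → 0 ≤ r → 2 * p + r = 2 → q = p →
          X t ^ q ≤ X t ^ (3 / 5 : ℝ) + X t ^ (3 / 8 : ℝ) →
          H (4 * μ / 5) (locDensity lam ϱ) (locVelocity lam u) t ≤ G t * n ^ r := by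
        intro p q r hp hr hpr hq hX
        have e : n ^ 2 = (n ^ 2) ^ p * n ^ r := by
          rw [← ENNReal.rpow_natCast, ← ENNReal.rpow_mul,
            ← ENNReal.rpow_add_of_nonneg _ _ (by positivity) hr]
          congr 1
          push_cast
          exact hpr.symm
        refine hHt.trans ?_
        rw [e]
        simp only [G, indicator_of_mem htT]
        calc _ ≤ C * (1 + sliceEnergy (2 * μ) lam ϱ t) ^ (2 / 5 : ℝ) * (X t ^ q * n ^ r) := by
              rw [hq]
              gcongr
          _ ≤ C * (1 + sliceEnergy (2 * μ) lam ϱ t) ^ (2 / 5 : ℝ)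
              * ((X t ^ (3 / 5 : ℝ) + X t ^ (3 / 8 : ℝ)) * n ^ r) := by gcongr
          _ = _ := by ring
      exact ⟨key (3 / 5) (3 / 5) _ (by norm_num) (by norm_num) (by norm_num) rfl le_self_add,
        key (3 / 8) (3 / 8) _ (by norm_num) (by norm_num) (by norm_num) rfl le_add_self⟩
    · have h0 : H (4 * μ / 5) (locDensity lam ϱ) (locVelocity lam u) t = 0 := by
        have : ∀ x, lam (x, t) = 0 := fun x => hlam.eq_zero fun hz => htT hz.2
        simp [H, locDensity, this]
      rw [h0]
      exact ⟨zero_le, zero_le⟩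

end Flow

/-! ### Passage from weak solutions to everywhere defined flows. -/

section Congruence

variable {U : Set R3} {g g' : R3 → R3} {G G' : R3 → Fin 3 → R3}

lemma HasWeakGradient.congr (hU : IsOpen U) (hg : ∀ᵐ x ∂(volume.restrict U), g x = g' x)
    (hG : ∀ᵐ x ∂(volume.restrict U), G x = G' x) (h : HasWeakGradient U g G) :
    HasWeakGradient U g' G' := by
  refine ⟨h.1.congr hg, fun j => ⟨(h.2 j).1.congr (hG.mono fun x hx => by rw [hx]),
    fun φ hφ => ?_⟩⟩
  rw [ae_restrict_iff' hU.measurableSet] at hg hG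
  have e1 : ∫ x, (fderiv ℝ φ x (e j)) • g x = ∫ x, (fderiv ℝ φ x (e j)) • g' x := by
    refine integral_congr_ae ?_
    filter_upwards [hg] with x hx
    by_cases hxU : x ∈ U
    · rw [hx hxU]
    · rw [hφ.fderiv_eq_zero hxU]; simp
  have e2 : ∫ x, φ x • G x j = ∫ x, φ x • G' x j := by
    refine integral_congr_ae ?_
    filter_upwards [hG] with x hx
    by_cases hxU : x ∈ U
    · rw [hx hxU]
    · rw [hφ.eq_zero hxU]; simp
  rw [← e1, ← e2]
  exact (h.2 j).2 φ hφ

lemma sobolevNorm_congr (hU : IsOpen U) (hg : ∀ᵐ x ∂(volume.restrict U), g x = g' x) :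
    sobolevNorm U g = sobolevNorm U g' := by
  have hg' : ∀ᵐ x ∂(volume.restrict U), g' x = g x := hg.mono fun x hx => hx.symm
  have hr : ∀ G : R3 → Fin 3 → R3, ∀ᵐ x ∂(volume.restrict U), G x = G x := fun G =>
    ae_of_all _ fun _ => rfl
  unfold sobolevNorm
  congr 1
  refine iInf_congr fun G => iInf_congr_Prop
    ⟨fun h => h.congr hU hg (hr G), fun h => h.congr hU hg' (hr G)⟩ fun _ => ?_
  refine lintegral_congr_ae ?_
  filter_upwards [hg] with x hx
  rw [hx]

end Congruence

lemma ae_ae_slice {P : R3 × ℝ → Prop} (h : ∀ᵐ z, P z) : ∀ᵐ t, ∀ᵐ x, P (x, t) := by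
  have h1 : ∀ᵐ p ∂((volume : Measure ℝ).prod (volume : Measure R3)), P p.swap :=
    Measure.measurePreserving_swap.quasiMeasurePreserving.ae h
  exact Measure.ae_ae_of_ae_prod h1

section Cleaning

variable {Ω : Set R3} {T : ℝ}

/-- The representative is set to zero outside the cylinder and wherever it leaves `S`; because `0 ∈
S`, an almost everywhere constraint becomes an everywhere one. -/
lemma exists_measurable_rep {Y : Type*} [NormedAddCommGroup Y] [MeasurableSpace Y] [BorelSpace Y]
    (hΩ : IsOpen Ω) {A : R3 × ℝ → Y}
    (hA : AEStronglyMeasurable A (volume.restrict (cylinder Ω T))) {S : Set Y}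
    (hS : MeasurableSet S) (h0 : (0 : Y) ∈ S)
    (hAS : ∀ᵐ z ∂(volume.restrict (cylinder Ω T)), A z ∈ S) :
    ∃ A' : R3 × ℝ → Y, Measurable A' ∧ (∀ z, A' z ∈ S) ∧ (∀ z, z ∉ cylinder Ω T → A' z = 0) ∧
      ∀ᵐ z, z ∈ cylinder Ω T → A z = A' z := by
  have hm := hA.stronglyMeasurable_mk.measurable
  have hcyl := Flow.measurableSet_cylinder hΩ T
  refine ⟨(cylinder Ω T ∩ hA.mk A ⁻¹' S).indicator (hA.mk A),
    hm.indicator (hcyl.inter (hm hS)), fun z => ?_, fun z hz => ?_, ?_⟩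
  · by_cases hz : z ∈ cylinder Ω T ∩ hA.mk A ⁻¹' S
    · rw [indicator_of_mem hz]; exact hz.2
    · rw [indicator_of_notMem hz]; exact h0
  · exact indicator_of_notMem (fun h => hz h.1) _
  · have h1 := (ae_restrict_iff' hcyl).1 hA.ae_eq_mk
    have h2 := (ae_restrict_iff' hcyl).1 hAS
    filter_upwards [h1, h2] with z e1 e2 hz
    have : z ∈ cylinder Ω T ∩ hA.mk A ⁻¹' S := ⟨hz, by
      rw [mem_preimage, ← e1 hz]; exact e2 hz⟩
    rw [indicator_of_mem this, e1 hz]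

lemma lintegral_slice_eq {a b : R3 × ℝ → ℝ≥0∞} (hΩ : IsOpen Ω)
    (hb : ∀ z, z ∉ cylinder Ω T → b z = 0) {t : ℝ} (ht : t ∈ Ioo 0 T)
    (hab : ∀ᵐ x, (x, t) ∈ cylinder Ω T → a (x, t) = b (x, t)) :
    ∫⁻ x, b (x, t) = ∫⁻ x in Ω, a (x, t) := by
  rw [← lintegral_indicator hΩ.measurableSet]
  refine lintegral_congr_ae ?_
  filter_upwards [hab] with x hx
  by_cases hxΩ : x ∈ Ω
  · rw [indicator_of_mem hxΩ, hx ⟨hxΩ, ht⟩]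
  · rw [indicator_of_notMem hxΩ, hb _ fun h => hxΩ h.1]

lemma lintegral_slice_eq_zero {b : R3 × ℝ → ℝ≥0∞}
    (hb : ∀ z, z ∉ cylinder Ω T → b z = 0) {t : ℝ} (ht : t ∉ Ioo 0 T) :
    ∫⁻ x, b (x, t) = 0 := by
  simp [hb _ fun h : (_, t) ∈ cylinder Ω T => ht h.2]

lemma setIntegral_cylinder_eq {V : Type*} [NormedAddCommGroup V] [NormedSpace ℝ V]
    (hΩ : IsOpen Ω) {a b : R3 × ℝ → V} (hb : ∀ z, z ∉ cylinder Ω T → b z = 0)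
    (hab : ∀ᵐ z, z ∈ cylinder Ω T → a z = b z) :
    ∫ z in cylinder Ω T, a z = ∫ z, b z := by
  rw [← setIntegral_eq_integral_of_forall_compl_eq_zero hb]
  exact setIntegral_congr_ae (Flow.measurableSet_cylinder hΩ T) hab

/-- Weak solutions of bounded energy coincide almost everywhere with flows. -/
theorem IsWeakSolution.exists_flow {ν₁ ν₂ ε m M E : ℝ} {f : R3 × ℝ → R3} {ϱ : R3 × ℝ → ℝ}
    {u : R3 × ℝ → R3} {Du : R3 × ℝ → Fin 3 → R3} (hΩ : IsOpen Ω) (hΩb : Bornology.IsBounded Ω)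
    (hε : 0 < ε) (hM : 0 ≤ M) (hE : 0 ≤ E)
    (hf : AEStronglyMeasurable f (volume.restrict (cylinder Ω T)))
    (hfM : ∀ᵐ z ∂(volume.restrict (cylinder Ω T)), ‖f z‖ ≤ M)
    (h : IsWeakSolution Ω T ν₁ ν₂ ε m f ϱ u Du) (hen : energy Ω T ε m ϱ u ≤ ENNReal.ofReal E) :
    ∃ f' ϱ' u' Du', Flow Ω T ν₁ ν₂ ε m M E f' ϱ' u' Du' ∧
      (∀ᵐ z, z ∈ cylinder Ω T → ϱ z = ϱ' z) ∧ ∀ᵐ z, z ∈ cylinder Ω T → u z = u' z := by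
  obtain ⟨f', f1, f2, f3, f4⟩ := exists_measurable_rep hΩ hf
    (S := Metric.closedBall 0 M) measurableSet_closedBall (by simpa using hM)
    (hfM.mono fun z hz => by simpa using hz)
  obtain ⟨ϱ', r1, r2, r3, r4⟩ := exists_measurable_rep hΩ h.density_measurable
    (S := Ici 0) measurableSet_Ici (by simp) h.density_nonneg
  obtain ⟨u', u1, -, u3, u4⟩ := exists_measurable_rep hΩ h.velocity_measurable
    (S := univ) MeasurableSet.univ (by simp) (by simp)
  obtain ⟨Du', d1, -, d3, d4⟩ := exists_measurable_rep hΩ h.gradient_measurable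
    (S := univ) MeasurableSet.univ (by simp) (by simp)
  have hcyl := Flow.measurableSet_cylinder hΩ T
  have hpress : ∀ᵐ t ∂(volume.restrict (Ioo 0 T)),
      ∫⁻ x in Ω, ENNReal.ofReal (pressure ε m (ϱ (x, t))) ≤ ENNReal.ofReal E := by
    filter_upwards [ENNReal.ae_le_essSup (μ := volume.restrict (Ioo 0 T))
      fun t => ∫⁻ x in Ω, ENNReal.ofReal (pressure ε m (ϱ (x, t)))] with t ht
    exact ht.trans ((le_self_add.trans le_self_add).trans hen)
  have hkin : ∀ᵐ t ∂(volume.restrict (Ioo 0 T)),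
      ∫⁻ x in Ω, ENNReal.ofReal (ϱ (x, t) * ‖u (x, t)‖ ^ 2) ≤ ENNReal.ofReal E := by
    filter_upwards [ENNReal.ae_le_essSup (μ := volume.restrict (Ioo 0 T))
      fun t => ∫⁻ x in Ω, ENNReal.ofReal (ϱ (x, t) * ‖u (x, t)‖ ^ 2)] with t ht
    exact ht.trans ((le_add_self.trans le_self_add).trans hen)
  have hdis : ∫⁻ t in Ioo 0 T, sobolevNorm Ω (fun x => u (x, t)) ^ 2 ≤ ENNReal.ofReal (E ^ 2) := by
    have h1 : (∫⁻ t in Ioo 0 T, sobolevNorm Ω (fun x => u (x, t)) ^ 2) ^ (1 / 2 : ℝ)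
        ≤ ENNReal.ofReal E := le_add_self.trans hen
    have h2 := pow_le_pow_left' h1 2
    rw [← ENNReal.rpow_natCast, ← ENNReal.rpow_mul, ← ENNReal.ofReal_pow hE] at h2
    norm_num at h2
    exact h2
  have hgrad : ∀ᵐ t ∂(volume.restrict (Ioo 0 T)),
      HasWeakGradient Ω (fun x => u' (x, t)) (fun x => Du' (x, t)) := by
    rw [ae_restrict_iff' measurableSet_Ioo]
    filter_upwards [(ae_restrict_iff' measurableSet_Ioo).1 h.gradient_weak, ae_ae_slice u4,
      ae_ae_slice d4] with t h1 h2 h3 ht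
    refine (h1 ht).congr hΩ ?_ ?_
    · rw [ae_restrict_iff' hΩ.measurableSet]
      filter_upwards [h2] with x hx hxΩ using hx ⟨hxΩ, ht⟩
    · rw [ae_restrict_iff' hΩ.measurableSet]
      filter_upwards [h3] with x hx hxΩ using hx ⟨hxΩ, ht⟩
  refine ⟨f', ϱ', u', Du', ?_, r4, u4⟩
  exact
    { isOpen := hΩ
      bounded := hΩb
      eps_pos := hε
      measurable_density := r1
      measurable_velocity := u1
      measurable_gradient := d1
      measurable_force := f1
      density_nonneg := r2
      density_zero := r3
      velocity_zero := u3
      gradient_zero := d3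
      force_le := fun z => by simpa using f2 z
      pressure_le := by
        filter_upwards [(ae_restrict_iff' measurableSet_Ioo).1 hpress, ae_ae_slice r4] with t h1 h2
        have h0 : ∀ z, z ∉ cylinder Ω T → ENNReal.ofReal (pressure ε m (ϱ' z)) = 0 := fun z hz => by
          rw [r3 z hz, pressure_zero, ENNReal.ofReal_zero]
        by_cases ht : t ∈ Ioo 0 T
        · rw [lintegral_slice_eq (a := fun z => ENNReal.ofReal (pressure ε m (ϱ z)))
            (b := fun z => ENNReal.ofReal (pressure ε m (ϱ' z))) hΩ h0 ht
            (h2.mono fun x hx hz => by rw [hx hz])]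
          exact h1 ht
        · rw [lintegral_slice_eq_zero (b := fun z => ENNReal.ofReal (pressure ε m (ϱ' z))) h0 ht]
          exact zero_le
      kinetic_le := by
        filter_upwards [(ae_restrict_iff' measurableSet_Ioo).1 hkin, ae_ae_slice r4,
          ae_ae_slice u4] with t h1 h2 h3
        have h0 : ∀ z, z ∉ cylinder Ω T → ENNReal.ofReal (ϱ' z * ‖u' z‖ ^ 2) = 0 := fun z hz => by
          rw [r3 z hz, zero_mul, ENNReal.ofReal_zero]
        by_cases ht : t ∈ Ioo 0 T
        · rw [lintegral_slice_eq (a := fun z => ENNReal.ofReal (ϱ z * ‖u z‖ ^ 2))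
            (b := fun z => ENNReal.ofReal (ϱ' z * ‖u' z‖ ^ 2)) hΩ h0 ht
            (by filter_upwards [h2, h3] with x e1 e2 hz; rw [e1 hz, e2 hz])]
          exact h1 ht
        · rw [lintegral_slice_eq_zero (b := fun z => ENNReal.ofReal (ϱ' z * ‖u' z‖ ^ 2)) h0 ht]
          exact zero_le
      dissipation_le := by
        have h0 : ∀ z, z ∉ cylinder Ω T →
            ENNReal.ofReal (‖u' z‖ ^ 2 + ∑ j, ‖Du' z j‖ ^ 2) = 0 := fun z hz => by
          simp [u3 z hz, d3 z hz]
        rw [lintegral_slices (by fun_prop)]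
        refine le_trans ?_ hdis
        rw [← lintegral_indicator measurableSet_Ioo]
        refine lintegral_mono_ae ?_
        filter_upwards [(ae_restrict_iff' measurableSet_Ioo).1 hgrad, ae_ae_slice u4] with t h1 h2
        by_cases ht : t ∈ Ioo 0 T
        · have e : sobolevNorm Ω (fun x => u (x, t)) = sobolevNorm Ω (fun x => u' (x, t)) := by
            refine sobolevNorm_congr hΩ ?_
            rw [ae_restrict_iff' hΩ.measurableSet]
            filter_upwards [h2] with x hx hxΩ using hx ⟨hxΩ, ht⟩
          rw [indicator_of_mem ht, e, (h1 ht).sobolevNorm_sq hΩ]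
          exact le_of_eq (lintegral_slice_eq
            (a := fun z => ENNReal.ofReal (‖u' z‖ ^ 2 + ∑ j, ‖Du' z j‖ ^ 2)) hΩ h0 ht
            (ae_of_all _ fun _ _ => rfl))
        · rw [lintegral_slice_eq_zero
            (b := fun z => ENNReal.ofReal (‖u' z‖ ^ 2 + ∑ j, ‖Du' z j‖ ^ 2)) h0 ht]
          exact zero_le
      gradient_weak := hgrad
      momentum := fun ξ hξ => by
        refine Eq.trans ?_ (h.momentum ξ hξ)
        congr 1
        · congr 1
          · refine (setIntegral_cylinder_eq hΩ (fun z hz => ?_) ?_).symm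
            · rw [r3 z hz, zero_mul]
            · filter_upwards [r4, u4] with z e1 e2 hz
              rw [e1 hz, e2 hz]
          · refine (setIntegral_cylinder_eq hΩ (fun z hz => ?_) ?_).symm
            · simp [r3 z hz, d3 z hz, stress, pressure_zero]
            · filter_upwards [r4, u4, d4] with z e1 e2 e3 hz
              rw [e1 hz, e2 hz, e3 hz]
        · refine (setIntegral_cylinder_eq hΩ (fun z hz => ?_) ?_).symm
          · rw [r3 z hz, zero_mul]
          · filter_upwards [r4, f4] with z e1 e2 hz
            rw [e1 hz, e2 hz]
      mass := fun ψ hψ => by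
        refine Eq.trans ?_ (h.mass ψ hψ)
        refine (setIntegral_cylinder_eq hΩ (fun z hz => ?_) ?_).symm
        · simp [r3 z hz]
        · filter_upwards [r4, u4] with z e1 e2 hz
          rw [e1 hz, e2 hz] }

end Cleaning

/-! ### Uniform constants and the conclusion. -/

section Constants

variable {Ω : Set R3} {T : ℝ} {lam : R3 × ℝ → ℝ}

lemma IsTest.exists_spaceBound (hlam : IsTest (cylinder Ω T) lam) (h0 : ∀ z, 0 ≤ lam z) :
    ∃ K, SpaceBound lam K := by
  obtain ⟨C, hC⟩ := hlam.exists_bound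
  choose D hD using fun j : Fin 3 => hlam.exists_bound_fderiv (e j, (0 : ℝ))
  have hC0 : 0 ≤ C := (norm_nonneg _).trans (hC 0)
  have hD0 : ∀ j, 0 ≤ D j := fun j => (norm_nonneg _).trans (hD j 0)
  have hs : 0 ≤ ∑ j, D j := Finset.sum_nonneg fun j _ => hD0 j
  refine ⟨1 + C + ∑ j, D j, by linarith, h0, fun z => ?_, fun z j => ?_⟩
  · have := (le_abs_self _).trans (hC z)
    linarith
  · have h1 : |dx j lam z| ≤ D j := hD j z
    have h2 := Finset.single_le_sum (fun j _ => hD0 j) (Finset.mem_univ j)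
    linarith

lemma IsTest.exists_cutoffBound (hlam : IsTest (cylinder Ω T) lam) : ∃ L, Flow.CutoffBound lam L := by
  obtain ⟨C, hC⟩ := hlam.exists_bound
  obtain ⟨C', hC'⟩ := hlam.exists_bound_fderiv (0, (1 : ℝ))
  choose D hD using fun j : Fin 3 => hlam.exists_bound_fderiv (e j, (0 : ℝ))
  have hC0 : 0 ≤ C := (norm_nonneg _).trans (hC 0)
  have hC0' : 0 ≤ C' := (norm_nonneg _).trans (hC' 0)
  have hD0 : ∀ j, 0 ≤ D j := fun j => (norm_nonneg _).trans (hD j 0)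
  have hs : 0 ≤ ∑ j, D j := Finset.sum_nonneg fun j _ => hD0 j
  refine ⟨C + C' + ∑ j, D j, fun z => ?_, fun z => ?_, fun j z => ?_⟩
  · have h1 : |lam z| ≤ C := hC z
    linarith
  · have h1 : |dt lam z| ≤ C' := hC' z
    linarith
  · have h1 : |dx j lam z| ≤ D j := hD j z
    have h2 := Finset.single_le_sum (fun j _ => hD0 j) (Finset.mem_univ j)
    linarith

lemma IsTest.sq (hlam : IsTest (cylinder Ω T) lam) :
    IsTest (cylinder Ω T) fun z => lam z ^ 2 := by
  have hs : Function.support (fun z => lam z ^ 2) ⊆ Function.support lam := fun z hz => by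
    simpa using hz
  exact ⟨hlam.1.pow 2, hlam.2.1.mono hs, (closure_mono hs).trans hlam.2.2⟩

end Constants

/-- The integral of the interaction energy is bounded uniformly in the regularisation of the
pressure. -/
theorem exists_lintegral_sliceEnergy_le {Ω : Set R3} (hΩb : Bornology.IsBounded Ω)
    {T ν₁ ν₂ M E s K : ℝ} {lam : R3 × ℝ → ℝ} (hlam : IsTest (cylinder Ω T) lam)
    (hK : SpaceBound lam K) (hM : 0 ≤ M) (hs : 0 ≤ s) (hs2 : s < 4 / 3) :
    ∃ CB : ℝ≥0∞, CB ≠ ⊤ ∧ ∀ (ε m : ℝ) (f : R3 × ℝ → R3) (ϱ : R3 × ℝ → ℝ) (u : R3 × ℝ → R3)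
      (Du : R3 × ℝ → Fin 3 → R3), Flow Ω T ν₁ ν₂ ε m M E f ϱ u Du →
      ∫⁻ t, Flow.sliceEnergy s lam ϱ t ≤ CB := by
  have hlm : Measurable lam := hlam.1.continuous.measurable
  obtain ⟨C6, hC6, h6⟩ := exists_lintegral_pow_six_le_of_hasWeakGradient
  obtain ⟨L, hL⟩ := hlam.sq.exists_cutoffBound
  obtain ⟨R, hR⟩ := Metric.isBounded_iff.1 hΩb
  -- Boundedness gives distances at most `R`, and the kernel bound asks for a strict inequality.
  obtain ⟨Ck, hCk, hk⟩ := exists_lintegral_errKer_le hs hs2 (R + 1)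
  have hvol : volume Ω ≠ ⊤ := hΩb.measure_lt_top.ne
  set W0 := volume Ω + ENNReal.ofReal E + ENNReal.ofReal E with hW0
  have hW : W0 ≠ ⊤ := by rw [hW0]; finiteness
  set A0 := W0 * (ENNReal.ofReal T + ENNReal.ofReal (E ^ 2)) + 3 * ENNReal.ofReal (E ^ 2)
    + C6 * ENNReal.ofReal (7 * K ^ 2) ^ 3 * ENNReal.ofReal (E ^ 2) with hA0
  have hA : A0 ≠ ⊤ := by rw [hA0]; finiteness
  set R0 := W0 * A0 + Ck * A0 + Ck * (W0 * ENNReal.ofReal T) with hR0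
  have hR0t : R0 ≠ ⊤ := by rw [hR0]; finiteness
  refine ⟨ENNReal.ofReal (4 * Flow.interactionConst ν₁ ν₂ M L) * R0, by finiteness,
    fun ε m f ϱ u Du h => ?_⟩
  rw [h.lintegral_sliceEnergy hlm]
  refine h.lintegral_interactionEnergy_zero_le hlm fun δ hδ => ?_
  refine h.lintegral_interactionEnergy_le hlam.sq hlm hM hs (by linarith) hδ hL hR0t ?_
  refine h.lintegral_errLoc_le hlm hδ (fun x hx => hk δ hδ x Ω h.isOpen.measurableSet
    fun y hy => ?_) (h.lintegral_errWeight_le hlm (h.lintegral_abs_mul_norm_pow_six_le hlam hK h6))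
  have := hR hx hy
  rw [dist_eq_norm] at this
  linarith

end CNS

theorem proposition6p1
    (Ω : Set CNS.R3) (hΩ : IsOpen Ω) (hΩb : Bornology.IsBounded Ω) (T : ℝ) (hT : 0 < T)
    (lam : CNS.R3 × ℝ → ℝ) (hlam : CNS.IsTest (CNS.cylinder Ω T) lam) (hlam0 : ∀ z, 0 ≤ lam z)
    (ν₁ ν₂ : ℝ) (hν₁ : 0 < ν₁) (hν : 0 ≤ ν₁ + ν₂)
    (μ : ℝ) (hμ0 : 0 < μ) (hμ1 : μ < 2 / 3) (E M : ℝ) :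
    ∃ c : ℝ, ∀ (ε m : ℝ), 0 < ε → 1 < m →
      ∀ (f : CNS.R3 × ℝ → CNS.R3) (ϱ : CNS.R3 × ℝ → ℝ) (u : CNS.R3 × ℝ → CNS.R3)
        (Du : CNS.R3 × ℝ → Fin 3 → CNS.R3),
      AEStronglyMeasurable f (volume.restrict (CNS.cylinder Ω T)) →
      (∀ᵐ z ∂(volume.restrict (CNS.cylinder Ω T)), ‖f z‖ ≤ M) →
      CNS.IsWeakSolution Ω T ν₁ ν₂ ε m f ϱ u Du →
      CNS.energy Ω T ε m ϱ u ≤ ENNReal.ofReal E →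
      ∃ F : ℝ → ℝ, (∀ t, 0 ≤ F t) ∧ Integrable F volume ∧ ∫ t, F t ≤ c ∧
        ∀ᵐ t : ℝ,
          CNS.N (CNS.locVelocity lam u) t < ⊤ ∧
          CNS.H (4 * μ / 5) (CNS.locDensity lam ϱ) (CNS.locVelocity lam u) t
            ≤ ENNReal.ofReal (F t) * CNS.N (CNS.locVelocity lam u) t ^ (4 / 5 : ℝ) ∧
          CNS.H (4 * μ / 5) (CNS.locDensity lam ϱ) (CNS.locVelocity lam u) t
            ≤ ENNReal.ofReal (F t) * CNS.N (CNS.locVelocity lam u) t ^ (5 / 4 : ℝ) := by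
  obtain ⟨K, hK⟩ := hlam.exists_spaceBound hlam0
  obtain ⟨C1, hC1, h1⟩ := CNS.exists_sq_lintegral_mul_enorm_le
  obtain ⟨C6, hC6, h6⟩ := CNS.exists_lintegral_pow_six_le_of_hasWeakGradient
  -- `E` and `M` may be negative reals; `max E 0` and `|M|` are nonnegative bounds that the solution
  -- satisfies as well.
  obtain ⟨CB, hCB, hB⟩ := CNS.exists_lintegral_sliceEnergy_le (ν₁ := ν₁) (ν₂ := ν₂) (M := |M|)
    (E := max E 0) (s := 2 * μ) hΩb hlam hK (abs_nonneg M) (by linarith) (by linarith)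
  have hvol : volume Ω ≠ ⊤ := hΩb.measure_lt_top.ne
  have hC : CNS.Flow.logEnergyConst Ω (max E 0) K C1 C6 ≠ ⊤ := by
    unfold CNS.Flow.logEnergyConst
    finiteness
  refine ⟨(CNS.Flow.logEnergyConst Ω (max E 0) K C1 C6 * (2 * (2 * ENNReal.ofReal T + CB
    + ENNReal.ofReal (7 * K ^ 2) * ENNReal.ofReal (max E 0 ^ 2)))).toReal,
    fun ε m hε _ f ϱ u Du hf hfM hsol hen => ?_⟩
  obtain ⟨f', ϱ', u', Du', hflow, hϱ, hu⟩ := hsol.exists_flow hΩ hΩb hε (abs_nonneg M)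
    (le_max_right E 0) hf (hfM.mono fun z hz => hz.trans (le_abs_self M))
    (hen.trans (ENNReal.ofReal_le_ofReal (le_max_left E 0)))
  obtain ⟨F, F1, F2, F3, F4⟩ := hflow.exists_bound hlam hK hC hCB (hB ε m f' ϱ' u' Du' hflow)
    (hflow.H_le hlam hK hμ0.le hμ1.le h1 h6)
  refine ⟨F, F1, F2, F3, ?_⟩
  filter_upwards [F4, CNS.ae_ae_slice hϱ, CNS.ae_ae_slice hu] with t ht e1 e2
  have hv : ∀ᵐ x, CNS.locVelocity lam u (x, t) = CNS.locVelocity lam u' (x, t) := by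
    filter_upwards [e2] with x hx
    unfold CNS.locVelocity
    by_cases hz : (x, t) ∈ CNS.cylinder Ω T
    · rw [hx hz]
    · rw [hlam.eq_zero hz, zero_smul, zero_smul]
  have hr : ∀ᵐ x, CNS.locDensity lam ϱ (x, t) = CNS.locDensity lam ϱ' (x, t) := by
    filter_upwards [e1] with x hx
    unfold CNS.locDensity
    by_cases hz : (x, t) ∈ CNS.cylinder Ω T
    · rw [hx hz]
    · rw [hlam.eq_zero hz]; simp
  have hN : CNS.N (CNS.locVelocity lam u) t = CNS.N (CNS.locVelocity lam u') t :=
    CNS.sobolevNorm_congr isOpen_univ (by rwa [Measure.restrict_univ])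
  have hH : CNS.H (4 * μ / 5) (CNS.locDensity lam ϱ) (CNS.locVelocity lam u) t
      = CNS.H (4 * μ / 5) (CNS.locDensity lam ϱ') (CNS.locVelocity lam u') t := by
    refine lintegral_congr_ae ?_
    filter_upwards [hv, hr] with x k1 k2
    rw [k1, k2]
  rw [hN, hH]
  exact ht
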